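/- Let $n\ge 1$, $A\in\mathbb R^{n\times n}$, $C\in\mathbb R^{m\times n}$ with $(A,C)$ observable, and let $Q\in\mathbb R^{n\times n}$, $R\in\mathbb R^{m\times m}$ be symmetric positive definite. For $P>0$ put $L(P)=PC^\top(CPC^\top+R)^{-1}$ and $P^{+}=P-PC^\top(CPC^\top+R)^{-1}CP$, and let $$\gamma(X,\theta)=\tfrac12\bigl(\ln\det(I-\theta X)+\operatorname{tr}((I-\theta X)^{-1}-I)\bigr).$$ The update-resilient Kalman filter with tolerance $c>0$ and initial covariance $P_0>0$ generates $(P_t,\theta_t)_{t\ge0}$ by: $\theta_t>0$ satisfies $I-\theta_tP_t^{+}>0$ and $\gamma(P_t^{+},\theta_t)=c$, and $P_{t+1}=A\bigl((P_t^{+})^{-1}-\theta_tI\bigr)^{-1}A^\top+Q$; write $L_t=L(P_t)$. Given sequences $(L_t,\theta_t)$, the backward recursion over the horizon $\{0,\dots,N\}$ is $\Omega_{N+1}^{-1}=0$ and, for $t=N,\dots,0$, $$W_{t+1}=\theta_tI+\Omega_{t+1}^{-1},\quad O_t=(I-L_t^\top W_{t+1}L_t)^{-1},\quad F_t=-O_tL_t^\top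 W_{t+1}(I-L_tC),$$ $$\Omega_t^{-1}=(F_tA)^\top O_t^{-1}F_tA+(A-L_tCA)^\top W_{t+1}(A-L_tCA),$$ where $\Omega_t^{-1}$ is a symbol for the matrix so defined. The least favorable model over $\{0,\dots,N\}$ has the matrices $$\bar A_t=\begin{bmatrix}A&0&0\\0&A-L_tCA-L_tF_tA&I-L_tF_t-L_tC\\0&0&0\end{bmatrix},\quad \bar B_t=\begin{bmatrix}I&0\\0&-L_t\Upsilon_t\\I&0\end{bmatrix},\quad \bar C_t=\begin{bmatrix}C&F_tA&F_t\end{bmatrix},\quad \bar D_t=\begin{bmatrix}0&\Upsilon_t\end{bmatrix},$$ with $\Upsilon_t\Upsilon_t^\top=O_t$. For $\theta\ge0$ consider the algebraic equation $P=A((P^{+})^{-1}-\theta I)^{-1}A^\top+Q$ in matrices $P>0$ with $(P^{+})^{-1}-\theta I>0$, and let $f(\theta)=(\bar A,L)$ with $L=L(P)$ and $\bar A=(I-LC)A$, where $P$ is the solution. Assume that $f$ is continuous on $[0,\check\theta]$ for some $\check\theta>0$. Then there is $c_{\max}>0$ such that for every $c\in(0,c_{\max}]$ there are $\theta\in(0,\check\theta]$,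 a solution $P$ of the algebraic equation for this $\theta$, with $I-\theta P^{+}>0$, $\gamma(P^{+},\theta)=c$ and $(\bar A,L)=f(\theta)$, $L=L(P)$, and a matrix $W>0$ with $I-L^\top WL>0$, such that: 1. (Steady-state recursion.) For the backward recursion with constant coefficients $L_t=L$, $\theta_t=\theta$, and with $W_t=\theta I+\Omega_t^{-1}$ for $0\le t\le N+1$, one has $I-L^\top W_{t+1}L>0$ for all $0\le t\le N$, and for every $\beta\in(0,1)$, $W_t\to W$ as $N\to\infty$, uniformly over $t\in\{0,\dots,\lceil\beta N\rceil\}$. 2. (Stability.) With $J=\bar A^\top WL(L^\top WL-I)^{-1}$, all eigenvalues of $\bar A-LJ^\top$ have modulus less than $1$. 3. (Steady-state least favorable model.) For every $P_0>0$ the filter sequence $(P_t,\theta_t)$ exists, and $P_t\to P$, $\theta_t\to\theta$, $L_t\to L$ as $t\to\infty$. Let $0<\alpha<\beta<1$ and let $W_t$ be given by the backward recursion with the coefficients $(L_t,\theta_t)$ of the filter. Then, for all sufficiently large $N$, $I-L_t^\top W_{t+1}L_t>0$ for $\lfloor\alpha N\rfloor\le t\le N$; and, as $N\to\infty$, uniformly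 over $t\in\{\lfloor\alpha N\rfloor,\dots,\lceil\beta N\rceil\}$, $W_t\to W$ and the matrices $\bar A_t,\bar B_t,\bar C_t,\bar D_t$ converge to the constant matrices obtained by replacing $(L_t,W_{t+1})$ by $(L,W)$, where $\Upsilon_t=S(O_t)$ for any fixed continuous map $S$ on the positive definite matrices with $S(X)S(X)^\top=X$. -/

import Mathlib

open Filter Topology Matrix

noncomputable section

namespace URKF

variable {n m : ℕ}

/-- `(A, C)` is observable: the observability matrix `[C; CA; …; CA^(n-1)]` has trivial kernel. -/
def Observable (A : Matrix (Fin n) (Fin n) ℝ) (C : Matrix (Fin m) (Fin n) ℝ) : Prop :=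
  ∀ x : Fin n → ℝ, (∀ k < n, C *ᵥ ((A ^ k) *ᵥ x) = 0) → x = 0

/-- A real square matrix is (Schur) stable if all its complex eigenvalues have modulus `< 1`. -/
def Stable (M : Matrix (Fin n) (Fin n) ℝ) : Prop :=
  ∀ μ ∈ spectrum ℂ (M.map (algebraMap ℝ ℂ)), ‖μ‖ < 1

/-- The filtering gain `L = P Cᵀ (C P Cᵀ + R)⁻¹`. -/
def gain (C : Matrix (Fin m) (Fin n) ℝ) (R : Matrix (Fin m) (Fin m) ℝ)
    (P : Matrix (Fin n) (Fin n) ℝ) : Matrix (Fin n) (Fin m) ℝ :=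
  P * Cᵀ * (C * P * Cᵀ + R)⁻¹

/-- The updated covariance `P_{t|t} = P - P Cᵀ (C P Cᵀ + R)⁻¹ C P`. -/
def updCov (C : Matrix (Fin m) (Fin n) ℝ) (R : Matrix (Fin m) (Fin m) ℝ)
    (P : Matrix (Fin n) (Fin n) ℝ) : Matrix (Fin n) (Fin n) ℝ :=
  P - P * Cᵀ * (C * P * Cᵀ + R)⁻¹ * C * P

/-- `γ(X, θ) = ½ (ln det (I - θ X) + tr ((I - θ X)⁻¹ - I))`. -/
def gamma (X : Matrix (Fin n) (Fin n) ℝ) (θ : ℝ) : ℝ :=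
  (1 / 2) * (Real.log (1 - θ • X).det + ((1 - θ • X)⁻¹ - 1).trace)

/-- One step of the distorted Riccati recursion with risk sensitivity parameter `θ`:
`P ↦ A (P_{t|t}⁻¹ - θ I)⁻¹ Aᵀ + Q`. -/
def riccati (A : Matrix (Fin n) (Fin n) ℝ) (C : Matrix (Fin m) (Fin n) ℝ)
    (Q : Matrix (Fin n) (Fin n) ℝ) (R : Matrix (Fin m) (Fin m) ℝ) (θ : ℝ)
    (P : Matrix (Fin n) (Fin n) ℝ) : Matrix (Fin n) (Fin n) ℝ :=
  A * ((updCov C R P)⁻¹ - θ • (1 : Matrix (Fin n) (Fin n) ℝ))⁻¹ * Aᵀ + Q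

/-- `θ` is the risk sensitivity parameter attached to the updated covariance `X` by the
tolerance `c`: the root of `γ(X, θ) = c` in the range `0 < θ < 1 / σ_max(X)`. -/
structure IsRiskParam (c : ℝ) (X : Matrix (Fin n) (Fin n) ℝ) (θ : ℝ) : Prop where
  pos : 0 < θ
  admissible : (1 - θ • X).PosDef
  eq : gamma X θ = c

/-- `(P_t, θ_t)` is the run of the update-resilient Kalman filter with constant tolerance `c`
started at `P₀`. -/
structure IsRun (A : Matrix (Fin n) (Fin n) ℝ) (C : Matrix (Fin m) (Fin n) ℝ)
    (Q : Matrix (Fin n) (Fin n) ℝ) (R : Matrix (Fin m) (Fin m) ℝ) (c : ℝ)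
    (P₀ : Matrix (Fin n) (Fin n) ℝ) (P : ℕ → Matrix (Fin n) (Fin n) ℝ) (θ : ℕ → ℝ) : Prop where
  init : P 0 = P₀
  risk : ∀ t, IsRiskParam c (updCov C R (P t)) (θ t)
  step : ∀ t, P (t + 1) = riccati A C Q R (θ t) (P t)

/-- `P` is an admissible positive definite solution of the algebraic Riccati equation with
parameter `θ`. -/
structure IsSteady (A : Matrix (Fin n) (Fin n) ℝ) (C : Matrix (Fin m) (Fin n) ℝ)
    (Q : Matrix (Fin n) (Fin n) ℝ) (R : Matrix (Fin m) (Fin m) ℝ) (θ : ℝ)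
    (P : Matrix (Fin n) (Fin n) ℝ) : Prop where
  posDef : P.PosDef
  admissible : ((updCov C R P)⁻¹ - θ • (1 : Matrix (Fin n) (Fin n) ℝ)).PosDef
  eq : P = riccati A C Q R θ P

/-- `Ā = (I - L C) A`. -/
def abar (A : Matrix (Fin n) (Fin n) ℝ) (C : Matrix (Fin m) (Fin n) ℝ)
    (L : Matrix (Fin n) (Fin m) ℝ) : Matrix (Fin n) (Fin n) ℝ :=
  (1 - L * C) * A

open Classical in
/-- The solution of the algebraic Riccati equation with parameter `θ` (`0` if there is none). -/
def steadyCov (A : Matrix (Fin n) (Fin n) ℝ) (C : Matrix (Fin m) (Fin n) ℝ)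
    (Q : Matrix (Fin n) (Fin n) ℝ) (R : Matrix (Fin m) (Fin m) ℝ) (θ : ℝ) :
    Matrix (Fin n) (Fin n) ℝ :=
  if h : ∃ P, IsSteady A C Q R θ P then h.choose else 0

/-- The map `f : θ ↦ (Ā, L)`. -/
def steadyMap (A : Matrix (Fin n) (Fin n) ℝ) (C : Matrix (Fin m) (Fin n) ℝ)
    (Q : Matrix (Fin n) (Fin n) ℝ) (R : Matrix (Fin m) (Fin m) ℝ) (θ : ℝ) :
    Matrix (Fin n) (Fin n) ℝ × Matrix (Fin n) (Fin m) ℝ :=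
  (abar A C (gain C R (steadyCov A C Q R θ)), gain C R (steadyCov A C Q R θ))

/-- `O = (I - Lᵀ W L)⁻¹`. -/
def lfO (L : Matrix (Fin n) (Fin m) ℝ) (W : Matrix (Fin n) (Fin n) ℝ) :
    Matrix (Fin m) (Fin m) ℝ :=
  (1 - Lᵀ * W * L)⁻¹

/-- `F = - O Lᵀ W (I - L C)`. -/
def lfF (C : Matrix (Fin m) (Fin n) ℝ) (L : Matrix (Fin n) (Fin m) ℝ)
    (W : Matrix (Fin n) (Fin n) ℝ) : Matrix (Fin m) (Fin n) ℝ :=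
  -(lfO L W * Lᵀ * W * (1 - L * C))

/-- `Ω` is the sequence `Ω_t⁻¹`, `0 ≤ t ≤ N + 1`, of the least favorable model over `{0, …, N}`:
`Ω_{N+1}⁻¹ = 0`, and `Ω_t⁻¹ = (F_t A)ᵀ O_t⁻¹ F_t A + Ā_tᵀ W_{t+1} Ā_t` where
`W_{t+1} = θ_t I + Ω_{t+1}⁻¹`. -/
structure IsBackward (A : Matrix (Fin n) (Fin n) ℝ) (C : Matrix (Fin m) (Fin n) ℝ)
    (L : ℕ → Matrix (Fin n) (Fin m) ℝ) (θ : ℕ → ℝ) (N : ℕ)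
    (Ω : ℕ → Matrix (Fin n) (Fin n) ℝ) : Prop where
  terminal : Ω (N + 1) = 0
  step : ∀ t ≤ N, ∀ W : Matrix (Fin n) (Fin n) ℝ, W = θ t • 1 + Ω (t + 1) →
    Ω t = (lfF C (L t) W * A)ᵀ * (lfO (L t) W)⁻¹ * (lfF C (L t) W * A)
      + (abar A C (L t))ᵀ * W * abar A C (L t)

/-- State matrix of the least favorable model (state `(x_t, e_{t-1}, ε_{t-1})`). -/
def lfA (A : Matrix (Fin n) (Fin n) ℝ) (C : Matrix (Fin m) (Fin n) ℝ)
    (L : Matrix (Fin n) (Fin m) ℝ) (W : Matrix (Fin n) (Fin n) ℝ) :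
    Matrix (Fin n ⊕ (Fin n ⊕ Fin n)) (Fin n ⊕ (Fin n ⊕ Fin n)) ℝ :=
  fromBlocks A 0 0
    (fromBlocks (A - L * C * A - L * lfF C L W * A) (1 - L * lfF C L W - L * C) 0 0)

/-- Input matrix of the least favorable model; `Υ` is a square root of `O`. -/
def lfB (L : Matrix (Fin n) (Fin m) ℝ) (Υ : Matrix (Fin m) (Fin m) ℝ) :
    Matrix (Fin n ⊕ (Fin n ⊕ Fin n)) (Fin n ⊕ Fin m) ℝ :=
  fromBlocks 1 0 (fromRows 0 1) (fromRows (-(L * Υ)) 0)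

/-- Output matrix of the least favorable model. -/
def lfC (A : Matrix (Fin n) (Fin n) ℝ) (C : Matrix (Fin m) (Fin n) ℝ)
    (L : Matrix (Fin n) (Fin m) ℝ) (W : Matrix (Fin n) (Fin n) ℝ) :
    Matrix (Fin m) (Fin n ⊕ (Fin n ⊕ Fin n)) ℝ :=
  fromCols C (fromCols (lfF C L W * A) (lfF C L W))

/-- Feedthrough matrix of the least favorable model. -/
def lfD (n : ℕ) (Υ : Matrix (Fin m) (Fin m) ℝ) : Matrix (Fin m) (Fin n ⊕ Fin m) ℝ :=
  fromCols 0 Υ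

/-- `X N t → x` as `N → ∞`, uniformly over `lo N ≤ t ≤ hi N`. -/
def ConvergesOn {α : Type*} [TopologicalSpace α] (lo hi : ℕ → ℕ) (X : ℕ → ℕ → α) (x : α) : Prop :=
  ∀ U ∈ 𝓝 x, ∀ᶠ N in atTop, ∀ t, lo N ≤ t → t ≤ hi N → X N t ∈ U

/-- A continuous choice of square roots `S(X) S(X)ᵀ = X` of the positive definite matrices. -/
structure IsSqrtMap (S : Matrix (Fin m) (Fin m) ℝ → Matrix (Fin m) (Fin m) ℝ) : Prop where
  sq : ∀ X : Matrix (Fin m) (Fin m) ℝ, X.PosDef → S X * (S X)ᵀ = X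
  cont : ContinuousOn S {X | X.PosDef}

end URKF

end

/-! Everything rests on one contraction estimate in the Thompson metric on positive definite
matrices, in which $X$ and $Y$ are $\log r$-close when $X\le rY$ and $Y\le rX$. Consider a map
$X\mapsto A(X^{-1}-H)^{-1}A^\top+Q$. Inversion and congruence preserve ratios, adding $Q>0$ strictly
shrinks them once $A(X^{-1}-H)^{-1}A^\top\le KQ$, and the subtracted $H$ does little harm if
$H\le\delta(X^{-1}-H)$ with $\delta$ small. This is `smul_sub_le_sub` followed by `conj_inv_add_le`,
and it serves twice.

Forward, $X=P^+$ and $H=\theta I$. The parameter $\theta_t$ depends on $P_t$, but $\gamma(X,\theta)$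
is strictly increasing in $\theta X$, so ratios of $\theta$ are bounded by ratios of $P$
(`IsRiskParam.le_mul`) and the coupled recursion still contracts. The bounds needed for contraction
come from $P_{t+1}\ge Q$, from small $c$ forcing small $\theta_t$ (`exists_tolerance`), and from
observability: $P_n^{-1}$ dominates the least cost of a trajectory ending at a given state, which
gives $P_n\le M I$ whatever the initial covariance (`le_smul_one_of_trajectory`). Comparing a run
with its own shift produces the steady state; comparing any run with that state gives convergence.

Backward, the matrix inversion lemma turns the recursion into $W_t=\theta_{t-1}I+\bar
A_t^\top(W_{t+1}^{-1}-L_tL_t^\top)^{-1}\bar A_t$ (`backward_step_eq`), so now $X=W$ and $H=LL^\top$.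
The steady Riccati equation makes $Y=(P^+)^{-1}$ a Lyapunov matrix for $\bar A$
(`IsSteady.abar_lyapunov`). Hence a region in which $W$ has size of order $\theta$ is invariant, and
there $LL^\top$ is negligible against $W^{-1}$ when $\theta$ is small. The contraction gives the
fixed point $W$, which is itself a Lyapunov matrix for $\bar A-LJ^\top$ (`stable_feedback`).
Coefficients that merely converge perturb each step slightly; away from both ends of the horizon the
accumulated error is small (`exists_interior_ratioLe`), and the least favorable matrices converge
because they are continuous in $(L_t,W_{t+1})$. -/

noncomputable section

set_option linter.unusedSectionVars false

namespace URKF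

/-! ### Loewner order: inversion, bounds, limits. -/

section LoewnerOrder

open scoped MatrixOrder

variable {ι κ : Type*} [Fintype ι] [DecidableEq ι] [Fintype κ] [DecidableEq κ]

theorem _root_.Matrix.PosDef.transpose_eq {X : Matrix ι ι ℝ} (hX : X.PosDef) : Xᵀ = X := by
  have := hX.isHermitian.eq
  rwa [conjTranspose_eq_transpose_of_trivial] at this

theorem _root_.Matrix.PosSemidef.transpose_eq {X : Matrix ι ι ℝ} (hX : X.PosSemidef) : Xᵀ = X := by
  have := hX.isHermitian.eq
  rwa [conjTranspose_eq_transpose_of_trivial] at this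

theorem _root_.Matrix.PosDef.mul_inv {X : Matrix ι ι ℝ} (hX : X.PosDef) : X * X⁻¹ = 1 :=
  mul_nonsing_inv _ ((isUnit_iff_isUnit_det _).1 hX.isUnit)

theorem _root_.Matrix.PosDef.inv_mul {X : Matrix ι ι ℝ} (hX : X.PosDef) : X⁻¹ * X = 1 :=
  nonsing_inv_mul _ ((isUnit_iff_isUnit_det _).1 hX.isUnit)

theorem _root_.Matrix.PosDef.inv_inv {X : Matrix ι ι ℝ} (hX : X.PosDef) : X⁻¹⁻¹ = X :=
  nonsing_inv_nonsing_inv _ ((isUnit_iff_isUnit_det _).1 hX.isUnit)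

theorem _root_.Matrix.PosDef.nonneg {X : Matrix ι ι ℝ} (hX : X.PosDef) : 0 ≤ X :=
  nonneg_iff_posSemidef.2 hX.posSemidef

theorem inv_smul_of_posDef {X : Matrix ι ι ℝ} (hX : X.PosDef) {a : ℝ} (ha : a ≠ 0) :
    (a • X)⁻¹ = a⁻¹ • X⁻¹ := by
  apply inv_eq_right_inv
  rw [smul_mul_smul_comm, hX.mul_inv, mul_inv_cancel₀ ha, one_smul]

theorem posDef_smul_one {a : ℝ} (ha : 0 < a) : (a • (1 : Matrix ι ι ℝ)).PosDef :=
  PosDef.one.smul ha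

theorem inv_smul_one (a : ℝ) : (a • (1 : Matrix ι ι ℝ))⁻¹ = a⁻¹ • 1 := by
  rcases eq_or_ne a 0 with rfl | ha
  · simp
  · rw [inv_smul_of_posDef PosDef.one ha, inv_one]

theorem posDef_iff_quad {X : Matrix ι ι ℝ} :
    X.PosDef ↔ Xᵀ = X ∧ ∀ x : ι → ℝ, x ≠ 0 → 0 < x ⬝ᵥ X *ᵥ x := by
  rw [posDef_iff_dotProduct_mulVec, Matrix.IsHermitian, conjTranspose_eq_transpose_of_trivial]
  simp

theorem posSemidef_iff_quad {X : Matrix ι ι ℝ} :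
    X.PosSemidef ↔ Xᵀ = X ∧ ∀ x : ι → ℝ, 0 ≤ x ⬝ᵥ X *ᵥ x := by
  rw [posSemidef_iff_dotProduct_mulVec, Matrix.IsHermitian, conjTranspose_eq_transpose_of_trivial]
  simp

theorem le_of_quad {X Y : Matrix ι ι ℝ} (hX : Xᵀ = X) (hY : Yᵀ = Y)
    (h : ∀ x : ι → ℝ, x ⬝ᵥ X *ᵥ x ≤ x ⬝ᵥ Y *ᵥ x) : X ≤ Y := by
  rw [le_iff, posSemidef_iff_quad]
  refine ⟨by rw [transpose_sub, hX, hY], fun x => ?_⟩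
  rw [sub_mulVec, dotProduct_sub]
  linarith [h x]

theorem conj_mono {X Y : Matrix ι ι ℝ} (h : X ≤ Y) (B : Matrix κ ι ℝ) :
    B * X * Bᵀ ≤ B * Y * Bᵀ := by
  have := (le_iff.1 h).mul_mul_conjTranspose_same B
  rw [conjTranspose_eq_transpose_of_trivial, Matrix.mul_sub, Matrix.sub_mul] at this
  exact this

theorem conj_mono' {X Y : Matrix ι ι ℝ} (h : X ≤ Y) (B : Matrix ι κ ℝ) :
    Bᵀ * X * B ≤ Bᵀ * Y * B := by
  simpa using conj_mono h Bᵀ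

theorem conj_nonneg {X : Matrix ι ι ℝ} (h : 0 ≤ X) (B : Matrix κ ι ℝ) : 0 ≤ B * X * Bᵀ := by
  simpa using conj_mono h B

theorem mul_transpose_self_nonneg (B : Matrix κ ι ℝ) : 0 ≤ B * Bᵀ := by
  simpa using conj_nonneg (PosDef.one (n := ι) (R := ℝ)).nonneg B

theorem posDef_of_le {X Y : Matrix ι ι ℝ} (hX : X.PosDef) (h : X ≤ Y) : Y.PosDef := by
  simpa using hX.add_posSemidef (le_iff.1 h)

theorem posDef_add_nonneg {X Y : Matrix ι ι ℝ} (hX : X.PosDef) (hY : 0 ≤ Y) : (X + Y).PosDef :=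
  hX.add_posSemidef (nonneg_iff_posSemidef.1 hY)

/-- Both terms on the right are congruences, so the sign of $Y-X$ is visible; antitonicity of
inversion, weak and strict, follows without matrix square roots. -/
theorem inv_sub_inv_eq {X Y : Matrix ι ι ℝ} (hX : X.PosDef) (hY : Y.PosDef) :
    X⁻¹ - Y⁻¹ = Y⁻¹ * (Y - X) * Y⁻¹ + (Y⁻¹ * (Y - X)) * X⁻¹ * ((Y - X) * Y⁻¹) := by
  have h1 : Y⁻¹ * (Y - X) = 1 - Y⁻¹ * X := by rw [Matrix.mul_sub, hY.inv_mul]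
  have h2 : (Y - X) * Y⁻¹ = 1 - X * Y⁻¹ := by rw [Matrix.sub_mul, hY.mul_inv]
  have h3 : (1 - Y⁻¹ * X) * X⁻¹ = X⁻¹ - Y⁻¹ := by
    rw [Matrix.sub_mul, Matrix.mul_assoc, hX.mul_inv, Matrix.one_mul, Matrix.mul_one]
  have h4 : X⁻¹ * (X * Y⁻¹) = Y⁻¹ := by rw [← Matrix.mul_assoc, hX.inv_mul, Matrix.one_mul]
  rw [h1, h2, h3, Matrix.sub_mul 1, Matrix.mul_sub (X⁻¹ - Y⁻¹),
    Matrix.sub_mul X⁻¹ Y⁻¹ (X * Y⁻¹), h4, Matrix.mul_one,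
    Matrix.one_mul, Matrix.mul_assoc]
  abel

theorem inv_antitone {X Y : Matrix ι ι ℝ} (hX : X.PosDef) (h : X ≤ Y) : Y⁻¹ ≤ X⁻¹ := by
  have hY := posDef_of_le hX h
  rw [← sub_nonneg, inv_sub_inv_eq hX hY]
  have hd : (0 : Matrix ι ι ℝ) ≤ Y - X := sub_nonneg.2 h
  have e1 := conj_nonneg hd Y⁻¹
  have e2 := conj_nonneg hX.inv.nonneg (Y⁻¹ * (Y - X))
  have h1 : (Y⁻¹)ᵀ = Y⁻¹ := hY.inv.transpose_eq
  have h2 : (Y⁻¹ * (Y - X))ᵀ = (Y - X) * Y⁻¹ := by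
    rw [transpose_mul, h1, transpose_sub, hY.transpose_eq, hX.transpose_eq]
  rw [h1] at e1
  rw [h2] at e2
  exact add_nonneg e1 e2

theorem inv_sub_inv_posDef {X Y : Matrix ι ι ℝ} (hX : X.PosDef) (h : (Y - X).PosDef) :
    (X⁻¹ - Y⁻¹).PosDef := by
  have hY : Y.PosDef := by simpa using h.add hX
  rw [inv_sub_inv_eq hX hY]
  have h1 : (Y⁻¹)ᵀ = Y⁻¹ := hY.inv.transpose_eq
  have h2 : (Y⁻¹ * (Y - X))ᵀ = (Y - X) * Y⁻¹ := by
    rw [transpose_mul, h1, transpose_sub, hY.transpose_eq, hX.transpose_eq]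
  have e2 := conj_nonneg hX.inv.nonneg (Y⁻¹ * (Y - X))
  rw [h2] at e2
  refine posDef_add_nonneg ?_ e2
  have := h.conjTranspose_mul_mul_same (B := Y⁻¹) (mulVec_injective_of_isUnit hY.inv.isUnit)
  rwa [conjTranspose_eq_transpose_of_trivial, h1] at this

theorem abs_quad_le (X : Matrix ι ι ℝ) (x : ι → ℝ) :
    |x ⬝ᵥ X *ᵥ x| ≤ (∑ i, ∑ j, |X i j|) * (x ⬝ᵥ x) := by
  have hx : ∀ i, x i ^ 2 ≤ x ⬝ᵥ x := fun i => by
    rw [dotProduct]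
    simp_rw [← sq]
    exact Finset.single_le_sum (f := fun i => x i ^ 2) (fun i _ => sq_nonneg _) (Finset.mem_univ i)
  rw [Finset.sum_mul, dotProduct]
  simp only [mulVec, Finset.sum_mul]
  refine (Finset.abs_sum_le_sum_abs _ _).trans (Finset.sum_le_sum fun i _ => ?_)
  rw [dotProduct, Finset.mul_sum]
  refine (Finset.abs_sum_le_sum_abs _ _).trans (Finset.sum_le_sum fun j _ => ?_)
  rw [show x i * (X i j * x j) = X i j * (x i * x j) by ring, abs_mul]
  refine mul_le_mul_of_nonneg_left ?_ (abs_nonneg _)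
  rw [abs_le]
  constructor <;> nlinarith [hx i, hx j, sq_nonneg (x i + x j), sq_nonneg (x i - x j)]

theorem le_sum_abs_smul_one {X : Matrix ι ι ℝ} (hX : Xᵀ = X) :
    X ≤ (∑ i, ∑ j, |X i j|) • 1 := by
  refine le_of_quad hX (by simp) fun x => ?_
  rw [smul_mulVec, one_mulVec, dotProduct_smul, smul_eq_mul]
  exact (le_abs_self _).trans (abs_quad_le X x)

theorem exists_le_smul_one {X : Matrix ι ι ℝ} (hX : Xᵀ = X) :
    ∃ k : ℝ, 0 < k ∧ X ≤ k • 1 := by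
  refine ⟨(∑ i, ∑ j, |X i j|) + 1, by positivity, (le_sum_abs_smul_one hX).trans ?_⟩
  exact smul_le_smul_of_nonneg_right (by linarith) PosDef.one.nonneg

theorem exists_smul_one_le {X : Matrix ι ι ℝ} (hX : X.PosDef) :
    ∃ k : ℝ, 0 < k ∧ k • 1 ≤ X := by
  obtain ⟨k, hk, h⟩ := exists_le_smul_one hX.inv.transpose_eq
  refine ⟨k⁻¹, inv_pos.2 hk, ?_⟩
  have := inv_antitone hX.inv h
  rwa [hX.inv_inv, inv_smul_one] at this

theorem exists_le_smul {X Y : Matrix ι ι ℝ} (hX : Xᵀ = X) (hY : Y.PosDef) :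
    ∃ k : ℝ, 0 < k ∧ X ≤ k • Y := by
  obtain ⟨a, ha, h1⟩ := exists_le_smul_one hX
  obtain ⟨b, hb, h2⟩ := exists_smul_one_le hY
  refine ⟨a / b, by positivity, h1.trans ?_⟩
  have := smul_le_smul_of_nonneg_left h2 (show 0 ≤ a / b by positivity)
  rwa [smul_smul, div_mul_cancel₀ _ hb.ne'] at this

theorem abs_entry_le_trace {X : Matrix ι ι ℝ} (hX : 0 ≤ X) (i j : ι) : |X i j| ≤ X.trace := by
  have hX' := nonneg_iff_posSemidef.1 hX
  have hd : ∀ k, 0 ≤ X k k := fun k => hX'.diag_nonneg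
  have htr : ∀ k, X k k ≤ X.trace := fun k =>
    Finset.single_le_sum (f := fun k => X k k) (fun k _ => hd k) (Finset.mem_univ k)
  have hs : X j i = X i j := by
    conv_lhs => rw [← hX'.transpose_eq]
    rfl
  -- The quadratic form evaluated at $e_i+se_j$; $s=\pm1$ bounds the off-diagonal entry from both
  -- sides.
  have key : ∀ s : ℝ, 0 ≤ X i i + s * X i j + s * X j i + s * s * X j j := fun s => by
    have := (posSemidef_iff_quad.1 hX').2 (Pi.single i 1 + s • Pi.single j 1)
    simp only [mulVec_add, mulVec_smul, dotProduct_add, add_dotProduct, smul_dotProduct,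
      dotProduct_smul, mulVec_single_one, single_dotProduct, one_mul, col_apply, smul_eq_mul] at this
    linarith
  have h1 := key 1
  have h2 := key (-1)
  rw [hs] at h1 h2
  rw [abs_le]
  constructor <;> linarith [htr i, htr j, hd i, hd j]

theorem abs_entry_le {S N : Matrix ι ι ℝ} {ε : ℝ} (h1 : S ≤ ε • N) (h2 : -S ≤ ε • N) (i j : ι) :
    |S i j| ≤ ε * N.trace := by
  have e1 := abs_entry_le_trace (sub_nonneg.2 h1) i j
  have e2 := abs_entry_le_trace (sub_nonneg.2 h2) i j
  simp only [Matrix.sub_apply, Matrix.smul_apply, Matrix.neg_apply, smul_eq_mul, trace_sub, trace_smul, trace_neg]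
    at e1 e2
  rw [abs_le] at *
  constructor <;> linarith [e1.1, e1.2, e2.1, e2.2]

theorem tendsto_matrix_iff {α : Type*} {l : Filter α} {f : α → Matrix ι κ ℝ} {M : Matrix ι κ ℝ} :
    Tendsto f l (𝓝 M) ↔ ∀ i j, Tendsto (fun a => f a i j) l (𝓝 (M i j)) :=
  tendsto_pi_nhds.trans (forall_congr' fun _ => tendsto_pi_nhds)

theorem continuousAt_inv {X : Matrix ι ι ℝ} (hX : X.det ≠ 0) :
    ContinuousAt (fun Y : Matrix ι ι ℝ => Y⁻¹) X := by
  have : (fun Y : Matrix ι ι ℝ => Y⁻¹) = fun Y => (Y.det)⁻¹ • Y.adjugate := by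
    funext Y
    rw [inv_def, Ring.inverse_eq_inv']
  rw [this]
  exact ((continuous_id.matrix_det.continuousAt).inv₀ hX).smul
    continuous_id.matrix_adjugate.continuousAt

theorem tendsto_inv_of_posDef {α : Type*} {l : Filter α} {f : α → Matrix ι ι ℝ} {X : Matrix ι ι ℝ}
    (hf : Tendsto f l (𝓝 X)) (hX : X.PosDef) : Tendsto (fun a => (f a)⁻¹) l (𝓝 X⁻¹) :=
  (continuousAt_inv hX.det_pos.ne').tendsto.comp hf

theorem isClosed_le_matrix : IsClosed {p : Matrix ι ι ℝ × Matrix ι ι ℝ | p.1 ≤ p.2} := by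
  have : {p : Matrix ι ι ℝ × Matrix ι ι ℝ | p.1 ≤ p.2} =
      {p | (p.2 - p.1)ᵀ = p.2 - p.1} ∩ ⋂ x : ι → ℝ, {p | 0 ≤ x ⬝ᵥ (p.2 - p.1) *ᵥ x} := by
    ext p
    simp only [Set.mem_ofPred_eq, le_iff, posSemidef_iff_quad, Set.mem_inter_iff, Set.mem_iInter]
  rw [this]
  refine (isClosed_eq (by fun_prop) (by fun_prop)).inter (isClosed_iInter fun x => ?_)
  refine isClosed_le continuous_const ?_
  exact continuous_const.dotProduct
    (Continuous.matrix_mulVec (continuous_snd.sub continuous_fst) continuous_const)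

instance : OrderClosedTopology (Matrix ι ι ℝ) := ⟨isClosed_le_matrix⟩

/-- Positive definiteness is open only among symmetric matrices, hence the symmetry hypothesis along
the filter. -/
theorem eventually_posDef {α : Type*} {l : Filter α} {f : α → Matrix ι ι ℝ} {X : Matrix ι ι ℝ}
    (hf : Tendsto f l (𝓝 X)) (hX : X.PosDef) (hs : ∀ᶠ a in l, (f a)ᵀ = f a) :
    ∀ᶠ a in l, (f a).PosDef := by
  obtain ⟨k, hk, h⟩ := exists_smul_one_le hX
  have h0 : Tendsto (fun a => ∑ i, ∑ j, |(X - f a) i j|) l (𝓝 0) := by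
    have := tendsto_finsetSum (Finset.univ : Finset ι) fun i _ =>
      tendsto_finsetSum (Finset.univ : Finset ι) fun j _ =>
        ((tendsto_const_nhds (x := X i j)).sub ((tendsto_matrix_iff.1 hf) i j)).abs
    simpa using this
  filter_upwards [hs, h0.eventually (gt_mem_nhds (half_pos hk))] with a ha hlt
  have h1 := le_sum_abs_smul_one (X := X - f a) (by rw [transpose_sub, hX.transpose_eq, ha])
  have h2 : X - f a ≤ (k / 2) • 1 :=
    h1.trans (smul_le_smul_of_nonneg_right hlt.le PosDef.one.nonneg)
  refine posDef_of_le (posDef_smul_one (half_pos hk)) ?_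
  have h3 : k • (1 : Matrix ι ι ℝ) - (k / 2) • 1 ≤ X - (X - f a) := sub_le_sub h h2
  rw [← sub_smul, sub_sub_cancel] at h3
  convert h3 using 2
  ring

end LoewnerOrder

/-! ### Thompson metric: contraction estimate, convergence, completeness. -/

section Thompson

open scoped MatrixOrder

variable {ι κ : Type*} [Fintype ι] [DecidableEq ι] [Fintype κ] [DecidableEq κ]

/-- `X ≤ r Y` and `Y ≤ r X` in the Loewner order: the Thompson distance of `X` and `Y` is at most
`log r`. -/
def RatioLe (r : ℝ) (X Y : Matrix ι ι ℝ) : Prop := X ≤ r • Y ∧ Y ≤ r • X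

theorem RatioLe.symm {r : ℝ} {X Y : Matrix ι ι ℝ} (h : RatioLe r X Y) : RatioLe r Y X := ⟨h.2, h.1⟩

theorem RatioLe.mono {r s : ℝ} {X Y : Matrix ι ι ℝ} (h : RatioLe r X Y) (hrs : r ≤ s)
    (hX : 0 ≤ X) (hY : 0 ≤ Y) : RatioLe s X Y :=
  ⟨h.1.trans (smul_le_smul_of_nonneg_right hrs hY), h.2.trans (smul_le_smul_of_nonneg_right hrs hX)⟩

theorem RatioLe.trans {r s : ℝ} {X Y Z : Matrix ι ι ℝ} (h : RatioLe r X Y) (h' : RatioLe s Y Z)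
    (hr : 0 ≤ r) (hs : 0 ≤ s) : RatioLe (r * s) X Z := by
  constructor
  · rw [mul_smul]
    exact h.1.trans (smul_le_smul_of_nonneg_left h'.1 hr)
  · rw [mul_comm, mul_smul]
    exact h'.2.trans (smul_le_smul_of_nonneg_left h.2 hs)

theorem ratioLe_of_mem_Icc {a b : Matrix ι ι ℝ} {r : ℝ} (hr : 0 ≤ r) (hab : b ≤ r • a)
    {X Y : Matrix ι ι ℝ} (hX : a ≤ X) (hX' : X ≤ b) (hY : a ≤ Y) (hY' : Y ≤ b) : RatioLe r X Y :=
  ⟨(hX'.trans hab).trans (smul_le_smul_of_nonneg_left hY hr),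
    (hY'.trans hab).trans (smul_le_smul_of_nonneg_left hX hr)⟩

/-- The left-hand difference is at least $r^{-1}X^{-1}-rH=r^{-1}(X^{-1}-H)-(r-r^{-1})H$, and the
last term is absorbed by the smallness of $H$. The loss beyond $r^{-1}$ is thus of order
$\delta(r-1)$, which a strict contraction can afford. -/
theorem smul_sub_le_sub {X X' H H' : Matrix ι ι ℝ} {r δ : ℝ} (hX : X.PosDef) (hX' : X'.PosDef)
    (hr : 1 ≤ r) (h : X' ≤ r • X) (hH : H' ≤ r • H) (hδ : H ≤ δ • (X⁻¹ - H)) :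
    (r⁻¹ * (1 - (r ^ 2 - 1) * δ)) • (X⁻¹ - H) ≤ X'⁻¹ - H' := by
  have hr0 : 0 < r := by linarith
  have h1 : r⁻¹ • X⁻¹ ≤ X'⁻¹ := by
    rw [← inv_smul_of_posDef hX hr0.ne']
    exact inv_antitone hX' h
  have h2 : ((r ^ 2 - 1) * r⁻¹) • H ≤ ((r ^ 2 - 1) * r⁻¹) • (δ • (X⁻¹ - H)) :=
    smul_le_smul_of_nonneg_left hδ (mul_nonneg (by nlinarith) (inv_nonneg.2 hr0.le))
  have h3 : r⁻¹ • X⁻¹ - r • H - ((r ^ 2 - 1) * r⁻¹) • (δ • (X⁻¹ - H)) ≤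
      X'⁻¹ - H' - ((r ^ 2 - 1) * r⁻¹) • H := sub_le_sub (sub_le_sub h1 hH) h2
  have h4 : r⁻¹ • X⁻¹ - r • H - ((r ^ 2 - 1) * r⁻¹) • (δ • (X⁻¹ - H)) + ((r ^ 2 - 1) * r⁻¹) • H ≤
      X'⁻¹ - H' := by
    have := add_le_add_left h3 (((r ^ 2 - 1) * r⁻¹) • H)
    simpa using this
  refine le_of_eq_of_le ?_ h4
  have e : r = r ^ 2 * r⁻¹ := by field_simp
  have : r⁻¹ • X⁻¹ - r • H - ((r ^ 2 - 1) * r⁻¹) • (δ • (X⁻¹ - H)) + ((r ^ 2 - 1) * r⁻¹) • H =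
      r⁻¹ • X⁻¹ - (r ^ 2 * r⁻¹) • H - ((r ^ 2 - 1) * r⁻¹) • (δ • (X⁻¹ - H)) +
        ((r ^ 2 - 1) * r⁻¹) • H := by
    rw [← e]
  rw [this]
  module

/-- Without loss ($\delta=0$) the term $B=AD^{-1}A^\top\le KQ$ grows by $r$ while $Q$ stays fixed,
so the excess $r-1$ shrinks by $K/(K+1)$. The rate $(2K+1)/(2K+2)$ lies midway between this and $1$;
the margin pays for $\delta$, uniformly for $r\le\rho$. -/
theorem conj_inv_add_le {D D' Q : Matrix ι ι ℝ} {A : Matrix ι ι ℝ} {K δ r ρ : ℝ} (hD : D.PosDef)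
    (h : (r⁻¹ * (1 - (r ^ 2 - 1) * δ)) • D ≤ D') (hr : 1 ≤ r) (hrρ : r ≤ ρ) (hK : 0 < K)
    (hB : A * D⁻¹ * Aᵀ ≤ K • Q) (hδ0 : 0 ≤ δ)
    (hδ : δ * (K * (ρ + 1) + (K + 1 / 2) * (ρ ^ 2 - 1)) ≤ 1 / 2) :
    A * D'⁻¹ * Aᵀ + Q ≤ (1 + (2 * K + 1) / (2 * K + 2) * (r - 1)) • (A * D⁻¹ * Aᵀ + Q) := by
  have hδr : δ * (K * (r + 1) + (K + 1 / 2) * (r ^ 2 - 1)) ≤ 1 / 2 := by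
    refine le_trans (mul_le_mul_of_nonneg_left ?_ hδ0) hδ
    gcongr
  have hr0 : 0 < r := by linarith
  have hpos : 0 < 1 - (r ^ 2 - 1) * δ := by
    have : 0 ≤ δ * K * (r + 1) := by positivity
    have h2 : 0 ≤ δ * K * (r ^ 2 - 1) := by
      have : 0 ≤ r ^ 2 - 1 := by nlinarith
      positivity
    by_contra! hc
    nlinarith
  set s := r⁻¹ * (1 - (r ^ 2 - 1) * δ) with hs
  have hs0 : 0 < s := by positivity
  have h1 : D'⁻¹ ≤ s⁻¹ • D⁻¹ := by
    rw [← inv_smul_of_posDef hD hs0.ne']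
    exact inv_antitone (hD.smul hs0) h
  have h2 : A * D'⁻¹ * Aᵀ ≤ s⁻¹ • (A * D⁻¹ * Aᵀ) := by
    have := conj_mono h1 A
    rwa [Matrix.mul_smul, Matrix.smul_mul] at this
  have hBn : 0 ≤ A * D⁻¹ * Aᵀ := conj_nonneg hD.inv.nonneg A
  set B := A * D⁻¹ * Aᵀ
  -- The smallness condition on $\delta$ is exactly what this inequality requires, as the
  -- factorization below shows.
  have hsc : s⁻¹ ≤ 1 + (2 * K + 1) / (2 * K) * (r - 1) := by
    rw [inv_le_iff_one_le_mul₀ hs0, hs]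
    have : (1 + (2 * K + 1) / (2 * K) * (r - 1)) * (r⁻¹ * (1 - (r ^ 2 - 1) * δ)) - 1 =
        r⁻¹ * K⁻¹ * (r - 1) * (1 / 2 - δ * (K * (r + 1) + (K + 1 / 2) * (r ^ 2 - 1))) := by
      field_simp
      ring
    have h0 : 0 ≤ r⁻¹ * K⁻¹ * (r - 1) *
        (1 / 2 - δ * (K * (r + 1) + (K + 1 / 2) * (r ^ 2 - 1))) := by
      have : 0 ≤ r - 1 := by linarith
      have : 0 ≤ 1 / 2 - δ * (K * (r + 1) + (K + 1 / 2) * (r ^ 2 - 1)) := by linarith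
      positivity
    linarith
  set c := (2 * K + 1) / (2 * K + 2) * (r - 1) with hc
  have hcn : 0 ≤ c := mul_nonneg (by positivity) (by linarith)
  -- The excess growth of $B$ beyond the factor $1+c$ is paid from the unused share $cQ$, using
  -- $B\le KQ$.
  have hcoef : s⁻¹ - 1 - c ≤ c / K := by
    have : c + c / K = (2 * K + 1) / (2 * K) * (r - 1) := by
      rw [hc]
      field_simp
    linarith
  have h3 : (s⁻¹ - 1 - c) • B ≤ c • Q := by
    refine (smul_le_smul_of_nonneg_right hcoef hBn).trans ?_
    have := smul_le_smul_of_nonneg_left hB (show 0 ≤ c / K by positivity)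
    rwa [smul_smul, div_mul_cancel₀ _ hK.ne'] at this
  calc A * D'⁻¹ * Aᵀ + Q ≤ s⁻¹ • B + Q := add_le_add_left h2 Q
    _ = (s⁻¹ - 1 - c) • B + ((1 + c) • B + Q) := by module
    _ ≤ c • Q + ((1 + c) • B + Q) := add_le_add_left h3 _
    _ = (1 + c) • (B + Q) := by module

theorem RatioLe.abs_sub_le {X Y : Matrix ι ι ℝ} {u : ℝ} (h : RatioLe (1 + u) Y X) (hX : 0 ≤ X)
    (hu : 0 ≤ u) (i j : ι) : |Y i j - X i j| ≤ u * (1 + u) * X.trace := by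
  rw [← Matrix.sub_apply]
  refine abs_entry_le ?_ ?_ i j
  · rw [sub_le_iff_le_add]
    refine h.1.trans ?_
    rw [← sub_nonneg]
    have : (u * (1 + u)) • X + X - (1 + u) • X = (u * u) • X := by module
    rw [this]
    exact smul_nonneg (mul_self_nonneg _) hX
  · rw [neg_sub, mul_smul]
    have h1 : X - Y ≤ u • Y := by
      rw [sub_le_iff_le_add]
      refine h.2.trans (le_of_eq ?_)
      module
    exact h1.trans (smul_le_smul_of_nonneg_left h.1 hu)

/-- Ratios tending to $1$ control entries, since an entry of a difference squeezed between
$\pm\varepsilon X$ is bounded by a multiple of $\varepsilon\operatorname{tr}X$. -/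
theorem tendsto_of_forall_ratioLe {α : Type*} {l : Filter α} {f : α → Matrix ι ι ℝ}
    {X : Matrix ι ι ℝ} (hX : 0 ≤ X) (h : ∀ ε : ℝ, 0 < ε → ∀ᶠ a in l, RatioLe (1 + ε) (f a) X) :
    Tendsto f l (𝓝 X) := by
  rw [tendsto_matrix_iff]
  intro i j
  rw [Metric.tendsto_nhds]
  intro ε hε
  have hlim : Tendsto (fun u : ℝ => u * (1 + u) * X.trace) (𝓝[>] 0) (𝓝 0) := by
    have : Continuous fun u : ℝ => u * (1 + u) * X.trace := by fun_prop
    simpa using (this.tendsto 0).mono_left nhdsWithin_le_nhds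
  obtain ⟨u, hu, hu0⟩ := ((hlim.eventually (gt_mem_nhds hε)).and self_mem_nhdsWithin).exists
  filter_upwards [h u hu0] with a ha
  rw [Real.dist_eq]
  exact (ha.abs_sub_le hX (le_of_lt hu0) i j).trans_lt hu

theorem tendsto_of_ratioLe {α : Type*} {l : Filter α} {f : α → Matrix ι ι ℝ} {X : Matrix ι ι ℝ}
    {u : α → ℝ} (hX : 0 ≤ X) (hu : Tendsto u l (𝓝 0)) (hf : ∀ a, 0 ≤ f a)
    (h : ∀ᶠ a in l, RatioLe (1 + u a) (f a) X) : Tendsto f l (𝓝 X) := by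
  refine tendsto_of_forall_ratioLe hX fun ε hε => ?_
  filter_upwards [h, hu.eventually (gt_mem_nhds hε)] with a ha hlt
  exact ha.mono (by linarith) (hf a) hX

theorem eventually_ratioLe_of_tendsto {α : Type*} {l : Filter α} {f : α → Matrix ι ι ℝ}
    {X : Matrix ι ι ℝ} (hX : X.PosDef) (hf : Tendsto f l (𝓝 X)) (hs : ∀ᶠ a in l, (f a)ᵀ = f a)
    {ε : ℝ} (hε : 0 < ε) : ∀ᶠ a in l, RatioLe (1 + ε) (f a) X := by
  have e : (1 + ε) • X - X = ε • X := by module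
  have h1 := eventually_posDef ((tendsto_const_nhds (x := (1 + ε) • X)).sub hf)
    (by rw [e]; exact hX.smul hε) (by
      filter_upwards [hs] with a ha
      rw [transpose_sub, transpose_smul, hX.transpose_eq, ha])
  have h2 := eventually_posDef ((hf.const_smul (1 + ε)).sub (tendsto_const_nhds (x := X)))
    (by rw [e]; exact hX.smul hε) (by
      filter_upwards [hs] with a ha
      rw [transpose_sub, transpose_smul, hX.transpose_eq, ha])
  filter_upwards [h1, h2] with a h1 h2
  exact ⟨sub_nonneg.1 h1.nonneg, sub_nonneg.1 h2.nonneg⟩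

/-- The common upper bound converts geometric decay of the ratios into geometric decay of entry
increments, so each entry is Cauchy. -/
theorem exists_tendsto_of_ratioLe {X : ℕ → Matrix ι ι ℝ} {N : Matrix ι ι ℝ} {C q : ℝ}
    (hC : 0 ≤ C) (hq0 : 0 ≤ q) (hq1 : q < 1) (hN : ∀ t, X t ≤ N)
    (h : ∀ t, RatioLe (1 + C * q ^ t) (X t) (X (t + 1))) :
    ∃ L, Tendsto X atTop (𝓝 L) := by
  have key : ∀ i j, ∃ l, Tendsto (fun t => X t i j) atTop (𝓝 l) := by
    intro i j
    refine cauchySeq_tendsto_of_complete ?_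
    refine cauchySeq_of_le_geometric q (C * N.trace) hq1 fun t => ?_
    rw [Real.dist_eq, ← Matrix.sub_apply,
      show C * N.trace * q ^ t = (C * q ^ t) * N.trace by ring]
    have hp : 0 ≤ C * q ^ t := by positivity
    refine abs_entry_le ?_ ?_ i j
    · refine le_trans ?_ (smul_le_smul_of_nonneg_left (hN (t + 1)) hp)
      rw [sub_le_iff_le_add]
      refine (h t).1.trans (le_of_eq ?_)
      module
    · refine le_trans ?_ (smul_le_smul_of_nonneg_left (hN t) hp)
      rw [neg_sub, sub_le_iff_le_add]
      refine (h t).2.trans (le_of_eq ?_)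
      module
  choose L hL using key
  exact ⟨Matrix.of L, tendsto_matrix_iff.2 fun i j => hL i j⟩

end Thompson

/-! ### The risk sensitivity parameter: existence, monotonicity, smallness. -/

section RiskParameter

open scoped MatrixOrder

variable {ι κ : Type*} [Fintype ι] [DecidableEq ι] [Fintype κ] [DecidableEq κ] {n : ℕ}

theorem exists_orthogonal_diagonalization {X : Matrix ι ι ℝ} (hX : X.PosDef) :
    ∃ (U : Matrix ι ι ℝ) (d : ι → ℝ), X = U * diagonal d * Uᵀ ∧ Uᵀ * U = 1 ∧ U * Uᵀ = 1 ∧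
      ∀ i, 0 < d i := by
  refine ⟨hX.1.eigenvectorUnitary, hX.1.eigenvalues, ?_, ?_, ?_, hX.eigenvalues_pos⟩
  · conv_lhs => rw [hX.1.spectral_theorem, Unitary.conjStarAlgAut_apply]
    rw [star_eq_conjTranspose, conjTranspose_eq_transpose_of_trivial]
    rfl
  · have := Unitary.coe_star_mul_self hX.1.eigenvectorUnitary
    rwa [star_eq_conjTranspose, conjTranspose_eq_transpose_of_trivial] at this
  · have := Unitary.coe_mul_star_self hX.1.eigenvectorUnitary
    rwa [Unitary.coe_star, star_eq_conjTranspose, conjTranspose_eq_transpose_of_trivial] at this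

theorem exists_transpose_mul_self {X : Matrix ι ι ℝ} (hX : X.PosDef) :
    ∃ B : Matrix ι ι ℝ, X = Bᵀ * B := by
  obtain ⟨U, d, h, -, -, hd⟩ := exists_orthogonal_diagonalization hX
  refine ⟨diagonal (fun i => √(d i)) * Uᵀ, ?_⟩
  rw [transpose_mul, transpose_transpose, diagonal_transpose, Matrix.mul_assoc U,
    ← Matrix.mul_assoc (diagonal _), diagonal_mul_diagonal, ← Matrix.mul_assoc, h]
  simp_rw [Real.mul_self_sqrt (hd _).le]

theorem log_det_le {X : Matrix ι ι ℝ} (hX : X.PosDef) : Real.log X.det ≤ X.trace - Fintype.card ι := by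
  rw [hX.1.det_eq_prod_eigenvalues, hX.1.trace_eq_sum_eigenvalues]
  simp only [RCLike.ofReal_real_eq_id, id_eq]
  rw [Real.log_prod fun i _ => (hX.eigenvalues_pos i).ne']
  calc _ ≤ ∑ i, (hX.1.eigenvalues i - 1) :=
        Finset.sum_le_sum fun i _ => Real.log_le_sub_one_of_pos (hX.eigenvalues_pos i)
    _ = _ := by simp [Finset.sum_sub_distrib]

theorem posDef_conj {X B : Matrix ι ι ℝ} (hX : X.PosDef) (hB : IsUnit B) :
    (B * X * Bᵀ).PosDef := by
  have := hX.mul_mul_conjTranspose_same (B := B) (vecMul_injective_of_isUnit hB)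
  rwa [conjTranspose_eq_transpose_of_trivial] at this

/-- Tangent-line form of the concavity of $\ln\det$: writing $X^{-1}=B^\top B$ reduces it to
$\ln\det Z\le\operatorname{tr}Z-n$ for $Z=BYB^\top$. -/
theorem log_det_sub_log_det_le {X Y : Matrix ι ι ℝ} (hX : X.PosDef) (hY : Y.PosDef) :
    Real.log Y.det - Real.log X.det ≤ (X⁻¹ * (Y - X)).trace := by
  obtain ⟨B, hB⟩ := exists_transpose_mul_self hX.inv
  have hBu : IsUnit B := by
    rw [isUnit_iff_isUnit_det, isUnit_iff_ne_zero]
    intro h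
    have := hX.inv.det_pos
    rw [hB, det_mul, h, mul_zero] at this
    exact lt_irrefl _ this
  have h := log_det_le (posDef_conj hY hBu)
  have e1 : (B * Y * Bᵀ).det = X.det⁻¹ * Y.det := by
    have : X.det⁻¹ = B.det * B.det := by
      rw [← Ring.inverse_eq_inv', ← det_nonsing_inv, hB, det_mul, det_transpose]
    rw [det_mul, det_mul, det_transpose, this]
    ring
  have e2 : (B * Y * Bᵀ).trace = (X⁻¹ * Y).trace := by
    rw [hB, trace_mul_comm, Matrix.mul_assoc]
  rw [e1, e2, Real.log_mul (inv_pos.2 hX.det_pos).ne' hY.det_pos.ne', Real.log_inv] at h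
  rw [Matrix.mul_sub, hX.inv_mul, trace_sub, trace_one]
  linarith

theorem trace_mul_pos [Nonempty ι] {X Y : Matrix ι ι ℝ} (hX : X.PosDef) (hY : Y.PosDef) :
    0 < (X * Y).trace := by
  obtain ⟨B, hB⟩ := exists_transpose_mul_self hX
  have hBu : IsUnit B := by
    rw [isUnit_iff_isUnit_det, isUnit_iff_ne_zero]
    intro h
    have := hX.det_pos
    rw [hB, det_mul, h, mul_zero] at this
    exact lt_irrefl _ this
  rw [hB, Matrix.mul_assoc, trace_mul_comm]
  exact (posDef_conj hY hBu).trace_pos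

theorem gamma_eq (X : Matrix (Fin n) (Fin n) ℝ) (θ : ℝ) :
    gamma X θ = (1 / 2) * (((1 - θ • X)⁻¹).trace - n - Real.log ((1 - θ • X)⁻¹).det) := by
  rw [gamma, trace_sub, trace_one, Fintype.card_fin, det_nonsing_inv, Ring.inverse_eq_inv',
    Real.log_inv]
  ring

theorem gamma_nonneg (X : Matrix (Fin n) (Fin n) ℝ) {θ : ℝ} (h : (1 - θ • X).PosDef) :
    0 ≤ gamma X θ := by
  rw [gamma_eq X]
  have := log_det_le h.inv
  rw [Fintype.card_fin] at this
  linarith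

/-- Put $Z=(I-\theta X)^{-1}$ and $Z'=(I-\eta Y)^{-1}$, so $Z'>Z$. Concavity of $\ln\det$ at $Z$
bounds the increase of $\gamma$ below by $\frac12\operatorname{tr}(\theta X(Z'-Z))>0$. -/
theorem gamma_lt_gamma [NeZero n] {X Y : Matrix (Fin n) (Fin n) ℝ} {θ η : ℝ}
    (hX : (θ • X).PosDef) (hXY : (η • Y - θ • X).PosDef) (hY : (1 - η • Y).PosDef) :
    gamma X θ < gamma Y η := by
  have h1 : (1 - θ • X).PosDef := by simpa using hXY.add hY
  rw [gamma_eq X, gamma_eq Y]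
  have hd : ((1 - η • Y)⁻¹ - (1 - θ • X)⁻¹).PosDef :=
    inv_sub_inv_posDef hY (by simpa using hXY)
  have h2 := log_det_sub_log_det_le h1.inv hY.inv
  rw [h1.inv_inv, Matrix.sub_mul, Matrix.one_mul, trace_sub, trace_sub] at h2
  have h3 := trace_mul_pos hX hd
  linarith

theorem gamma_pos [NeZero n] {X : Matrix (Fin n) (Fin n) ℝ} {θ : ℝ}
    (hX : (θ • X).PosDef) (h : (1 - θ • X).PosDef) : 0 < gamma X θ := by
  have e : θ • X - (θ / 2) • X = (1 / 2 : ℝ) • (θ • X) := by module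
  have hp : ((1 / 2 : ℝ) • (θ • X)).PosDef := hX.smul (by norm_num)
  have h2 : ((θ / 2) • X).PosDef := by
    convert hp using 1
    module
  have hh : (1 - (θ / 2) • X).PosDef := by
    have := h.add hp
    rw [← e] at this
    simpa using this
  exact (gamma_nonneg X hh).trans_lt (gamma_lt_gamma h2 (e ▸ hp) h)

/-- If $\eta>r\theta$, then $\eta Y>\theta rY\ge\theta X$ and $\gamma$ would take two different
values at a common tolerance. Thus the risk parameter does not expand Thompson distances, and the
filter contracts although its parameter varies with the state. -/
theorem IsRiskParam.le_mul [NeZero n] {c : ℝ} {X Y : Matrix (Fin n) (Fin n) ℝ} {θ η r : ℝ}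
    (hX : X.PosDef) (hY : Y.PosDef) (h : IsRiskParam c X θ) (h' : IsRiskParam c Y η)
    (hXY : X ≤ r • Y) : η ≤ r * θ := by
  by_contra! hlt
  refine (gamma_lt_gamma (hX.smul h.pos) ?_ h'.admissible).ne (h.eq.trans h'.eq.symm)
  have e : η • Y - θ • X = (η - r * θ) • Y + θ • (r • Y - X) := by module
  rw [e]
  exact posDef_add_nonneg (hY.smul (by linarith)) (smul_nonneg h.pos.le (sub_nonneg.2 hXY))

/-- The threshold is $\gamma(zI,\theta_0)$, well defined and positive since $0<\theta_0z<1$;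
monotonicity of $\gamma$ then excludes larger parameters for every $X\ge zI$. -/
theorem exists_tolerance [NeZero n] {z θ₀ : ℝ} (hz : 0 < z) (hθ : 0 < θ₀) (hzθ : θ₀ * z < 1) :
    ∃ c₀ : ℝ, 0 < c₀ ∧ ∀ c ≤ c₀, ∀ (X : Matrix (Fin n) (Fin n) ℝ) (θ : ℝ), z • 1 ≤ X →
      IsRiskParam c X θ → θ ≤ θ₀ := by
  have hp : (θ₀ • (z • (1 : Matrix (Fin n) (Fin n) ℝ))).PosDef := (posDef_smul_one hz).smul hθ
  have hp' : (1 - θ₀ • (z • (1 : Matrix (Fin n) (Fin n) ℝ))).PosDef := by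
    have e : 1 - θ₀ • (z • (1 : Matrix (Fin n) (Fin n) ℝ)) = (1 - θ₀ * z) • 1 := by module
    rw [e]
    exact posDef_smul_one (by linarith)
  refine ⟨gamma (z • (1 : Matrix (Fin n) (Fin n) ℝ)) θ₀, gamma_pos hp hp', fun c hc X θ hX h => ?_⟩
  by_contra! hlt
  have hXp := posDef_of_le (posDef_smul_one hz) hX
  have : gamma (z • (1 : Matrix (Fin n) (Fin n) ℝ)) θ₀ < gamma X θ := by
    refine gamma_lt_gamma hp ?_ h.admissible
    have e : θ • X - θ₀ • (z • (1 : Matrix (Fin n) (Fin n) ℝ)) =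
        (θ - θ₀) • X + θ₀ • (X - z • 1) := by module
    rw [e]
    exact posDef_add_nonneg (hXp.smul (by linarith)) (smul_nonneg hθ.le (sub_nonneg.2 hX))
  rw [h.eq] at this
  linarith

theorem gamma_of_diagonalization {U : Matrix (Fin n) (Fin n) ℝ} {d : Fin n → ℝ} {θ : ℝ}
    (hU : Uᵀ * U = 1) (hU' : U * Uᵀ = 1) (hd : ∀ i, 0 < 1 - θ * d i) :
    (1 - θ • (U * diagonal d * Uᵀ)).PosDef ∧ gamma (U * diagonal d * Uᵀ) θ =
      (1 / 2) * ∑ i, (Real.log (1 - θ * d i) + ((1 - θ * d i)⁻¹ - 1)) := by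
  have e : 1 - θ • (U * diagonal d * Uᵀ) = U * diagonal (fun i => 1 - θ * d i) * Uᵀ := by
    have : diagonal (fun i => 1 - θ * d i) = 1 - θ • diagonal d := by
      rw [← diagonal_one, ← diagonal_smul, diagonal_sub]
      rfl
    rw [this, Matrix.mul_sub, Matrix.sub_mul, Matrix.mul_one, hU', Matrix.mul_smul, Matrix.smul_mul]
  have hUu : IsUnit U := IsUnit.of_mul_eq_one _ hU'
  have hdet : U.det * U.det = 1 := by
    have := congrArg det hU'
    rwa [det_mul, det_transpose, det_one] at this
  have hinv : (U * diagonal (fun i => 1 - θ * d i) * Uᵀ)⁻¹ =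
      U * diagonal (fun i => (1 - θ * d i)⁻¹) * Uᵀ := by
    apply inv_eq_right_inv
    calc _ = U * diagonal (fun i => 1 - θ * d i) * (Uᵀ * U) *
          diagonal (fun i => (1 - θ * d i)⁻¹) * Uᵀ := by simp only [Matrix.mul_assoc]
      _ = 1 := by
        rw [hU, Matrix.mul_one, Matrix.mul_assoc U, diagonal_mul_diagonal]
        simp_rw [mul_inv_cancel₀ (hd _).ne']
        rw [diagonal_one, Matrix.mul_one, hU']
  refine ⟨by rw [e]; exact posDef_conj (PosDef.diagonal hd) hUu, ?_⟩
  have htr : (U * diagonal (fun i => (1 - θ * d i)⁻¹) * Uᵀ).trace = ∑ i, (1 - θ * d i)⁻¹ := by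
    rw [Matrix.mul_assoc, trace_mul_comm, Matrix.mul_assoc, hU, Matrix.mul_one, trace_diagonal]
  rw [gamma, e, hinv, trace_sub, htr, det_mul, det_mul, det_transpose, det_diagonal, trace_one,
    mul_right_comm, hdet, one_mul, Real.log_prod fun i _ => (hd i).ne', Finset.sum_add_distrib,
    Finset.sum_sub_distrib]
  simp

theorem exists_isRiskParam [NeZero n] {X : Matrix (Fin n) (Fin n) ℝ} (hX : X.PosDef) {c : ℝ}
    (hc : 0 < c) : ∃ θ, IsRiskParam c X θ := by
  obtain ⟨U, d, rfl, hU, hU', hd⟩ := exists_orthogonal_diagonalization hX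
  obtain ⟨i₀, hi₀⟩ := Finite.exists_max d
  set φ : ℝ → ℝ := fun θ => (1 / 2) * ∑ i, (Real.log (1 - θ * d i) + ((1 - θ * d i)⁻¹ - 1))
    with hφ
  -- At $\theta_1$ the largest eigenvalue leaves $1-\theta_1d_{i_0}=k^{-2}$. Its term is $k^2-1-2\ln
  -- k\ge(k-1)^2=(1+2c)^2\ge2c$, so $\gamma$ passes $c$ before $\theta_1$.
  set k : ℝ := 2 + 2 * c with hk
  set s : ℝ := (k ^ 2)⁻¹ with hs
  have hk1 : 1 < k := by linarith
  have hs0 : 0 < s := by positivity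
  have hs1 : s < 1 := inv_lt_one_of_one_lt₀ (by nlinarith)
  set θ₁ : ℝ := (1 - s) / d i₀ with hθ₁
  have hθ₁0 : 0 < θ₁ := div_pos (by linarith) (hd i₀)
  have hadm : ∀ θ ∈ Set.Icc 0 θ₁, ∀ i, 0 < 1 - θ * d i := by
    intro θ hθ i
    have : θ * d i ≤ θ₁ * d i₀ := mul_le_mul hθ.2 (hi₀ i) (hd i).le hθ₁0.le
    rw [hθ₁, div_mul_cancel₀ _ (hd i₀).ne'] at this
    linarith
  have hterm : ∀ θ ∈ Set.Icc 0 θ₁, ∀ i,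
      0 ≤ Real.log (1 - θ * d i) + ((1 - θ * d i)⁻¹ - 1) := by
    intro θ hθ i
    linarith [Real.one_sub_inv_le_log_of_pos (hadm θ hθ i)]
  have hcont : ContinuousOn φ (Set.Icc 0 θ₁) := by
    refine continuousOn_const.mul (continuousOn_finsetSum _ fun i _ => ?_)
    have h1 : ContinuousOn (fun θ : ℝ => 1 - θ * d i) (Set.Icc 0 θ₁) := by fun_prop
    exact (h1.log fun θ hθ => (hadm θ hθ i).ne').add
      ((h1.inv₀ fun θ hθ => (hadm θ hθ i).ne').sub continuousOn_const)
  have h0 : φ 0 = 0 := by simp [hφ]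
  have h1 : c ≤ φ θ₁ := by
    have hmem : θ₁ ∈ Set.Icc 0 θ₁ := ⟨hθ₁0.le, le_rfl⟩
    have hle := Finset.single_le_sum (f := fun i =>
      Real.log (1 - θ₁ * d i) + ((1 - θ₁ * d i)⁻¹ - 1)) (fun i _ => hterm θ₁ hmem i)
      (Finset.mem_univ i₀)
    have e : 1 - θ₁ * d i₀ = s := by
      rw [hθ₁, div_mul_cancel₀ _ (hd i₀).ne']
      ring
    simp only [e] at hle
    have hlog : Real.log s = -(2 * Real.log k) := by
      rw [hs, Real.log_inv, Real.log_pow]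
      norm_num
    have hlk := Real.log_le_sub_one_of_pos (show 0 < k by linarith)
    rw [hlog, hs, inv_inv] at hle
    rw [hφ]
    nlinarith
  obtain ⟨θ, hθ, hθc⟩ := intermediate_value_Icc hθ₁0.le hcont ⟨h0.le.trans hc.le, h1⟩
  obtain ⟨hp, hg⟩ := gamma_of_diagonalization hU hU' (hadm θ hθ)
  refine ⟨θ, lt_of_le_of_ne hθ.1 ?_, hp, hg.trans hθc⟩
  rintro rfl
  linarith

end RiskParameter

/-! ### The measurement update, the Riccati step and the closed loop. -/

section Kalman

open scoped MatrixOrder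

variable {n m : ℕ}

/-- The information `Cᵀ R⁻¹ C` gained from one measurement. -/
def infoGain (C : Matrix (Fin m) (Fin n) ℝ) (R : Matrix (Fin m) (Fin m) ℝ) :
    Matrix (Fin n) (Fin n) ℝ :=
  Cᵀ * R⁻¹ * C

variable {A : Matrix (Fin n) (Fin n) ℝ} {C : Matrix (Fin m) (Fin n) ℝ}
  {Q : Matrix (Fin n) (Fin n) ℝ} {R : Matrix (Fin m) (Fin m) ℝ} {P P' : Matrix (Fin n) (Fin n) ℝ}

theorem infoGain_nonneg (hR : R.PosDef) : 0 ≤ infoGain C R := by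
  simpa [infoGain] using conj_nonneg hR.inv.nonneg Cᵀ

theorem posDef_innovation (hR : R.PosDef) (hP : P.PosDef) : (C * P * Cᵀ + R).PosDef := by
  rw [add_comm]
  exact posDef_add_nonneg hR (conj_nonneg hP.nonneg C)

theorem posDef_inv_add_infoGain (hR : R.PosDef) (hP : P.PosDef) : (P⁻¹ + infoGain C R).PosDef :=
  posDef_add_nonneg hP.inv (infoGain_nonneg hR)

theorem updCov_eq_inv (hR : R.PosDef) (hP : P.PosDef) :
    updCov C R P = (P⁻¹ + infoGain C R)⁻¹ := by
  have hS := posDef_innovation (C := C) hR hP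
  have := add_mul_mul_inv_eq_sub P⁻¹ Cᵀ R⁻¹ C hP.inv.isUnit hR.inv.isUnit (by
    rw [hP.inv_inv, hR.inv_inv, add_comm]
    exact hS.isUnit)
  rw [hP.inv_inv, hR.inv_inv, add_comm R] at this
  rw [infoGain, this, updCov]

theorem updCov_inv (hR : R.PosDef) (hP : P.PosDef) :
    (updCov C R P)⁻¹ = P⁻¹ + infoGain C R := by
  rw [updCov_eq_inv hR hP, (posDef_inv_add_infoGain hR hP).inv_inv]

theorem posDef_updCov (hR : R.PosDef) (hP : P.PosDef) : (updCov C R P).PosDef := by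
  rw [updCov_eq_inv hR hP]
  exact (posDef_inv_add_infoGain hR hP).inv

theorem updCov_le (hR : R.PosDef) (hP : P.PosDef) : updCov C R P ≤ P := by
  rw [updCov_eq_inv hR hP]
  have := inv_antitone hP.inv (le_add_of_nonneg_right (infoGain_nonneg (C := C) hR))
  rwa [hP.inv_inv] at this

theorem updCov_mono (hR : R.PosDef) (hP : P.PosDef) (h : P ≤ P') :
    updCov C R P ≤ updCov C R P' := by
  have hP' := posDef_of_le hP h
  rw [updCov_eq_inv hR hP, updCov_eq_inv hR hP']
  exact inv_antitone (posDef_inv_add_infoGain hR hP') (add_le_add_left (inv_antitone hP h) _)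

/-- In information form the update adds a fixed nonnegative matrix to $P^{-1}$, which can only
improve the ratio. -/
theorem updCov_le_smul (hR : R.PosDef) (hP : P.PosDef) (hP' : P'.PosDef) {r : ℝ} (hr : 1 ≤ r)
    (h : P' ≤ r • P) : updCov C R P' ≤ r • updCov C R P := by
  have hr0 : 0 < r := by linarith
  have hG := posDef_inv_add_infoGain (C := C) hR hP
  rw [updCov_eq_inv hR hP, updCov_eq_inv hR hP']
  have h1 : r⁻¹ • P⁻¹ ≤ P'⁻¹ := by
    rw [← inv_smul_of_posDef hP hr0.ne']
    exact inv_antitone hP' h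
  have h2 : r⁻¹ • infoGain C R ≤ infoGain C R := by
    have := smul_le_smul_of_nonneg_right (inv_le_one_of_one_le₀ hr) (infoGain_nonneg (C := C) hR)
    rwa [one_smul] at this
  have h3 : r⁻¹ • (P⁻¹ + infoGain C R) ≤ P'⁻¹ + infoGain C R := by
    rw [smul_add]
    exact add_le_add h1 h2
  have := inv_antitone (hG.smul (inv_pos.2 hr0)) h3
  rwa [inv_smul_of_posDef hG (inv_pos.2 hr0).ne', _root_.inv_inv] at this

theorem riccati_eq (hR : R.PosDef) (hP : P.PosDef) (θ : ℝ) :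
    riccati A C Q R θ P = A * ((P⁻¹ + infoGain C R) - θ • 1)⁻¹ * Aᵀ + Q := by
  rw [riccati, updCov_inv hR hP]

theorem posDef_inv_sub_smul_one {X : Matrix (Fin n) (Fin n) ℝ} {θ : ℝ} (hX : X.PosDef)
    (hθ : 0 < θ) (h : (1 - θ • X).PosDef) : (X⁻¹ - θ • 1).PosDef := by
  have := inv_sub_inv_posDef (Y := θ⁻¹ • 1) hX (by
    have := h.smul (inv_pos.2 hθ)
    rwa [smul_sub, smul_smul, inv_mul_cancel₀ hθ.ne', one_smul] at this)
  rwa [inv_smul_one, _root_.inv_inv] at this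

theorem le_riccati {θ : ℝ} (h : ((updCov C R P)⁻¹ - θ • 1).PosDef) :
    Q ≤ riccati A C Q R θ P :=
  le_add_of_nonneg_left (conj_nonneg h.inv.nonneg A)

/-- The contraction estimate with $X=P^+$ and $H=\theta I$: from $P\le MI$ and
$\theta\le\delta/(2M)$ one gets $(P^+)^{-1}-\theta I\ge I/(2M)$, which yields both smallness of $H$
and the bound by $KQ$. -/
theorem riccati_le_smul (hQ : Q.PosDef) (hR : R.PosDef) {M K δ ρ θ θ' r : ℝ} (hM : 0 < M)
    (hK : 0 < K) (hAK : (2 * M) • (A * Aᵀ) ≤ K • Q) (hδ0 : 0 ≤ δ) (hδ1 : δ ≤ 1)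
    (hδ : δ * (K * (ρ + 1) + (K + 1 / 2) * (ρ ^ 2 - 1)) ≤ 1 / 2) (hθ : θ ≤ δ / (2 * M))
    (hr : 1 ≤ r) (hrρ : r ≤ ρ) (hP : Q ≤ P) (hPM : P ≤ M • 1) (hP' : Q ≤ P')
    (hPP' : P' ≤ r • P) (hθθ' : θ' ≤ r * θ) :
    riccati A C Q R θ' P' ≤ (1 + (2 * K + 1) / (2 * K + 2) * (r - 1)) • riccati A C Q R θ P := by
  have hPp := posDef_of_le hQ hP
  have hPp' := posDef_of_le hQ hP'
  have hXp := posDef_updCov (C := C) hR hPp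
  have hXp' := posDef_updCov (C := C) hR hPp'
  have hXM : M⁻¹ • 1 ≤ (updCov C R P)⁻¹ := by
    rw [← inv_smul_one]
    exact inv_antitone hXp ((updCov_le hR hPp).trans hPM)
  have hD : (1 / (2 * M)) • 1 ≤ (updCov C R P)⁻¹ - θ • 1 := by
    refine le_trans ?_ (sub_le_sub_right hXM _)
    rw [← sub_smul]
    refine smul_le_smul_of_nonneg_right ?_ PosDef.one.nonneg
    have : δ / (2 * M) ≤ 1 / (2 * M) := by gcongr
    have e : M⁻¹ = 1 / (2 * M) + 1 / (2 * M) := by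
      field_simp
      norm_num
    linarith
  have hDp : ((updCov C R P)⁻¹ - θ • 1).PosDef :=
    posDef_of_le (posDef_smul_one (by positivity)) hD
  have hH : θ • (1 : Matrix (Fin n) (Fin n) ℝ) ≤ δ • ((updCov C R P)⁻¹ - θ • 1) := by
    refine le_trans ?_ (smul_le_smul_of_nonneg_left hD hδ0)
    rw [smul_smul, mul_one_div]
    exact smul_le_smul_of_nonneg_right hθ PosDef.one.nonneg
  have hB : A * ((updCov C R P)⁻¹ - θ • 1)⁻¹ * Aᵀ ≤ K • Q := by
    refine le_trans ?_ hAK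
    have h1 := inv_antitone (posDef_smul_one (by positivity)) hD
    rw [inv_smul_one, one_div, _root_.inv_inv] at h1
    have := conj_mono h1 A
    rwa [Matrix.mul_smul, Matrix.smul_mul, Matrix.mul_one] at this
  have hH' : θ' • (1 : Matrix (Fin n) (Fin n) ℝ) ≤ r • (θ • 1) := by
    rw [smul_smul]
    exact smul_le_smul_of_nonneg_right hθθ' PosDef.one.nonneg
  exact conj_inv_add_le hDp
    (smul_sub_le_sub hXp hXp' hr (updCov_le_smul hR hPp hPp' hr hPP') hH' hH) hr hrρ hK hB hδ0 hδ

theorem gain_mul_innovation (hR : R.PosDef) (hP : P.PosDef) :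
    gain C R P * (C * P * Cᵀ + R) = P * Cᵀ := by
  rw [gain, Matrix.mul_assoc, (posDef_innovation hR hP).inv_mul, Matrix.mul_one]

/-- Joseph's form: each summand separately is below $P^+$, which bounds the gain (second summand)
and the closed loop (first summand). -/
theorem updCov_joseph (hR : R.PosDef) (hP : P.PosDef) :
    updCov C R P = (1 - gain C R P * C) * P * (1 - gain C R P * C)ᵀ +
      gain C R P * R * (gain C R P)ᵀ := by
  have h := gain_mul_innovation (C := C) hR hP
  have e : updCov C R P = P - gain C R P * C * P := by
    rw [updCov, gain]
  rw [e]
  set L := gain C R P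
  rw [transpose_sub, transpose_mul, transpose_one, Matrix.sub_mul, Matrix.one_mul, Matrix.mul_sub,
    Matrix.mul_one]
  have h2 : P * (Cᵀ * Lᵀ) = L * C * P * (Cᵀ * Lᵀ) + L * R * Lᵀ := by
    rw [← Matrix.mul_assoc, ← h, Matrix.mul_add, Matrix.add_mul]
    simp only [Matrix.mul_assoc]
  rw [Matrix.sub_mul, h2]
  abel

theorem gain_mul_transpose_le (hR : R.PosDef) (hP : P.PosDef) {r : ℝ} (hr : 0 < r)
    (hrR : r • 1 ≤ R) : gain C R P * (gain C R P)ᵀ ≤ r⁻¹ • P := by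
  have h1 : gain C R P * R * (gain C R P)ᵀ ≤ P := by
    refine le_trans ?_ (updCov_le (C := C) hR hP)
    rw [updCov_joseph hR hP]
    exact le_add_of_nonneg_left (conj_nonneg hP.nonneg _)
  have h2 := (conj_mono hrR (gain C R P)).trans h1
  rw [Matrix.mul_smul, Matrix.smul_mul, Matrix.mul_one] at h2
  have := smul_le_smul_of_nonneg_left h2 (inv_nonneg.2 hr.le)
  rwa [smul_smul, inv_mul_cancel₀ hr.ne', one_smul] at this

/-- Both inequalities say that $Z^{-1/2}BZ^{1/2}$ has norm at most $\sqrt\rho$. To avoid square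
roots, expand $T^\top Z^{-1}T\ge0$ for $T=I-\rho^{-1}ZN$, $N=B^\top Z^{-1}B$, and use $NZN\le\rho
N$. -/
theorem transpose_mul_inv_mul_le {Z B : Matrix (Fin n) (Fin n) ℝ} {ρ : ℝ} (hZ : Z.PosDef)
    (hρ : 0 < ρ) (h : B * Z * Bᵀ ≤ ρ • Z) : Bᵀ * Z⁻¹ * B ≤ ρ • Z⁻¹ := by
  set N := Bᵀ * Z⁻¹ * B with hN
  set T : Matrix (Fin n) (Fin n) ℝ := 1 - ρ⁻¹ • (Z * N) with hT
  have hZt := hZ.inv.transpose_eq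
  have hNt : Nᵀ = N := by
    rw [hN, transpose_mul, transpose_mul, hZt, transpose_transpose, Matrix.mul_assoc]
  have h0 : 0 ≤ Tᵀ * Z⁻¹ * T := by simpa using conj_nonneg hZ.inv.nonneg Tᵀ
  have h1 := conj_mono' h (Z⁻¹ * B)
  rw [transpose_mul, hZt] at h1
  have e1 : Bᵀ * Z⁻¹ * (B * Z * Bᵀ) * (Z⁻¹ * B) = N * Z * N := by
    simp only [hN, Matrix.mul_assoc]
  have e2 : Bᵀ * Z⁻¹ * (ρ • Z) * (Z⁻¹ * B) = ρ • N := by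
    rw [Matrix.mul_smul, Matrix.smul_mul, Matrix.mul_assoc Bᵀ, hZ.inv_mul, Matrix.mul_one,
      ← Matrix.mul_assoc]
  rw [e1, e2] at h1
  have e3 : Tᵀ * Z⁻¹ * T = Z⁻¹ - (2 * ρ⁻¹) • N + (ρ⁻¹ * ρ⁻¹) • (N * Z * N) := by
    rw [hT, transpose_sub, transpose_one, transpose_smul, transpose_mul, hNt, hZ.transpose_eq,
      Matrix.sub_mul, Matrix.one_mul, Matrix.smul_mul, Matrix.mul_assoc N, hZ.mul_inv,
      Matrix.mul_one, Matrix.mul_sub, Matrix.mul_one, Matrix.sub_mul, Matrix.mul_smul,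
      ← Matrix.mul_assoc Z⁻¹, hZ.inv_mul, Matrix.one_mul, Matrix.mul_smul, Matrix.smul_mul,
      ← Matrix.mul_assoc]
    module
  have h2 : 0 ≤ Z⁻¹ - (2 * ρ⁻¹) • N + (ρ⁻¹ * ρ⁻¹) • (ρ • N) := by
    refine (e3 ▸ h0).trans (add_le_add_right (smul_le_smul_of_nonneg_left h1 (by positivity)) _)
  have h3 := smul_le_smul_of_nonneg_left h2 hρ.le
  rw [smul_zero, smul_smul, mul_assoc, inv_mul_cancel₀ hρ.ne', mul_one] at h3
  rw [← sub_nonneg]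
  convert h3 using 1
  rw [smul_add, smul_sub, smul_smul, smul_smul, mul_comm 2, ← mul_assoc, mul_inv_cancel₀ hρ.ne']
  module

/-- Since $\theta\ge0$ only enlarges the covariance, $AP^+A^\top\le P-Q\le\rho P$. Joseph's form
turns this into $\bar AP^+\bar A^\top\le\rho P^+$, and duality passes to the inverse. -/
theorem IsSteady.abar_lyapunov (hR : R.PosDef) {θ ρ : ℝ} (hθ : 0 ≤ θ) (hρ : 0 < ρ)
    (h : IsSteady A C Q R θ P) (hPQ : P - Q ≤ ρ • P) :
    (abar A C (gain C R P))ᵀ * (updCov C R P)⁻¹ * abar A C (gain C R P) ≤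
      ρ • (updCov C R P)⁻¹ := by
  have hX := posDef_updCov (C := C) hR h.posDef
  refine transpose_mul_inv_mul_le hX hρ ?_
  have h1 : updCov C R P ≤ ((updCov C R P)⁻¹ - θ • (1 : Matrix (Fin n) (Fin n) ℝ))⁻¹ := by
    have := inv_antitone h.admissible (sub_le_self _ (smul_nonneg hθ PosDef.one.nonneg))
    rwa [hX.inv_inv] at this
  have h2 : A * updCov C R P * Aᵀ ≤ ρ • P := by
    refine le_trans (conj_mono h1 A) (le_trans (le_of_eq ?_) hPQ)
    conv_rhs => lhs; rw [h.eq]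
    rw [riccati, add_sub_cancel_right]
  have h3 := conj_mono h2 (1 - gain C R P * C)
  rw [abar, transpose_mul]
  have e : (1 - gain C R P * C) * A * updCov C R P * (Aᵀ * (1 - gain C R P * C)ᵀ) =
      (1 - gain C R P * C) * (A * updCov C R P * Aᵀ) * (1 - gain C R P * C)ᵀ := by
    simp only [Matrix.mul_assoc]
  rw [e]
  refine h3.trans ?_
  rw [Matrix.mul_smul, Matrix.smul_mul]
  refine smul_le_smul_of_nonneg_left ?_ hρ.le
  conv_rhs => rw [updCov_joseph hR h.posDef]
  exact le_add_of_nonneg_right (conj_nonneg hR.nonneg _)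

end Kalman

/-! ### Observability and a covariance bound independent of the initial value. -/

section UniformBound

open scoped MatrixOrder

variable {n m : ℕ} {A : Matrix (Fin n) (Fin n) ℝ} {C : Matrix (Fin m) (Fin n) ℝ}
  {Q : Matrix (Fin n) (Fin n) ℝ} {R : Matrix (Fin m) (Fin m) ℝ}

theorem exists_mul_sq_norm_le {V : Type*} [NormedAddCommGroup V] [NormedSpace ℝ V]
    [FiniteDimensional ℝ V] {φ : V → ℝ} (hφ : Continuous φ) (hh : ∀ (a : ℝ) x, φ (a • x) = a ^ 2 * φ x)
    (hp : ∀ x, x ≠ 0 → 0 < φ x) : ∃ ε : ℝ, 0 < ε ∧ ∀ x, ε * ‖x‖ ^ 2 ≤ φ x := by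
  have h0 : φ 0 = 0 := by simpa using hh 0 0
  rcases subsingleton_or_nontrivial V with hV | hV
  · refine ⟨1, one_pos, fun x => ?_⟩
    rw [Subsingleton.elim x 0, h0]
    simp
  obtain ⟨y, hy, hmin⟩ := (isCompact_sphere (0 : V) 1).exists_isMinOn
    (NormedSpace.sphere_nonempty.2 zero_le_one) hφ.continuousOn
  have hy1 : ‖y‖ = 1 := by simpa using hy
  refine ⟨φ y, hp y (by rintro rfl; simp at hy1), fun x => ?_⟩
  rcases eq_or_ne x 0 with rfl | hx
  · rw [h0]
    simp
  have hx' : 0 < ‖x‖ := norm_pos_iff.2 hx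
  have hm : φ y ≤ φ (‖x‖⁻¹ • x) := hmin (by
    rw [mem_sphere_zero_iff_norm, norm_smul, norm_inv, norm_norm, inv_mul_cancel₀ hx'.ne'])
  rw [hh] at hm
  calc φ y * ‖x‖ ^ 2 ≤ ‖x‖⁻¹ ^ 2 * φ x * ‖x‖ ^ 2 := by gcongr
    _ = φ x := by field_simp

/-- The cost of a state trajectory: the weighted energy of its disturbances and outputs. -/
def stageCost (A : Matrix (Fin n) (Fin n) ℝ) (C : Matrix (Fin m) (Fin n) ℝ)
    (Q : Matrix (Fin n) (Fin n) ℝ) (R : Matrix (Fin m) (Fin m) ℝ) (x y : Fin n → ℝ) : ℝ :=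
  (y - A *ᵥ x) ⬝ᵥ Q⁻¹ *ᵥ (y - A *ᵥ x) + x ⬝ᵥ infoGain C R *ᵥ x

theorem infoGain_quad (x : Fin n → ℝ) :
    x ⬝ᵥ infoGain C R *ᵥ x = (C *ᵥ x) ⬝ᵥ R⁻¹ *ᵥ (C *ᵥ x) := by
  rw [infoGain, mulVec_mulVec, Matrix.mul_assoc, ← mulVec_mulVec, dotProduct_mulVec, vecMul_transpose]

theorem stageCost_nonneg (hQ : Q.PosDef) (hR : R.PosDef) (x y : Fin n → ℝ) :
    0 ≤ stageCost A C Q R x y :=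
  add_nonneg ((posSemidef_iff_quad.1 hQ.inv.posSemidef).2 _)
    ((posSemidef_iff_quad.1 (nonneg_iff_posSemidef.1 (infoGain_nonneg hR))).2 _)

theorem stageCost_eq_zero (hQ : Q.PosDef) (hR : R.PosDef) {x y : Fin n → ℝ}
    (h : stageCost A C Q R x y = 0) : y = A *ᵥ x ∧ C *ᵥ x = 0 := by
  have h1 := (posSemidef_iff_quad.1 hQ.inv.posSemidef).2 (y - A *ᵥ x)
  have h2 := (posSemidef_iff_quad.1 hR.inv.posSemidef).2 (C *ᵥ x)
  rw [stageCost, infoGain_quad] at h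
  constructor
  · by_contra hne
    have := (posDef_iff_quad.1 hQ.inv).2 _ (sub_ne_zero.2 hne)
    linarith
  · by_contra hne
    have := (posDef_iff_quad.1 hR.inv).2 _ hne
    linarith

theorem stageCost_smul (a : ℝ) (x y : Fin n → ℝ) :
    stageCost A C Q R (a • x) (a • y) = a ^ 2 * stageCost A C Q R x y := by
  simp only [stageCost, mulVec_smul, ← smul_sub, smul_dotProduct, dotProduct_smul, smul_eq_mul]
  ring

theorem continuous_stageCost {V : Type*} [TopologicalSpace V] {f g : V → Fin n → ℝ}
    (hf : Continuous f) (hg : Continuous g) :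
    Continuous fun v => stageCost A C Q R (f v) (g v) := by
  have h1 : Continuous fun v => g v - A *ᵥ f v := hg.sub (continuous_const.matrix_mulVec hf)
  exact (h1.dotProduct (continuous_const.matrix_mulVec h1)).add
    (hf.dotProduct (continuous_const.matrix_mulVec hf))

theorem dotProduct_self_nonneg' (v : Fin n → ℝ) : 0 ≤ v ⬝ᵥ v :=
  Finset.sum_nonneg fun i _ => mul_self_nonneg (v i)

theorem dotProduct_self_le_norm (v : Fin n → ℝ) : v ⬝ᵥ v ≤ n * ‖v‖ ^ 2 := by
  calc v ⬝ᵥ v ≤ ∑ _i : Fin n, ‖v‖ ^ 2 := Finset.sum_le_sum fun i _ => by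
        rw [← sq, ← sq_abs]
        have := norm_le_pi_norm v i
        rw [Real.norm_eq_abs] at this
        gcongr
    _ = n * ‖v‖ ^ 2 := by simp

/-- Zero cost means no disturbance and no output, so observability kills the initial state and then
the trajectory; compactness of the sphere makes this quantitative. The energy includes the terminal
state $x_n$, where $P_n^{-1}$ will be tested. -/
theorem Observable.exists_stageCost_bound [NeZero n] (hobs : Observable A C) (hQ : Q.PosDef)
    (hR : R.PosDef) : ∃ ε : ℝ, 0 < ε ∧ ∀ x : ℕ → Fin n → ℝ,
      ε * ∑ k ∈ Finset.range (n + 1), x k ⬝ᵥ x k ≤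
        ∑ k ∈ Finset.range n, stageCost A C Q R (x k) (x (k + 1)) := by
  set φ : (Fin (n + 1) → Fin n → ℝ) → ℝ := fun x =>
    ∑ k : Fin n, stageCost A C Q R (x k.castSucc) (x k.succ) with hφ
  have hpos : ∀ x, x ≠ 0 → 0 < φ x := by
    intro x hx
    have hnn : 0 ≤ φ x := Finset.sum_nonneg fun k _ => stageCost_nonneg hQ hR _ _
    refine lt_of_le_of_ne hnn fun h => hx ?_
    have hz := (Finset.sum_eq_zero_iff_of_nonneg fun k _ => stageCost_nonneg hQ hR _ _).1 h.symm
    have hz' := fun k : Fin n => stageCost_eq_zero hQ hR (hz k (Finset.mem_univ k))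
    have hpow : ∀ k : Fin (n + 1), x k = (A ^ (k : ℕ)) *ᵥ x 0 := by
      intro k
      induction k using Fin.induction with
      | zero => simp
      | succ k ih =>
        rw [(hz' k).1, ih, mulVec_mulVec, Fin.val_succ, pow_succ']
        simp
    have h0 : x 0 = 0 := hobs _ fun k hk => by
      have := (hz' ⟨k, hk⟩).2
      rwa [hpow] at this
    funext k
    rw [hpow, h0, mulVec_zero]
    rfl
  have hhom : ∀ (a : ℝ) x, φ (a • x) = a ^ 2 * φ x := by
    intro a x
    simp only [hφ, Pi.smul_apply, stageCost_smul, Finset.mul_sum]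
  have hcont : Continuous φ :=
    continuous_finsetSum _ fun k _ => continuous_stageCost (continuous_apply _) (continuous_apply _)
  obtain ⟨ε, hε, h⟩ := exists_mul_sq_norm_le hcont hhom hpos
  have hn : (0 : ℝ) < n := Nat.cast_pos.2 (NeZero.pos n)
  refine ⟨ε / ((n + 1) * n), by positivity, fun x => ?_⟩
  have := h fun k => x k
  rw [Finset.sum_range, Finset.sum_range]
  have hsum : ∑ k : Fin (n + 1), x k ⬝ᵥ x k ≤ (n + 1) * n * ‖fun k : Fin (n + 1) => x k‖ ^ 2 := by
    calc ∑ k : Fin (n + 1), x k ⬝ᵥ x k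
        ≤ ∑ _k : Fin (n + 1), (n : ℝ) * ‖fun k : Fin (n + 1) => x k‖ ^ 2 :=
          Finset.sum_le_sum fun k _ => by
            refine (dotProduct_self_le_norm _).trans ?_
            have := norm_le_pi_norm (fun k : Fin (n + 1) => x k) k
            gcongr
      _ = _ := by
        simp
        ring
  calc ε / ((n + 1) * n) * ∑ k : Fin (n + 1), x k ⬝ᵥ x k
      ≤ ε / ((n + 1) * n) * ((n + 1) * n * ‖fun k : Fin (n + 1) => x k‖ ^ 2) := by gcongr
    _ = ε * ‖fun k : Fin (n + 1) => x k‖ ^ 2 := by field_simp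
    _ ≤ _ := this

/-- One step of dynamic programming: $v^\top P^{-1}v$ is an infimal convolution, and $y=D^{-1}A^\top
P^{-1}v$ attains it. -/
theorem quad_inv_conj_add {D P : Matrix (Fin n) (Fin n) ℝ} (hQ : Q.PosDef) (hD : D.PosDef)
    (hP : P = A * D⁻¹ * Aᵀ + Q) (v : Fin n → ℝ) :
    ∃ y, v ⬝ᵥ P⁻¹ *ᵥ v = (v - A *ᵥ y) ⬝ᵥ Q⁻¹ *ᵥ (v - A *ᵥ y) + y ⬝ᵥ D *ᵥ y := by
  have hPp : P.PosDef := by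
    rw [hP, add_comm]
    exact posDef_add_nonneg hQ (conj_nonneg hD.inv.nonneg A)
  obtain ⟨z, hz⟩ : ∃ z, z = P⁻¹ *ᵥ v := ⟨_, rfl⟩
  have hv : v = P *ᵥ z := by rw [hz, mulVec_mulVec, hPp.mul_inv, one_mulVec]
  refine ⟨D⁻¹ *ᵥ (Aᵀ *ᵥ z), ?_⟩
  have hPz : P *ᵥ z = A *ᵥ (D⁻¹ *ᵥ (Aᵀ *ᵥ z)) + Q *ᵥ z := by
    rw [hP, add_mulVec, mulVec_mulVec, mulVec_mulVec]
  have hw : v - A *ᵥ (D⁻¹ *ᵥ (Aᵀ *ᵥ z)) = Q *ᵥ z := by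
    rw [hv, hPz, add_sub_cancel_left]
  rw [hw, mulVec_mulVec z Q⁻¹, hQ.inv_mul, one_mulVec, mulVec_mulVec _ D, hD.mul_inv, one_mulVec,
    ← hz, dotProduct_comm v, hv, hPz, dotProduct_add, dotProduct_mulVec, ← mulVec_transpose,
    dotProduct_comm (Aᵀ *ᵥ z), dotProduct_comm (Q *ᵥ z)]
  ring

/-- Iterating the one-step identity backward from the terminal state. The initial cost $x_0^\top
P_0^{-1}x_0\ge0$ is dropped, so the bound does not depend on the size of $P_0$. -/
theorem exists_trajectory {P : ℕ → Matrix (Fin n) (Fin n) ℝ} {θ : ℕ → ℝ} (hQ : Q.PosDef)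
    (h0 : (P 0).PosDef) (N : ℕ)
    (hD : ∀ k < N, ((P k)⁻¹ + infoGain C R - θ k • 1).PosDef)
    (hP : ∀ k < N, P (k + 1) = A * ((P k)⁻¹ + infoGain C R - θ k • 1)⁻¹ * Aᵀ + Q)
    (v : Fin n → ℝ) : ∃ x : ℕ → Fin n → ℝ, x N = v ∧
      ∑ k ∈ Finset.range N, (stageCost A C Q R (x k) (x (k + 1)) - θ k * (x k ⬝ᵥ x k)) ≤
        v ⬝ᵥ (P N)⁻¹ *ᵥ v := by
  induction N generalizing v with
  | zero =>
    refine ⟨fun _ => v, rfl, ?_⟩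
    simpa using (posSemidef_iff_quad.1 h0.inv.posSemidef).2 v
  | succ N ih =>
    obtain ⟨y, hy⟩ := quad_inv_conj_add hQ (hD N (Nat.lt_succ_self N)) (hP N (Nat.lt_succ_self N)) v
    obtain ⟨x, hx, hle⟩ := ih (fun k hk => hD k (Nat.lt_succ_of_lt hk))
      (fun k hk => hP k (Nat.lt_succ_of_lt hk)) y
    refine ⟨Function.update x (N + 1) v, by simp, ?_⟩
    rw [Finset.sum_range_succ]
    have e : ∀ k ≤ N, Function.update x (N + 1) v k = x k := fun k hk =>
      Function.update_of_ne (by omega) _ _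
    have e1 : ∑ k ∈ Finset.range N, (stageCost A C Q R (Function.update x (N + 1) v k)
        (Function.update x (N + 1) v (k + 1)) - θ k * (Function.update x (N + 1) v k ⬝ᵥ
        Function.update x (N + 1) v k)) =
        ∑ k ∈ Finset.range N, (stageCost A C Q R (x k) (x (k + 1)) - θ k * (x k ⬝ᵥ x k)) := by
      refine Finset.sum_congr rfl fun k hk => ?_
      have hk' := Finset.mem_range.1 hk
      rw [e k hk'.le, e (k + 1) hk']
    rw [e1, e N le_rfl, hx, Function.update_self, hy, stageCost, sub_mulVec, add_mulVec, smul_mulVec,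
      one_mulVec, dotProduct_sub, dotProduct_add, dotProduct_smul, smul_eq_mul]
    linarith

/-- Risk sensitivity takes back at most half of the coercivity $\varepsilon$, leaving
$P_n^{-1}\ge(\varepsilon/2)I$. -/
theorem le_smul_one_of_trajectory {P : ℕ → Matrix (Fin n) (Fin n) ℝ} {θ : ℕ → ℝ} {ε : ℝ}
    (hQ : Q.PosDef) (hε : 0 < ε) (h0 : (P 0).PosDef)
    (hD : ∀ k < n, ((P k)⁻¹ + infoGain C R - θ k • 1).PosDef)
    (hP : ∀ k < n, P (k + 1) = A * ((P k)⁻¹ + infoGain C R - θ k • 1)⁻¹ * Aᵀ + Q)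
    (hθ : ∀ k < n, θ k ≤ ε / 2) (hPn : (P n).PosDef)
    (hobs : ∀ x : ℕ → Fin n → ℝ, ε * ∑ k ∈ Finset.range (n + 1), x k ⬝ᵥ x k ≤
        ∑ k ∈ Finset.range n, stageCost A C Q R (x k) (x (k + 1))) :
    P n ≤ (2 / ε) • 1 := by
  have key : (ε / 2) • 1 ≤ (P n)⁻¹ := by
    refine le_of_quad (by simp) hPn.inv.transpose_eq fun v => ?_
    rw [smul_mulVec, one_mulVec, dotProduct_smul, smul_eq_mul]
    obtain ⟨x, hx, hle⟩ := exists_trajectory hQ h0 n hD hP v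
    have h1 := hobs x
    rw [Finset.sum_range_succ, hx] at h1
    rw [Finset.sum_sub_distrib] at hle
    have h2 : ∑ k ∈ Finset.range n, θ k * (x k ⬝ᵥ x k) ≤
        (ε / 2) * ∑ k ∈ Finset.range n, x k ⬝ᵥ x k := by
      rw [Finset.mul_sum]
      refine Finset.sum_le_sum fun k hk => ?_
      exact mul_le_mul_of_nonneg_right (hθ k (Finset.mem_range.1 hk)) (dotProduct_self_nonneg' _)
    have h3 : 0 ≤ ∑ k ∈ Finset.range n, x k ⬝ᵥ x k :=
      Finset.sum_nonneg fun k _ => dotProduct_self_nonneg' _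
    have h4 : 0 ≤ v ⬝ᵥ v := dotProduct_self_nonneg' _
    nlinarith
  have := inv_antitone (posDef_smul_one (half_pos hε)) key
  rwa [hPn.inv_inv, inv_smul_one, inv_div] at this

end UniformBound

/-! ### Convergence of the filter to its steady state. -/

section Filter

open scoped MatrixOrder

variable {n m : ℕ} {A : Matrix (Fin n) (Fin n) ℝ} {C : Matrix (Fin m) (Fin n) ℝ}
  {Q : Matrix (Fin n) (Fin n) ℝ} {R : Matrix (Fin m) (Fin m) ℝ}

section Continuity

variable {α : Type*} {l : Filter α} {f : α → Matrix (Fin n) (Fin n) ℝ}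
  {P : Matrix (Fin n) (Fin n) ℝ} {θs : α → ℝ} {θ : ℝ}

theorem tendsto_matrix_mul {ι κ μ : Type*} [Fintype κ] {f : α → Matrix ι κ ℝ} {g : α → Matrix κ μ ℝ}
    {X : Matrix ι κ ℝ} {Y : Matrix κ μ ℝ} (hf : Tendsto f l (𝓝 X)) (hg : Tendsto g l (𝓝 Y)) :
    Tendsto (fun a => f a * g a) l (𝓝 (X * Y)) := by
  have h : Continuous fun p : Matrix ι κ ℝ × Matrix κ μ ℝ => p.1 * p.2 :=
    continuous_fst.matrix_mul continuous_snd
  exact (h.tendsto (X, Y)).comp (hf.prodMk_nhds hg)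

theorem tendsto_matrix_transpose {ι κ : Type*} {f : α → Matrix ι κ ℝ} {X : Matrix ι κ ℝ}
    (hf : Tendsto f l (𝓝 X)) : Tendsto (fun a => (f a)ᵀ) l (𝓝 Xᵀ) := by
  have h : Continuous fun Y : Matrix ι κ ℝ => Yᵀ := continuous_id.matrix_transpose
  exact (h.tendsto X).comp hf

theorem tendsto_gain (hR : R.PosDef) (hP : P.PosDef) (hf : Tendsto f l (𝓝 P)) :
    Tendsto (fun a => gain C R (f a)) l (𝓝 (gain C R P)) :=
  tendsto_matrix_mul (tendsto_matrix_mul hf tendsto_const_nhds) (tendsto_inv_of_posDef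
    ((tendsto_matrix_mul (tendsto_matrix_mul tendsto_const_nhds hf) tendsto_const_nhds).add
      tendsto_const_nhds) (posDef_innovation hR hP))

theorem tendsto_updCov (hR : R.PosDef) (hP : P.PosDef) (hf : Tendsto f l (𝓝 P)) :
    Tendsto (fun a => updCov C R (f a)) l (𝓝 (updCov C R P)) :=
  hf.sub (tendsto_matrix_mul (tendsto_matrix_mul (tendsto_gain hR hP hf) tendsto_const_nhds) hf)

theorem tendsto_riccati (hR : R.PosDef) (hP : P.PosDef)
    (hD : ((updCov C R P)⁻¹ - θ • (1 : Matrix (Fin n) (Fin n) ℝ)).PosDef)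
    (hf : Tendsto f l (𝓝 P)) (hθ : Tendsto θs l (𝓝 θ)) :
    Tendsto (fun a => riccati A C Q R (θs a) (f a)) l (𝓝 (riccati A C Q R θ P)) := by
  have h1 := tendsto_inv_of_posDef (tendsto_updCov (C := C) hR hP hf) (posDef_updCov hR hP)
  have h2 := tendsto_inv_of_posDef
    (h1.sub (hθ.smul_const (1 : Matrix (Fin n) (Fin n) ℝ))) hD
  exact (tendsto_matrix_mul (tendsto_matrix_mul tendsto_const_nhds h2) tendsto_const_nhds).add
    tendsto_const_nhds

theorem tendsto_gamma (hD : (1 - θ • P).PosDef) (hf : Tendsto f l (𝓝 P))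
    (hθ : Tendsto θs l (𝓝 θ)) :
    Tendsto (fun a => gamma (f a) (θs a)) l (𝓝 (gamma P θ)) := by
  have h1 : Tendsto (fun a => 1 - θs a • f a) l (𝓝 (1 - θ • P)) :=
    tendsto_const_nhds.sub (hθ.smul hf)
  have h2 := (tendsto_inv_of_posDef h1 hD).sub_const 1
  have hdet : Continuous fun X : Matrix (Fin n) (Fin n) ℝ => X.det := continuous_id.matrix_det
  have htr : Continuous fun X : Matrix (Fin n) (Fin n) ℝ => X.trace := continuous_id.matrix_trace
  have h3 := ((hdet.tendsto _).comp h1).log hD.det_pos.ne'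
  have h4 := (htr.tendsto _).comp h2
  exact (h3.add h4).const_mul _

end Continuity

theorem exists_isRun [NeZero n] (hQ : Q.PosDef) (hR : R.PosDef) {c : ℝ} (hc : 0 < c)
    {P₀ : Matrix (Fin n) (Fin n) ℝ} (hP₀ : P₀.PosDef) :
    ∃ Ps θs, IsRun A C Q R c P₀ Ps θs := by
  choose θ hθ using fun P : {P : Matrix (Fin n) (Fin n) ℝ // P.PosDef} =>
    exists_isRiskParam (posDef_updCov (C := C) hR P.2) hc
  let F : {P : Matrix (Fin n) (Fin n) ℝ // P.PosDef} → {P : Matrix (Fin n) (Fin n) ℝ // P.PosDef} :=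
    fun P => ⟨riccati A C Q R (θ P) P.1, posDef_of_le hQ (le_riccati
      (posDef_inv_sub_smul_one (posDef_updCov hR P.2) (hθ P).pos (hθ P).admissible))⟩
  refine ⟨fun t => (F^[t] ⟨P₀, hP₀⟩).1, fun t => θ (F^[t] ⟨P₀, hP₀⟩), rfl, fun t => hθ _,
    fun t => ?_⟩
  simp only [Function.iterate_succ_apply']
  rfl

/-- Constants for which the Riccati recursion with risk sensitivity at most `θ₀` enters the region
`Q ≤ P ≤ M` after `n` steps and contracts there. -/
structure RiccatiBounds (A : Matrix (Fin n) (Fin n) ℝ) (C : Matrix (Fin m) (Fin n) ℝ)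
    (Q : Matrix (Fin n) (Fin n) ℝ) (R : Matrix (Fin m) (Fin m) ℝ) (M z K ρ δ θ₀ : ℝ) : Prop where
  posM : 0 < M
  posz : 0 < z
  posK : 0 < K
  one_lt : 1 < ρ
  nonneg_δ : 0 ≤ δ
  δ_le_one : δ ≤ 1
  conj_le : (2 * M) • (A * Aᵀ) ≤ K • Q
  ratio : M • 1 ≤ ρ • Q
  contract : δ * (K * (ρ + 1) + (K + 1 / 2) * (ρ ^ 2 - 1)) ≤ 1 / 2
  θ_le : θ₀ ≤ δ / (2 * M)
  upd_ge : z • 1 ≤ updCov C R Q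
  upper : ∀ (P : ℕ → Matrix (Fin n) (Fin n) ℝ) (θ : ℕ → ℝ), (∀ k, (P k).PosDef) →
    (∀ k, ((updCov C R (P k))⁻¹ - θ k • 1).PosDef) →
    (∀ k, P (k + 1) = riccati A C Q R (θ k) (P k)) → (∀ k, θ k ≤ θ₀) → P n ≤ M • 1

theorem exists_riccatiBounds [NeZero n] (hobs : Observable A C) (hQ : Q.PosDef) (hR : R.PosDef) :
    ∃ M z K ρ δ θ₁ : ℝ, 0 < θ₁ ∧ ∀ θ₀ ≤ θ₁, RiccatiBounds A C Q R M z K ρ δ θ₀ := by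
  obtain ⟨ε, hε, hεx⟩ := hobs.exists_stageCost_bound hQ hR
  set M := 2 / ε with hM
  have hM0 : 0 < M := by positivity
  obtain ⟨K, hK0, hK⟩ := exists_le_smul (X := (2 * M) • (A * Aᵀ)) (Y := Q)
    (by rw [transpose_smul, transpose_mul, transpose_transpose]) hQ
  obtain ⟨ρ', hρ0, hρ'⟩ := exists_le_smul (X := M • (1 : Matrix (Fin n) (Fin n) ℝ)) (Y := Q)
    (by simp) hQ
  obtain ⟨z, hz0, hz⟩ := exists_smul_one_le (posDef_updCov (C := C) hR hQ)
  set ρ := ρ' + 1 with hρ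
  have hc0 : 0 < K * (ρ + 1) + (K + 1 / 2) * (ρ ^ 2 - 1) := by
    have : 0 ≤ ρ ^ 2 - 1 := by nlinarith
    positivity
  set c := K * (ρ + 1) + (K + 1 / 2) * (ρ ^ 2 - 1) with hc
  set δ := min 1 (1 / (2 * c)) with hδ
  have hδ0 : 0 < δ := lt_min one_pos (by positivity)
  refine ⟨M, z, K, ρ, δ, min (ε / 2) (δ / (2 * M)), lt_min (by positivity) (by positivity),
    fun θ₀ hθ₀ => ⟨hM0, hz0, hK0, by linarith, hδ0.le, min_le_left _ _, hK, ?_, ?_,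
      hθ₀.trans (min_le_right _ _), hz, ?_⟩⟩
  · exact hρ'.trans (smul_le_smul_of_nonneg_right (by linarith) hQ.nonneg)
  · calc δ * c ≤ 1 / (2 * c) * c := by
          gcongr
          exact min_le_right _ _
      _ = 1 / 2 := by field_simp
  · intro P θ hP hD hstep hθ
    refine le_smul_one_of_trajectory hQ hε (hP 0) (fun k _ => ?_) (fun k _ => ?_)
      (fun k _ => (hθ k).trans (hθ₀.trans (min_le_left _ _))) (hP n) hεx
    · rw [← updCov_inv hR (hP k)]
      exact hD k
    · rw [hstep, riccati_eq hR (hP k)]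

/-- The contraction rate of a Riccati recursion. -/
def rate (K : ℝ) : ℝ := (2 * K + 1) / (2 * K + 2)

theorem rate_pos {K : ℝ} (hK : 0 < K) : 0 < rate K := by
  rw [rate]
  positivity

theorem rate_lt_one {K : ℝ} (hK : 0 < K) : rate K < 1 := by
  rw [rate, div_lt_one (by positivity)]
  linarith

namespace RiccatiBounds

variable {M z K ρ δ θ₀ : ℝ}

theorem θ_le' (h : RiccatiBounds A C Q R M z K ρ δ θ₀) : θ₀ ≤ 1 / (2 * M) := by
  refine h.θ_le.trans ?_
  have := h.posM
  have := h.δ_le_one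
  gcongr

theorem θ_mul_le (h : RiccatiBounds A C Q R M z K ρ δ θ₀) : θ₀ * M ≤ 1 / 2 := by
  have h1 := mul_le_mul_of_nonneg_right h.θ_le' h.posM.le
  have := h.posM
  have e : 1 / (2 * M) * M = 1 / 2 := by field_simp
  linarith

theorem step (h : RiccatiBounds A C Q R M z K ρ δ θ₀) (hQ : Q.PosDef) (hR : R.PosDef)
    {P P' : Matrix (Fin n) (Fin n) ℝ} {θ θ' r : ℝ} (hr : 1 ≤ r) (hrρ : r ≤ ρ)
    (hP : Q ≤ P) (hPM : P ≤ M • 1) (hP' : Q ≤ P') (hPM' : P' ≤ M • 1) (hPP' : RatioLe r P P')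
    (hθ : θ ≤ θ₀) (hθ' : θ' ≤ θ₀) (h1 : θ ≤ r * θ') (h2 : θ' ≤ r * θ) :
    RatioLe (1 + rate K * (r - 1)) (riccati A C Q R θ P) (riccati A C Q R θ' P') :=
  ⟨riccati_le_smul hQ hR h.posM h.posK h.conj_le h.nonneg_δ h.δ_le_one h.contract
      (hθ'.trans h.θ_le) hr hrρ hP' hPM' hP hPP'.1 h1,
    riccati_le_smul hQ hR h.posM h.posK h.conj_le h.nonneg_δ h.δ_le_one h.contract
      (hθ.trans h.θ_le) hr hrρ hP hPM hP' hPP'.2 h2⟩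

theorem one_sub_posDef (h : RiccatiBounds A C Q R M z K ρ δ θ₀) (hR : R.PosDef)
    {P : Matrix (Fin n) (Fin n) ℝ} {θ : ℝ} (hP : P.PosDef) (hPM : P ≤ M • 1)
    (hθ0 : 0 ≤ θ) (hθ : θ ≤ θ₀) : (1 - θ • updCov C R P).PosDef := by
  have h1 := smul_le_smul_of_nonneg_left ((updCov_le (C := C) hR hP).trans hPM) hθ0
  refine posDef_of_le (posDef_smul_one one_half_pos) ?_
  refine le_trans ?_ (sub_le_sub_left h1 1)
  have e : 1 - θ • (M • (1 : Matrix (Fin n) (Fin n) ℝ)) = (1 - θ * M) • 1 := by module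
  rw [e]
  refine smul_le_smul_of_nonneg_right ?_ PosDef.one.nonneg
  have := mul_le_mul_of_nonneg_right hθ h.posM.le
  linarith [h.θ_mul_le]

theorem inv_sub_posDef (h : RiccatiBounds A C Q R M z K ρ δ θ₀) (hR : R.PosDef)
    {P : Matrix (Fin n) (Fin n) ℝ} {θ : ℝ} (hP : P.PosDef) (hPM : P ≤ M • 1)
    (hθ : θ ≤ θ₀) : ((updCov C R P)⁻¹ - θ • 1).PosDef := by
  have hX := posDef_updCov (C := C) hR hP
  have h1 := inv_antitone hX ((updCov_le (C := C) hR hP).trans hPM)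
  rw [inv_smul_one] at h1
  have hM := h.posM
  refine posDef_of_le (posDef_smul_one (show 0 < 1 / (2 * M) by positivity)) ?_
  refine le_trans ?_ (sub_le_sub_right h1 _)
  rw [← sub_smul]
  refine smul_le_smul_of_nonneg_right ?_ PosDef.one.nonneg
  have e : M⁻¹ = 1 / (2 * M) + 1 / (2 * M) := by
    field_simp
    norm_num
  linarith [h.θ_le']

theorem steady_mem (h : RiccatiBounds A C Q R M z K ρ δ θ₀)
    {P : Matrix (Fin n) (Fin n) ℝ} {θ : ℝ} (hθ : θ ≤ θ₀) (hs : IsSteady A C Q R θ P) :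
    Q ≤ P ∧ P ≤ M • 1 := by
  refine ⟨?_, h.upper (fun _ => P) (fun _ => θ) (fun _ => hs.posDef) (fun _ => hs.admissible)
    (fun _ => hs.eq) (fun _ => hθ)⟩
  have := le_riccati (A := A) (Q := Q) hs.admissible
  rwa [← hs.eq] at this

theorem tendsto_ratio_zero (h : RiccatiBounds A C Q R M z K ρ δ θ₀) :
    Tendsto (fun t : ℕ => (ρ - 1) * rate K ^ t) atTop (𝓝 0) := by
  simpa using (tendsto_pow_atTop_nhds_zero_of_lt_one (rate_pos h.posK).le
    (rate_lt_one h.posK)).const_mul (ρ - 1)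

theorem ratio_nonneg (h : RiccatiBounds A C Q R M z K ρ δ θ₀) (t : ℕ) :
    0 ≤ (ρ - 1) * rate K ^ t :=
  mul_nonneg (by linarith [h.one_lt]) (pow_nonneg (rate_pos h.posK).le t)

theorem ratio_le (h : RiccatiBounds A C Q R M z K ρ δ θ₀) (t : ℕ) :
    1 + (ρ - 1) * rate K ^ t ≤ ρ := by
  have := mul_le_mul_of_nonneg_left
    (pow_le_one₀ (n := t) (rate_pos h.posK).le (rate_lt_one h.posK).le)
    (show 0 ≤ ρ - 1 by linarith [h.one_lt])
  linarith

theorem ratio_succ (t : ℕ) : 1 + (ρ - 1) * rate K ^ (t + 1) =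
    1 + rate K * (1 + (ρ - 1) * rate K ^ t - 1) := by
  ring

theorem initial_ratio (h : RiccatiBounds A C Q R M z K ρ δ θ₀)
    {P P' : Matrix (Fin n) (Fin n) ℝ} (hP : Q ≤ P) (hPM : P ≤ M • 1) (hP' : Q ≤ P')
    (hPM' : P' ≤ M • 1) : RatioLe (1 + (ρ - 1) * rate K ^ 0) P P' := by
  rw [pow_zero, mul_one, add_sub_cancel]
  exact ratioLe_of_mem_Icc (by linarith [h.one_lt]) h.ratio hP hPM hP' hPM'

/-- Two solutions are constant runs with the same parameter, so applying the contraction repeatedly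
drives their ratio to $1$. -/
theorem steady_unique (h : RiccatiBounds A C Q R M z K ρ δ θ₀) (hQ : Q.PosDef) (hR : R.PosDef)
    {P P' : Matrix (Fin n) (Fin n) ℝ} {θ : ℝ} (hθ0 : 0 ≤ θ) (hθ : θ ≤ θ₀)
    (hs : IsSteady A C Q R θ P) (hs' : IsSteady A C Q R θ P') : P = P' := by
  obtain ⟨hP, hPM⟩ := h.steady_mem hθ hs
  obtain ⟨hP', hPM'⟩ := h.steady_mem hθ hs'
  have key : ∀ t : ℕ, RatioLe (1 + (ρ - 1) * rate K ^ t) P P' := by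
    intro t
    induction t with
    | zero => exact h.initial_ratio hP hPM hP' hPM'
    | succ t ih =>
      have hn := h.ratio_nonneg t
      have h1 : θ ≤ (1 + (ρ - 1) * rate K ^ t) * θ := by nlinarith
      have := h.step hQ hR (by linarith) (h.ratio_le t) hP hPM hP' hPM' ih hθ hθ h1 h1
      rwa [← hs.eq, ← hs'.eq, ← ratio_succ] at this
  exact tendsto_nhds_unique tendsto_const_nhds (tendsto_of_ratioLe hs'.posDef.nonneg
    h.tendsto_ratio_zero (fun _ => hs.posDef.nonneg) (Eventually.of_forall key))

end RiccatiBounds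

/-- A trajectory of the filter recursion that stays in the region `Q ≤ P ≤ M`, with risk
sensitivity at most `θ₀`. -/
structure IsRegularRun (A : Matrix (Fin n) (Fin n) ℝ) (C : Matrix (Fin m) (Fin n) ℝ)
    (Q : Matrix (Fin n) (Fin n) ℝ) (R : Matrix (Fin m) (Fin m) ℝ) (c M θ₀ : ℝ)
    (P : ℕ → Matrix (Fin n) (Fin n) ℝ) (θ : ℕ → ℝ) : Prop where
  lower : ∀ t, Q ≤ P t
  upper : ∀ t, P t ≤ M • 1
  risk : ∀ t, IsRiskParam c (updCov C R (P t)) (θ t)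
  θ_le : ∀ t, θ t ≤ θ₀
  step : ∀ t, P (t + 1) = riccati A C Q R (θ t) (P t)

namespace IsRegularRun

variable {c M z K ρ δ θ₀ : ℝ} {P P' : ℕ → Matrix (Fin n) (Fin n) ℝ} {θ θ' : ℕ → ℝ}

theorem shift (hr : IsRegularRun A C Q R c M θ₀ P θ) :
    IsRegularRun A C Q R c M θ₀ (fun t => P (t + 1)) (fun t => θ (t + 1)) :=
  ⟨fun _ => hr.lower _, fun _ => hr.upper _, fun _ => hr.risk _, fun _ => hr.θ_le _,
    fun _ => hr.step _⟩

theorem risk_le [NeZero n] (hr : IsRegularRun A C Q R c M θ₀ P θ)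
    (hr' : IsRegularRun A C Q R c M θ₀ P' θ') (hQ : Q.PosDef) (hR : R.PosDef) {r : ℝ}
    (h1 : 1 ≤ r) (t : ℕ) (h : RatioLe r (P t) (P' t)) : θ' t ≤ r * θ t :=
  (hr.risk t).le_mul (posDef_updCov hR (posDef_of_le hQ (hr.lower t)))
    (posDef_updCov hR (posDef_of_le hQ (hr'.lower t))) (hr'.risk t)
    (updCov_le_smul hR (posDef_of_le hQ (hr'.lower t)) (posDef_of_le hQ (hr.lower t)) h1 h.1)

theorem ratioLe [NeZero n] (hr : IsRegularRun A C Q R c M θ₀ P θ)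
    (hr' : IsRegularRun A C Q R c M θ₀ P' θ') (h : RiccatiBounds A C Q R M z K ρ δ θ₀)
    (hQ : Q.PosDef) (hR : R.PosDef) (t : ℕ) : RatioLe (1 + (ρ - 1) * rate K ^ t) (P t) (P' t) := by
  induction t with
  | zero => exact h.initial_ratio (hr.lower 0) (hr.upper 0) (hr'.lower 0) (hr'.upper 0)
  | succ t ih =>
    have hn := h.ratio_nonneg t
    rw [hr.step, hr'.step, RiccatiBounds.ratio_succ]
    exact h.step hQ hR (by linarith) (h.ratio_le t) (hr.lower t) (hr.upper t) (hr'.lower t)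
      (hr'.upper t) ih (hr.θ_le t) (hr'.θ_le t) (hr'.risk_le hr hQ hR (by linarith) t ih.symm)
      (hr.risk_le hr' hQ hR (by linarith) t ih)

theorem abs_sub_le [NeZero n] (hr : IsRegularRun A C Q R c M θ₀ P θ)
    (hr' : IsRegularRun A C Q R c M θ₀ P' θ') (h : RiccatiBounds A C Q R M z K ρ δ θ₀)
    (hQ : Q.PosDef) (hR : R.PosDef) (t : ℕ) : |θ t - θ' t| ≤ ((ρ - 1) * rate K ^ t) * θ₀ := by
  have hn := h.ratio_nonneg t
  have h0 := hr.ratioLe hr' h hQ hR t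
  have h1 := hr.risk_le hr' hQ hR (by linarith) t h0
  have h2 := hr'.risk_le hr hQ hR (by linarith) t h0.symm
  have h3 := mul_le_mul_of_nonneg_left (hr.θ_le t) hn
  have h4 := mul_le_mul_of_nonneg_left (hr'.θ_le t) hn
  rw [abs_le]
  constructor <;> linarith

theorem tendsto [NeZero n] (hr : IsRegularRun A C Q R c M θ₀ P θ)
    {P' : Matrix (Fin n) (Fin n) ℝ} {θ' : ℝ}
    (hr' : IsRegularRun A C Q R c M θ₀ (fun _ => P') (fun _ => θ'))
    (h : RiccatiBounds A C Q R M z K ρ δ θ₀) (hQ : Q.PosDef) (hR : R.PosDef) :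
    Tendsto P atTop (𝓝 P') ∧ Tendsto θ atTop (𝓝 θ') := by
  constructor
  · exact tendsto_of_ratioLe (posDef_of_le hQ (hr'.lower 0)).nonneg
      h.tendsto_ratio_zero (fun t => (posDef_of_le hQ (hr.lower t)).nonneg) (Eventually.of_forall fun t => hr.ratioLe hr' h hQ hR t)
  · rw [tendsto_iff_norm_sub_tendsto_zero]
    refine squeeze_zero (fun t => norm_nonneg _) (fun t => hr.abs_sub_le hr' h hQ hR t) ?_
    simpa using h.tendsto_ratio_zero.mul_const θ₀

/-- The contraction applied to a run and its shift makes consecutive covariances and parameters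
geometrically close; the step equation and the tolerance equation pass to the limit by continuity.
-/
theorem exists_limit [NeZero n] (hr : IsRegularRun A C Q R c M θ₀ P θ) (hc : 0 < c)
    (h : RiccatiBounds A C Q R M z K ρ δ θ₀) (hQ : Q.PosDef) (hR : R.PosDef) :
    ∃ P' θ', IsSteady A C Q R θ' P' ∧ IsRegularRun A C Q R c M θ₀ (fun _ => P') (fun _ => θ') := by
  obtain ⟨P', hP'⟩ := exists_tendsto_of_ratioLe (C := ρ - 1) (by linarith [h.one_lt])
    (rate_pos h.posK).le (rate_lt_one h.posK) hr.upper (fun t => hr.ratioLe hr.shift h hQ hR t)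
  obtain ⟨θ', hθ'⟩ : ∃ θ', Tendsto θ atTop (𝓝 θ') := by
    refine cauchySeq_tendsto_of_complete
      (cauchySeq_of_le_geometric (rate K) ((ρ - 1) * θ₀) (rate_lt_one h.posK) fun t => ?_)
    rw [Real.dist_eq]
    refine (hr.abs_sub_le hr.shift h hQ hR t).trans (le_of_eq ?_)
    ring
  have hlow : Q ≤ P' := ge_of_tendsto' hP' hr.lower
  have hup : P' ≤ M • 1 := le_of_tendsto' hP' hr.upper
  have hθ0 : 0 ≤ θ' := ge_of_tendsto' hθ' fun t => (hr.risk t).pos.le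
  have hθle : θ' ≤ θ₀ := le_of_tendsto' hθ' hr.θ_le
  have hPp := posDef_of_le hQ hlow
  have hadm := h.one_sub_posDef hR hPp hup hθ0 hθle
  have hD := h.inv_sub_posDef hR hPp hup hθle
  have hstep : P' = riccati A C Q R θ' P' := by
    refine tendsto_nhds_unique ((tendsto_add_atTop_iff_nat 1).2 hP') ?_
    refine (tendsto_riccati hR hPp hD hP' hθ').congr fun t => ?_
    rw [hr.step]
  have hγ : gamma (updCov C R P') θ' = c := by
    refine tendsto_nhds_unique (tendsto_gamma hadm (tendsto_updCov hR hPp hP') hθ') ?_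
    refine tendsto_const_nhds.congr fun t => ?_
    rw [(hr.risk t).eq]
  -- Positivity may be lost in the limit, but $\gamma(X,0)=0\ne c$.
  have hθpos : 0 < θ' := by
    refine lt_of_le_of_ne hθ0 ?_
    rintro rfl
    simp [gamma] at hγ
    linarith
  exact ⟨P', θ', ⟨hPp, hD, hstep⟩, fun _ => hlow, fun _ => hup, fun _ => ⟨hθpos, hadm, hγ⟩,
    fun _ => hθle, fun _ => hstep⟩

end IsRegularRun

/-- One step gives $P\ge Q$, hence $P^+\ge zI$ and small $\theta$ from then on; $n$ further steps
give the upper bound. This is the shift by $n+1$. -/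
theorem IsRun.isRegularRun {c M z K ρ δ θ₀ : ℝ} {P₀ : Matrix (Fin n) (Fin n) ℝ}
    {P : ℕ → Matrix (Fin n) (Fin n) ℝ} {θ : ℕ → ℝ} (hr : IsRun A C Q R c P₀ P θ)
    (h : RiccatiBounds A C Q R M z K ρ δ θ₀) (hQ : Q.PosDef) (hR : R.PosDef) (hP₀ : P₀.PosDef)
    (hc : ∀ (X : Matrix (Fin n) (Fin n) ℝ) (η : ℝ), z • 1 ≤ X → IsRiskParam c X η → η ≤ θ₀) :
    IsRegularRun A C Q R c M θ₀ (fun t => P (t + (n + 1))) (fun t => θ (t + (n + 1))) := by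
  have hD : ∀ t, (P t).PosDef → ((updCov C R (P t))⁻¹ - θ t • 1).PosDef := fun t ht =>
    posDef_inv_sub_smul_one (posDef_updCov hR ht) (hr.risk t).pos (hr.risk t).admissible
  have hPp : ∀ t, (P t).PosDef := by
    intro t
    induction t with
    | zero => rwa [hr.init]
    | succ t ih =>
      rw [hr.step]
      exact posDef_of_le hQ (le_riccati (hD t ih))
  have hlow : ∀ t, Q ≤ P (t + 1) := by
    intro t
    rw [hr.step]
    exact le_riccati (hD t (hPp t))
  have hθ : ∀ t, θ (t + 1) ≤ θ₀ := fun t =>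
    hc _ _ (h.upd_ge.trans (updCov_mono hR hQ (hlow t))) (hr.risk _)
  refine ⟨fun t => hlow (t + n), fun t => ?_, fun t => hr.risk _, fun t => hθ (t + n), fun t => ?_⟩
  · have := h.upper (fun k => P (t + 1 + k)) (fun k => θ (t + 1 + k)) (fun k => hPp _)
      (fun k => hD _ (hPp _)) (fun k => hr.step _) (fun k => by
        have := hθ (t + k)
        rwa [show t + k + 1 = t + 1 + k by ring] at this)
    rwa [show t + 1 + n = t + (n + 1) by ring] at this
  · rw [show t + 1 + (n + 1) = t + (n + 1) + 1 by ring, hr.step]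

end Filter

/-! ### The backward recursion: reduced form, invariant region, fixed point, stability. -/

section Backward

open scoped MatrixOrder

variable {n m : ℕ}

/-- One step `W ↦ Bᵀ (W⁻¹ - L Lᵀ)⁻¹ B + q I` of the backward recursion. -/
def bwd (q : ℝ) (B : Matrix (Fin n) (Fin n) ℝ) (L : Matrix (Fin n) (Fin m) ℝ)
    (W : Matrix (Fin n) (Fin n) ℝ) : Matrix (Fin n) (Fin n) ℝ :=
  Bᵀ * (W⁻¹ - L * Lᵀ)⁻¹ * B + q • 1

section Algebra

variable {A W B : Matrix (Fin n) (Fin n) ℝ} {L : Matrix (Fin n) (Fin m) ℝ}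
  {C : Matrix (Fin m) (Fin n) ℝ}

theorem inv_mul_gram_mul (hW : W.PosDef) (hD : (W⁻¹ - L * Lᵀ).PosDef) :
    (W⁻¹ - L * Lᵀ)⁻¹ * (L * Lᵀ) * W = (W⁻¹ - L * Lᵀ)⁻¹ - W := by
  have e : L * Lᵀ = W⁻¹ - (W⁻¹ - L * Lᵀ) := by abel
  conv_lhs => lhs; rhs; rw [e]
  rw [Matrix.mul_sub, hD.inv_mul, Matrix.sub_mul, Matrix.mul_assoc, hW.inv_mul, Matrix.mul_one,
    Matrix.one_mul]

theorem one_add_mul_one_sub (hW : W.PosDef) (hD : (W⁻¹ - L * Lᵀ).PosDef) :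
    (1 + Lᵀ * (W⁻¹ - L * Lᵀ)⁻¹ * L) * (1 - Lᵀ * W * L) = 1 := by
  have h := inv_mul_gram_mul hW hD
  set D := W⁻¹ - L * Lᵀ
  have e : Lᵀ * D⁻¹ * L * (Lᵀ * W * L) = Lᵀ * (D⁻¹ * (L * Lᵀ) * W) * L := by
    simp only [Matrix.mul_assoc]
  rw [Matrix.add_mul, Matrix.mul_sub, Matrix.mul_sub, e, h]
  simp only [Matrix.one_mul, Matrix.mul_one, Matrix.mul_sub, Matrix.sub_mul]
  abel

theorem posDef_one_add (hD : (W⁻¹ - L * Lᵀ).PosDef) :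
    (1 + Lᵀ * (W⁻¹ - L * Lᵀ)⁻¹ * L).PosDef := by
  have := conj_nonneg hD.inv.nonneg Lᵀ
  rw [transpose_transpose] at this
  exact posDef_add_nonneg PosDef.one this

theorem one_sub_eq_inv (hW : W.PosDef) (hD : (W⁻¹ - L * Lᵀ).PosDef) :
    1 - Lᵀ * W * L = (1 + Lᵀ * (W⁻¹ - L * Lᵀ)⁻¹ * L)⁻¹ :=
  (inv_eq_right_inv (one_add_mul_one_sub hW hD)).symm

theorem posDef_one_sub (hW : W.PosDef) (hD : (W⁻¹ - L * Lᵀ).PosDef) :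
    (1 - Lᵀ * W * L).PosDef := by
  rw [one_sub_eq_inv hW hD]
  exact (posDef_one_add hD).inv

theorem lfO_eq (hW : W.PosDef) (hD : (W⁻¹ - L * Lᵀ).PosDef) :
    lfO L W = 1 + Lᵀ * (W⁻¹ - L * Lᵀ)⁻¹ * L := by
  rw [lfO, one_sub_eq_inv hW hD, (posDef_one_add hD).inv_inv]

theorem lfO_mul (hW : W.PosDef) (hD : (W⁻¹ - L * Lᵀ).PosDef) :
    lfO L W * Lᵀ * W = Lᵀ * (W⁻¹ - L * Lᵀ)⁻¹ := by
  have h := inv_mul_gram_mul hW hD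
  rw [lfO_eq hW hD]
  set D := W⁻¹ - L * Lᵀ
  have e : Lᵀ * D⁻¹ * L * Lᵀ * W = Lᵀ * (D⁻¹ * (L * Lᵀ) * W) := by
    simp only [Matrix.mul_assoc]
  rw [Matrix.add_mul, Matrix.add_mul, e, h, Matrix.one_mul, Matrix.mul_sub]
  abel

/-- With $D=W^{-1}-LL^\top$, the inversion lemma gives $O=I+L^\top D^{-1}L$ and $FA=-L^\top
D^{-1}\bar A$; the two quadratic terms then combine to $D^{-1}$ between $\bar A^\top$ and $\bar A$.
-/
theorem backward_step_eq (hW : W.PosDef) (hD : (W⁻¹ - L * Lᵀ).PosDef) :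
    (lfF C L W * A)ᵀ * (lfO L W)⁻¹ * (lfF C L W * A) + (abar A C L)ᵀ * W * abar A C L =
      (abar A C L)ᵀ * (W⁻¹ - L * Lᵀ)⁻¹ * abar A C L := by
  have hF : lfF C L W * A = -(Lᵀ * (W⁻¹ - L * Lᵀ)⁻¹ * abar A C L) := by
    rw [lfF, lfO_mul hW hD, abar, Matrix.neg_mul]
    simp only [Matrix.mul_assoc]
  have hO : (lfO L W)⁻¹ = 1 - Lᵀ * W * L := by
    rw [lfO, (posDef_one_sub hW hD).inv_inv]
  have h := inv_mul_gram_mul hW hD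
  have hDt := hD.inv.transpose_eq
  have hcore : (W⁻¹ - L * Lᵀ)⁻¹ * L * (1 - Lᵀ * W * L) * Lᵀ * (W⁻¹ - L * Lᵀ)⁻¹ + W =
      (W⁻¹ - L * Lᵀ)⁻¹ := by
    have h1 : (W⁻¹ - L * Lᵀ)⁻¹ * L * (1 - Lᵀ * W * L) * Lᵀ = W * (L * Lᵀ) := by
      have e : (W⁻¹ - L * Lᵀ)⁻¹ * L * (1 - Lᵀ * W * L) * Lᵀ = (W⁻¹ - L * Lᵀ)⁻¹ * (L * Lᵀ) -
          ((W⁻¹ - L * Lᵀ)⁻¹ * (L * Lᵀ) * W) * (L * Lᵀ) := by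
        rw [Matrix.mul_sub, Matrix.sub_mul, Matrix.mul_one]
        simp only [Matrix.mul_assoc]
      rw [e, h, Matrix.sub_mul]
      abel
    have h2 : W * (L * Lᵀ) = 1 - W * (W⁻¹ - L * Lᵀ) := by
      rw [Matrix.mul_sub, hW.mul_inv]
      abel
    rw [h1, h2, Matrix.sub_mul, Matrix.mul_assoc, hD.mul_inv, Matrix.mul_one, Matrix.one_mul]
    abel
  rw [hF, hO, transpose_neg, Matrix.neg_mul, Matrix.neg_mul, Matrix.mul_neg, neg_neg, transpose_mul,
    transpose_mul, hDt, transpose_transpose]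
  conv_rhs => rw [← hcore]
  simp only [Matrix.mul_add, Matrix.add_mul, Matrix.mul_assoc]

theorem feedback_eq (hW : W.PosDef) (hD : (W⁻¹ - L * Lᵀ).PosDef) {J : Matrix (Fin n) (Fin m) ℝ}
    (hJ : J = Bᵀ * W * L * (Lᵀ * W * L - 1)⁻¹) :
    B - L * Jᵀ = W⁻¹ * (W⁻¹ - L * Lᵀ)⁻¹ * B := by
  have hO : (Lᵀ * W * L - 1)⁻¹ = -lfO L W := by
    apply inv_eq_right_inv
    rw [lfO, Matrix.mul_neg, ← Matrix.neg_mul, neg_sub, (posDef_one_sub hW hD).mul_inv]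
  have hOt : (lfO L W)ᵀ = lfO L W := by
    rw [lfO]
    exact (posDef_one_sub hW hD).inv.transpose_eq
  have hJt : Jᵀ = -(Lᵀ * (W⁻¹ - L * Lᵀ)⁻¹ * B) := by
    rw [hJ, hO, Matrix.mul_neg, transpose_neg, transpose_mul, transpose_mul, transpose_mul,
      transpose_transpose, hOt, hW.transpose_eq, ← lfO_mul hW hD]
    simp only [Matrix.mul_assoc]
  have e : L * Lᵀ = W⁻¹ - (W⁻¹ - L * Lᵀ) := by abel
  rw [hJt, Matrix.mul_neg, sub_neg_eq_add, ← Matrix.mul_assoc, ← Matrix.mul_assoc]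
  conv_lhs => rhs; lhs; lhs; rw [e]
  rw [Matrix.sub_mul, hD.mul_inv, Matrix.sub_mul, Matrix.one_mul]
  abel

/-- For a complex eigenvector $a+ib$, adding the real quadratic forms at $a$ and $b$ cancels the
cross terms and leaves $(1-|\mu|^2)(a^\top Sa+b^\top Sb)>0$. -/
theorem stable_of_lyapunov {M S : Matrix (Fin n) (Fin n) ℝ} (hS : S.PosDef)
    (h : (S - Mᵀ * S * M).PosDef) : Stable M := by
  intro μ hμ
  have hμ' : Module.End.HasEigenvalue (Matrix.toLin' (M.map (algebraMap ℝ ℂ))) μ := by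
    rw [Module.End.hasEigenvalue_iff_mem_spectrum, Matrix.spectrum_toLin']
    exact hμ
  obtain ⟨v, hv, hv0⟩ := hμ'.exists_hasEigenvector
  rw [Module.End.mem_eigenspace_iff, toLin'_apply] at hv
  set a : Fin n → ℝ := fun i => (v i).re with ha
  set b : Fin n → ℝ := fun i => (v i).im with hb
  have hMa : M *ᵥ a = μ.re • a - μ.im • b := by
    funext i
    have := congrArg Complex.re (congrFun hv i)
    simpa [mulVec, dotProduct, ha, hb] using this
  have hMb : M *ᵥ b = μ.re • b + μ.im • a := by
    funext i
    have := congrArg Complex.im (congrFun hv i)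
    simpa [mulVec, dotProduct, ha, hb] using this
  have hsym : b ⬝ᵥ S *ᵥ a = a ⬝ᵥ S *ᵥ b := by
    rw [dotProduct_mulVec, ← mulVec_transpose, hS.transpose_eq, dotProduct_comm]
  have hq : ∀ x, x ⬝ᵥ (S - Mᵀ * S * M) *ᵥ x = x ⬝ᵥ S *ᵥ x - (M *ᵥ x) ⬝ᵥ S *ᵥ (M *ᵥ x) := by
    intro x
    rw [sub_mulVec, dotProduct_sub, mulVec_mulVec, Matrix.mul_assoc, ← mulVec_mulVec,
      dotProduct_mulVec x Mᵀ, vecMul_transpose]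
  have hnn : ∀ x, 0 ≤ x ⬝ᵥ S *ᵥ x := (posSemidef_iff_quad.1 hS.posSemidef).2
  have hnn' := (posSemidef_iff_quad.1 h.posSemidef).2
  have hsum : a ⬝ᵥ (S - Mᵀ * S * M) *ᵥ a + b ⬝ᵥ (S - Mᵀ * S * M) *ᵥ b =
      (1 - ‖μ‖ ^ 2) * (a ⬝ᵥ S *ᵥ a + b ⬝ᵥ S *ᵥ b) := by
    rw [hq, hq, hMa, hMb, ← Complex.normSq_eq_norm_sq, Complex.normSq_apply]
    simp only [mulVec_add, mulVec_sub, mulVec_smul, add_dotProduct, sub_dotProduct, dotProduct_add,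
      dotProduct_sub, smul_dotProduct, dotProduct_smul, smul_eq_mul, hsym]
    ring
  have hne : a ≠ 0 ∨ b ≠ 0 := by
    by_contra! hc
    refine hv0 (funext fun i => Complex.ext ?_ ?_)
    · exact congrFun hc.1 i
    · exact congrFun hc.2 i
  have hpos : 0 < a ⬝ᵥ (S - Mᵀ * S * M) *ᵥ a + b ⬝ᵥ (S - Mᵀ * S * M) *ᵥ b := by
    rcases hne with hne | hne
    · exact add_pos_of_pos_of_nonneg ((posDef_iff_quad.1 h).2 _ hne) (hnn' b)
    · exact add_pos_of_nonneg_of_pos (hnn' a) ((posDef_iff_quad.1 h).2 _ hne)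
  rw [hsum] at hpos
  have h1 : 0 < 1 - ‖μ‖ ^ 2 := pos_of_mul_pos_left hpos (add_nonneg (hnn a) (hnn b))
  nlinarith [norm_nonneg μ]

end Algebra

theorem tendsto_bwd {α : Type*} {l : Filter α} {q : α → ℝ} {B : α → Matrix (Fin n) (Fin n) ℝ}
    {L : α → Matrix (Fin n) (Fin m) ℝ} {W : α → Matrix (Fin n) (Fin n) ℝ} {q' : ℝ}
    {B' W' : Matrix (Fin n) (Fin n) ℝ} {L' : Matrix (Fin n) (Fin m) ℝ} (hq : Tendsto q l (𝓝 q'))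
    (hB : Tendsto B l (𝓝 B')) (hL : Tendsto L l (𝓝 L')) (hW : Tendsto W l (𝓝 W'))
    (hWp : W'.PosDef) (hD : (W'⁻¹ - L' * L'ᵀ).PosDef) :
    Tendsto (fun a => bwd (q a) (B a) (L a) (W a)) l (𝓝 (bwd q' B' L' W')) :=
  (tendsto_matrix_mul (tendsto_matrix_mul (tendsto_matrix_transpose hB)
    (tendsto_inv_of_posDef ((tendsto_inv_of_posDef hW hWp).sub
      (tendsto_matrix_mul hL (tendsto_matrix_transpose hL))) hD)) hB).add (hq.smul_const _)

/-- Constants for which the backward recursion contracts on the region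
`θ / 2 ≤ W ≤ (w θ / y₂) Y`. -/
structure BackwardBounds (y₁ y₂ ρ ℓ w δ θ : ℝ) : Prop where
  y₁_pos : 0 < y₁
  y₂_pos : 0 < y₂
  ρ_pos : 0 < ρ
  ρ_lt : ρ < 1
  ℓ_nonneg : 0 ≤ ℓ
  w_eq : w = 4 * y₂ / ((1 - ρ) * y₁)
  δ_nonneg : 0 ≤ δ
  δ_le : δ ≤ 1
  contract : δ * (2 * w * (2 * w + 1 + 1) + (2 * w + 1 / 2) * ((2 * w + 1) ^ 2 - 1)) ≤ 1 / 2
  θ_pos : 0 < θ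
  small : ℓ * (w * θ) ≤ (1 - ρ) / 2
  small' : ℓ * (w * θ) ≤ δ / 2

/-- The region scales with $\theta$, so $w$ and $\delta$, and with them the contraction rate, are
independent of $\theta$; only the two conditions on $\ell w\theta$ ask $\theta$ to be small. -/
theorem exists_backwardBounds {y₁ y₂ ρ ℓ : ℝ} (hy₁ : 0 < y₁) (hy₂ : 0 < y₂) (hρ : 0 < ρ)
    (hρ1 : ρ < 1) (hℓ : 0 < ℓ) : ∃ w δ θ₁ : ℝ, 0 < θ₁ ∧ ∀ θ, 0 < θ → θ ≤ θ₁ →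
      BackwardBounds y₁ y₂ ρ ℓ w δ θ := by
  have h1 : 0 < 1 - ρ := by linarith
  set w := 4 * y₂ / ((1 - ρ) * y₁) with hw
  have hw0 : 0 < w := by positivity
  set c := 2 * w * (2 * w + 1 + 1) + (2 * w + 1 / 2) * ((2 * w + 1) ^ 2 - 1) with hc
  have hc0 : 0 < c := by
    have : (2 * w + 1) ^ 2 - 1 = 4 * w ^ 2 + 4 * w := by ring
    rw [hc, this]
    positivity
  set δ := min 1 (1 / (2 * c)) with hδ
  have hδ0 : 0 < δ := lt_min one_pos (by positivity)
  refine ⟨w, δ, min ((1 - ρ) / 2 / (ℓ * w)) (δ / 2 / (ℓ * w)), lt_min (by positivity)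
    (by positivity), fun θ hθ hθ' => ⟨hy₁, hy₂, hρ, hρ1, hℓ.le, rfl, hδ0.le, min_le_left _ _, ?_, hθ,
    ?_, ?_⟩⟩
  · calc δ * c ≤ 1 / (2 * c) * c := by
          gcongr
          exact min_le_right _ _
      _ = 1 / 2 := by field_simp
  · have := hθ'.trans (min_le_left _ _)
    rw [le_div_iff₀ (by positivity)] at this
    linarith
  · have := hθ'.trans (min_le_right _ _)
    rw [le_div_iff₀ (by positivity)] at this
    linarith

/-- Admissible coefficients of the backward recursion. -/
structure IsAdmissible (Y : Matrix (Fin n) (Fin n) ℝ) (ρ ℓ θ : ℝ) (q : ℝ)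
    (B : Matrix (Fin n) (Fin n) ℝ) (L : Matrix (Fin n) (Fin m) ℝ) : Prop where
  q_ge : θ / 2 ≤ q
  q_le : q ≤ 2 * θ
  lyapunov : Bᵀ * Y * B ≤ ρ • Y
  gain_le : L * Lᵀ ≤ ℓ • 1

/-- The invariant region of the backward recursion. -/
def InRegion (Y : Matrix (Fin n) (Fin n) ℝ) (y₂ w θ : ℝ) (W : Matrix (Fin n) (Fin n) ℝ) : Prop :=
  (θ / 2) • 1 ≤ W ∧ W ≤ (w * θ / y₂) • Y

namespace BackwardBounds

variable {y₁ y₂ ρ ℓ w δ θ q : ℝ} {Y W W' B : Matrix (Fin n) (Fin n) ℝ} {L : Matrix (Fin n) (Fin m) ℝ}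

theorem w_pos (h : BackwardBounds y₁ y₂ ρ ℓ w δ θ) : 0 < w := by
  have h1 : 0 < 1 - ρ := by linarith [h.ρ_lt]
  have := h.y₁_pos
  have := h.y₂_pos
  rw [h.w_eq]
  positivity

theorem posDef (h : BackwardBounds y₁ y₂ ρ ℓ w δ θ) (hW : InRegion Y y₂ w θ W) : W.PosDef :=
  posDef_of_le (posDef_smul_one (half_pos h.θ_pos)) hW.1

theorem le_smul_one (h : BackwardBounds y₁ y₂ ρ ℓ w δ θ) (hY : Y ≤ y₂ • 1) :
    (w * θ / y₂) • Y ≤ (w * θ) • 1 := by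
  have h1 := h.w_pos
  have h2 := h.θ_pos
  have h3 := h.y₂_pos
  have := smul_le_smul_of_nonneg_left hY (show 0 ≤ w * θ / y₂ by positivity)
  rwa [smul_smul, div_mul_cancel₀ _ h3.ne'] at this

theorem gram_le (h : BackwardBounds y₁ y₂ ρ ℓ w δ θ) (hY : Y ≤ y₂ • 1)
    (hc : IsAdmissible Y ρ ℓ θ q B L) (hW : InRegion Y y₂ w θ W) :
    L * Lᵀ ≤ (ℓ * (w * θ)) • W⁻¹ := by
  have h1 := h.w_pos
  have h2 := h.θ_pos
  have h3 := inv_antitone (h.posDef hW) (hW.2.trans (h.le_smul_one hY))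
  rw [inv_smul_one] at h3
  have := smul_le_smul_of_nonneg_left h3 (show 0 ≤ ℓ * (w * θ) from
    mul_nonneg h.ℓ_nonneg (by positivity))
  rw [smul_smul, mul_assoc, mul_inv_cancel₀ (by positivity), mul_one] at this
  exact hc.gain_le.trans this

theorem smul_inv_le (h : BackwardBounds y₁ y₂ ρ ℓ w δ θ) (hY : Y ≤ y₂ • 1)
    (hc : IsAdmissible Y ρ ℓ θ q B L) (hW : InRegion Y y₂ w θ W) :
    (1 - ℓ * (w * θ)) • W⁻¹ ≤ W⁻¹ - L * Lᵀ := by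
  rw [sub_smul, one_smul]
  exact sub_le_sub_left (h.gram_le hY hc hW) _

theorem one_sub_pos (h : BackwardBounds y₁ y₂ ρ ℓ w δ θ) : 0 < 1 - ℓ * (w * θ) := by
  linarith [h.small, h.ρ_pos]

theorem posDef_sub (h : BackwardBounds y₁ y₂ ρ ℓ w δ θ) (hY : Y ≤ y₂ • 1)
    (hc : IsAdmissible Y ρ ℓ θ q B L) (hW : InRegion Y y₂ w θ W) : (W⁻¹ - L * Lᵀ).PosDef :=
  posDef_of_le ((h.posDef hW).inv.smul h.one_sub_pos) (h.smul_inv_le hY hc hW)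

theorem gram_le_smul_sub (h : BackwardBounds y₁ y₂ ρ ℓ w δ θ) (hY : Y ≤ y₂ • 1)
    (hc : IsAdmissible Y ρ ℓ θ q B L) (hW : InRegion Y y₂ w θ W) :
    L * Lᵀ ≤ δ • (W⁻¹ - L * Lᵀ) := by
  refine (h.gram_le hY hc hW).trans ?_
  refine le_trans ?_ (smul_le_smul_of_nonneg_left (h.smul_inv_le hY hc hW) h.δ_nonneg)
  rw [smul_smul]
  refine smul_le_smul_of_nonneg_right ?_ (h.posDef hW).inv.nonneg
  nlinarith [h.small', h.δ_nonneg, h.δ_le]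

/-- The ceiling $(w\theta/y_2)Y$ is split into shares: the dynamics use $(1+\rho)/2$, because
$\rho/(1-x)\le(1+\rho)/2$ for $0\le x\le(1-\rho)/2$, and the added $qI$ uses the remaining
$(1-\rho)/2$. -/
theorem conj_inv_le (h : BackwardBounds y₁ y₂ ρ ℓ w δ θ) (hY0 : 0 ≤ Y) (hY : Y ≤ y₂ • 1)
    (hc : IsAdmissible Y ρ ℓ θ q B L) (hW : InRegion Y y₂ w θ W) :
    Bᵀ * (W⁻¹ - L * Lᵀ)⁻¹ * B ≤ ((1 + ρ) / 2 * (w * θ / y₂)) • Y := by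
  have hx := h.one_sub_pos
  have hw := h.w_pos
  have hθ := h.θ_pos
  have hy := h.y₂_pos
  have h1 := inv_antitone ((h.posDef hW).inv.smul hx) (h.smul_inv_le hY hc hW)
  rw [inv_smul_of_posDef (h.posDef hW).inv hx.ne', (h.posDef hW).inv_inv] at h1
  have h2 := h1.trans (smul_le_smul_of_nonneg_left hW.2 (inv_nonneg.2 hx.le))
  rw [smul_smul] at h2
  have h3 := conj_mono' h2 B
  rw [Matrix.mul_smul, Matrix.smul_mul] at h3
  have hk : 0 ≤ (1 - ℓ * (w * θ))⁻¹ * (w * θ / y₂) := by positivity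
  refine h3.trans ((smul_le_smul_of_nonneg_left hc.lyapunov hk).trans ?_)
  rw [smul_smul]
  refine smul_le_smul_of_nonneg_right ?_ hY0
  rw [mul_right_comm]
  refine mul_le_mul_of_nonneg_right ?_ (by positivity)
  rw [inv_mul_le_iff₀ hx]
  nlinarith [h.small, h.ρ_pos, h.ρ_lt, sq_nonneg (1 - ρ)]

theorem smul_one_le (h : BackwardBounds y₁ y₂ ρ ℓ w δ θ) (hY1 : y₁ • 1 ≤ Y) (hq : q ≤ 2 * θ) :
    q • 1 ≤ ((1 - ρ) / 2 * (w * θ / y₂)) • Y := by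
  have hw := h.w_pos
  have hθ := h.θ_pos
  have hy := h.y₂_pos
  have hy1 := h.y₁_pos
  have hr : 0 < 1 - ρ := by linarith [h.ρ_lt]
  refine le_trans ?_ (smul_le_smul_of_nonneg_left hY1 (by positivity))
  rw [smul_smul]
  refine smul_le_smul_of_nonneg_right (hq.trans (le_of_eq ?_)) PosDef.one.nonneg
  -- The value of $w$ is the one that makes this an equality.
  rw [h.w_eq]
  field_simp
  norm_num

theorem inRegion_smul_one (h : BackwardBounds y₁ y₂ ρ ℓ w δ θ) (hY1 : y₁ • 1 ≤ Y)
    (hq : θ / 2 ≤ q) (hq' : q ≤ 2 * θ) : InRegion Y y₂ w θ (q • 1) := by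
  have hw := h.w_pos
  have hθ := h.θ_pos
  have hy := h.y₂_pos
  refine ⟨smul_le_smul_of_nonneg_right hq PosDef.one.nonneg, (h.smul_one_le hY1 hq').trans ?_⟩
  refine smul_le_smul_of_nonneg_right ?_ (posDef_of_le (posDef_smul_one h.y₁_pos) hY1).nonneg
  have : 0 ≤ w * θ / y₂ := by positivity
  nlinarith [h.ρ_pos]

theorem inRegion_bwd (h : BackwardBounds y₁ y₂ ρ ℓ w δ θ) (hY1 : y₁ • 1 ≤ Y) (hY : Y ≤ y₂ • 1)
    (hc : IsAdmissible Y ρ ℓ θ q B L) (hW : InRegion Y y₂ w θ W) :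
    InRegion Y y₂ w θ (bwd q B L W) := by
  have hY0 := (posDef_of_le (posDef_smul_one h.y₁_pos) hY1).nonneg
  constructor
  · have hq : (θ / 2) • (1 : Matrix (Fin n) (Fin n) ℝ) ≤ q • 1 :=
      smul_le_smul_of_nonneg_right hc.q_ge PosDef.one.nonneg
    refine hq.trans ?_
    have := conj_nonneg (h.posDef_sub hY hc hW).inv.nonneg Bᵀ
    rw [transpose_transpose] at this
    exact le_add_of_nonneg_left this
  · refine (add_le_add (h.conj_inv_le hY0 hY hc hW) (h.smul_one_le hY1 hc.q_le)).trans
      (le_of_eq ?_)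
    module

/-- This is the bound $B\le KQ$ of the contraction estimate, with $Q$ replaced by $qI$ and $K=2w$:
ceiling $w\theta$ against floor $q\ge\theta/2$. -/
theorem conj_inv_le_smul_one (h : BackwardBounds y₁ y₂ ρ ℓ w δ θ) (hY0 : 0 ≤ Y) (hY : Y ≤ y₂ • 1)
    (hc : IsAdmissible Y ρ ℓ θ q B L) (hW : InRegion Y y₂ w θ W) :
    Bᵀ * (W⁻¹ - L * Lᵀ)⁻¹ * B ≤ (2 * w) • (q • 1) := by
  have hw := h.w_pos
  have hθ := h.θ_pos
  have hy := h.y₂_pos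
  have h0 : 0 ≤ w * θ / y₂ := by positivity
  refine (h.conj_inv_le hY0 hY hc hW).trans ?_
  have h1 : (1 + ρ) / 2 * (w * θ / y₂) ≤ w * θ / y₂ := by nlinarith [h.ρ_lt]
  refine (smul_le_smul_of_nonneg_right h1 hY0).trans ((h.le_smul_one hY).trans ?_)
  rw [smul_smul]
  refine smul_le_smul_of_nonneg_right ?_ PosDef.one.nonneg
  nlinarith [hc.q_ge]

theorem bwd_le_smul (h : BackwardBounds y₁ y₂ ρ ℓ w δ θ) (hY0 : 0 ≤ Y) (hY : Y ≤ y₂ • 1)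
    (hc : IsAdmissible Y ρ ℓ θ q B L) (hW : InRegion Y y₂ w θ W) (hW' : InRegion Y y₂ w θ W')
    {r : ℝ} (hr : 1 ≤ r) (hr' : r ≤ 2 * w + 1) (hWW : W' ≤ r • W) :
    bwd q B L W' ≤ (1 + rate (2 * w) * (r - 1)) • bwd q B L W := by
  have hw := h.w_pos
  have hD := h.posDef_sub hY hc hW
  have hH : L * Lᵀ ≤ r • (L * Lᵀ) := by
    have := smul_le_smul_of_nonneg_right hr (mul_transpose_self_nonneg L)
    rwa [one_smul] at this
  have := conj_inv_add_le (A := Bᵀ) (Q := q • 1) (K := 2 * w) hD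
    (smul_sub_le_sub (h.posDef hW) (h.posDef hW') hr hWW hH (h.gram_le_smul_sub hY hc hW)) hr hr'
    (by positivity) (by
      rw [transpose_transpose]
      exact h.conj_inv_le_smul_one hY0 hY hc hW) h.δ_nonneg h.contract
  rwa [transpose_transpose] at this

theorem ratioLe_of_inRegion (h : BackwardBounds y₁ y₂ ρ ℓ w δ θ) (hY : Y ≤ y₂ • 1)
    (hW : InRegion Y y₂ w θ W) (hW' : InRegion Y y₂ w θ W') : RatioLe (2 * w + 1) W W' := by
  have hw := h.w_pos
  have hθ := h.θ_pos
  refine ratioLe_of_mem_Icc (by positivity) ?_ hW.1 (hW.2.trans (h.le_smul_one hY)) hW'.1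
    (hW'.2.trans (h.le_smul_one hY))
  rw [smul_smul]
  refine smul_le_smul_of_nonneg_right ?_ PosDef.one.nonneg
  linarith

/-- The contraction holds for ratios up to $2w+1$, which no two matrices of the region exceed; a
larger given ratio is first replaced by this one. -/
theorem ratioLe_bwd (h : BackwardBounds y₁ y₂ ρ ℓ w δ θ) (hY0 : 0 ≤ Y) (hY : Y ≤ y₂ • 1)
    (hc : IsAdmissible Y ρ ℓ θ q B L) (hW : InRegion Y y₂ w θ W) (hW' : InRegion Y y₂ w θ W')
    (hb : 0 ≤ bwd q B L W) (hb' : 0 ≤ bwd q B L W') {u : ℝ} (hu : 0 ≤ u)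
    (hWW : RatioLe (1 + u) W W') :
    RatioLe (1 + rate (2 * w) * u) (bwd q B L W) (bwd q B L W') := by
  have hw := h.w_pos
  have key : ∀ r, 1 ≤ r → r ≤ 2 * w + 1 → RatioLe r W W' →
      RatioLe (1 + rate (2 * w) * (r - 1)) (bwd q B L W) (bwd q B L W') := fun r hr hr' hrr =>
    ⟨h.bwd_le_smul hY0 hY hc hW' hW hr hr' hrr.1, h.bwd_le_smul hY0 hY hc hW hW' hr hr' hrr.2⟩
  rcases le_total (1 + u) (2 * w + 1) with hle | hle
  · have := key (1 + u) (by linarith) hle hWW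
    rwa [add_sub_cancel_left] at this
  · refine (key (2 * w + 1) (by linarith) le_rfl (h.ratioLe_of_inRegion hY hW hW')).mono ?_ hb hb'
    have := rate_pos (show 0 < 2 * w by positivity)
    have := mul_le_mul_of_nonneg_left (show 2 * w + 1 - 1 ≤ u by linarith) this.le
    linarith

theorem exists_fixedPoint (h : BackwardBounds y₁ y₂ ρ ℓ w δ θ) (hY1 : y₁ • 1 ≤ Y) (hY : Y ≤ y₂ • 1)
    (hc : IsAdmissible Y ρ ℓ θ q B L) : ∃ W, InRegion Y y₂ w θ W ∧ bwd q B L W = W := by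
  have hY0 := (posDef_of_le (posDef_smul_one h.y₁_pos) hY1).nonneg
  have hK : 0 < 2 * w := by linarith [h.w_pos]
  set X : ℕ → Matrix (Fin n) (Fin n) ℝ := fun t => (bwd q B L)^[t] (q • 1) with hX
  have hstep : ∀ t, X (t + 1) = bwd q B L (X t) := fun t => Function.iterate_succ_apply' _ _ _
  have hreg : ∀ t, InRegion Y y₂ w θ (X t) := by
    intro t
    induction t with
    | zero => exact h.inRegion_smul_one hY1 hc.q_ge hc.q_le
    | succ t ih =>
      rw [hstep]
      exact h.inRegion_bwd hY1 hY hc ih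
  have hratio : ∀ t, RatioLe (1 + 2 * w * rate (2 * w) ^ t) (X t) (X (t + 1)) := by
    intro t
    induction t with
    | zero =>
      rw [pow_zero, mul_one, add_comm]
      exact h.ratioLe_of_inRegion hY (hreg 0) (hreg 1)
    | succ t ih =>
      have := h.ratioLe_bwd hY0 hY hc (hreg t) (hreg (t + 1))
        (by rw [← hstep]; exact (h.posDef (hreg _)).nonneg)
        (by rw [← hstep]; exact (h.posDef (hreg _)).nonneg)
        (mul_nonneg hK.le (pow_nonneg (rate_pos hK).le t)) ih
      rw [← hstep, ← hstep] at this
      convert this using 1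
      ring
  obtain ⟨W, hW⟩ := exists_tendsto_of_ratioLe hK.le (rate_pos hK).le (rate_lt_one hK)
    (fun t => (hreg t).2) hratio
  have hWreg : InRegion Y y₂ w θ W :=
    ⟨ge_of_tendsto' hW fun t => (hreg t).1, le_of_tendsto' hW fun t => (hreg t).2⟩
  refine ⟨W, hWreg, ?_⟩
  have h1 := tendsto_bwd (tendsto_const_nhds (x := q)) (tendsto_const_nhds (x := B))
    (tendsto_const_nhds (x := L)) hW (h.posDef hWreg) (h.posDef_sub hY hc hWreg)
  refine tendsto_nhds_unique h1 (((tendsto_add_atTop_iff_nat 1).2 hW).congr fun t => ?_)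
  rw [hstep]

/-- With $D=W^{-1}-LL^\top$ the closed loop is $G=W^{-1}D^{-1}B$. From $W^{-1}\le(1+\delta)D$ and
the fixed point equation, $G^\top WG\le(1+\delta)(W-qI)\le W-(q/2)I$, so $W$ is a Lyapunov matrix.
-/
theorem stable_feedback (h : BackwardBounds y₁ y₂ ρ ℓ w δ θ) (hY0 : 0 ≤ Y) (hY : Y ≤ y₂ • 1)
    (hc : IsAdmissible Y ρ ℓ θ q B L) (hW : InRegion Y y₂ w θ W) (hfix : bwd q B L W = W)
    {J : Matrix (Fin n) (Fin m) ℝ} (hJ : J = Bᵀ * W * L * (Lᵀ * W * L - 1)⁻¹) :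
    Stable (B - L * Jᵀ) := by
  have hWp := h.posDef hW
  have hD := h.posDef_sub hY hc hW
  have hDi := hD.inv.transpose_eq
  rw [feedback_eq hWp hD hJ]
  refine stable_of_lyapunov hWp ?_
  have hgram := h.gram_le_smul_sub hY hc hW
  have hle := h.conj_inv_le_smul_one hY0 hY hc hW
  have hfix' : Bᵀ * (W⁻¹ - L * Lᵀ)⁻¹ * B = W - q • 1 := eq_sub_of_add_eq hfix
  have e : W⁻¹ = (W⁻¹ - L * Lᵀ) + L * Lᵀ := by abel
  have h1 : (W⁻¹ * (W⁻¹ - L * Lᵀ)⁻¹ * B)ᵀ * W * (W⁻¹ * (W⁻¹ - L * Lᵀ)⁻¹ * B) =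
      ((W⁻¹ - L * Lᵀ)⁻¹ * B)ᵀ * W⁻¹ * ((W⁻¹ - L * Lᵀ)⁻¹ * B) := by
    rw [Matrix.mul_assoc W⁻¹, transpose_mul, hWp.inv.transpose_eq, Matrix.mul_assoc _ W⁻¹ W,
      hWp.inv_mul, Matrix.mul_one, Matrix.mul_assoc]
  have h2 : W⁻¹ ≤ (1 + δ) • (W⁻¹ - L * Lᵀ) := by
    conv_lhs => rw [e]
    rw [add_smul, one_smul]
    exact add_le_add_right hgram _
  have h3 := conj_mono' h2 ((W⁻¹ - L * Lᵀ)⁻¹ * B)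
  have e1 : ((W⁻¹ - L * Lᵀ)⁻¹ * B)ᵀ * (W⁻¹ - L * Lᵀ) * ((W⁻¹ - L * Lᵀ)⁻¹ * B) = W - q • 1 := by
    rw [transpose_mul, hDi, Matrix.mul_assoc Bᵀ, hD.inv_mul, Matrix.mul_one, ← Matrix.mul_assoc,
      hfix']
  rw [← h1, Matrix.mul_smul, Matrix.smul_mul, e1] at h3
  rw [hfix'] at hle
  have hw := h.w_pos
  have hq : 0 < q := by linarith [hc.q_ge, h.θ_pos]
  have hδw : δ * (2 * w) ≤ 1 / 2 := by
    refine le_trans (mul_le_mul_of_nonneg_left ?_ h.δ_nonneg) h.contract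
    nlinarith [sq_nonneg w]
  have h4 := smul_le_smul_of_nonneg_left hle h.δ_nonneg
  refine posDef_of_le (posDef_smul_one (half_pos hq)) ?_
  rw [le_sub_comm]
  refine h3.trans ?_
  rw [add_smul, one_smul]
  refine (add_le_add_right h4 _).trans ?_
  rw [← sub_nonneg]
  have e2 : W - (q / 2) • 1 - (W - q • 1 + δ • (2 * w) • q • (1 : Matrix (Fin n) (Fin n) ℝ)) =
      (q * (1 / 2 - δ * (2 * w))) • 1 := by module
  rw [e2]
  exact smul_nonneg (mul_nonneg hq.le (by linarith)) PosDef.one.nonneg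

end BackwardBounds

end Backward

/-! ### Convergence in the interior of the horizon. -/

section Interior

open scoped MatrixOrder

variable {n m : ℕ}

namespace BackwardBounds

variable {y₁ y₂ ρ ℓ w δ θ : ℝ} {Y W : Matrix (Fin n) (Fin n) ℝ} {q : ℕ → ℝ}
  {B : ℕ → Matrix (Fin n) (Fin n) ℝ} {L : ℕ → Matrix (Fin n) (Fin m) ℝ}

theorem inRegion_of_recursion (h : BackwardBounds y₁ y₂ ρ ℓ w δ θ) (hY1 : y₁ • 1 ≤ Y)
    (hY : Y ≤ y₂ • 1) {T : ℕ} (hc : ∀ t ≥ T, IsAdmissible Y ρ ℓ θ (q t) (B t) (L t))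
    {V : ℕ → Matrix (Fin n) (Fin n) ℝ} {N : ℕ} (hterm : InRegion Y y₂ w θ (V (N + 1)))
    (hrec : ∀ t, T ≤ t → t ≤ N → InRegion Y y₂ w θ (V (t + 1)) →
      V t = bwd (q t) (B t) (L t) (V (t + 1))) :
    ∀ t, T ≤ t → t ≤ N + 1 → InRegion Y y₂ w θ (V t) := by
  have key : ∀ j t, T ≤ t → t + j = N + 1 → InRegion Y y₂ w θ (V t) := by
    intro j
    induction j with
    | zero =>
      rintro t - ht
      rw [add_zero] at ht
      rwa [ht]
    | succ j ih =>
      intro t hT ht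
      have hr := ih (t + 1) (by omega) (by omega)
      rw [hrec t hT (by omega) hr]
      exact h.inRegion_bwd hY1 hY (hc t hT) hr
  intro t hT ht
  exact key (N + 1 - t) t hT (by omega)

/-- A step moving $W$ by a ratio at most $1+\eta$ sends the excess $u$ to at most $\kappa'u+\eta$,
with $\kappa'$ midway between the rate and $1$. Iteration leaves $\eta/(1-\kappa')\le\varepsilon/2$
plus a geometric term, small $K$ steps before the end. Neither $\eta$ nor $K$ depends on the
coefficients or on the horizon, whence uniformity. -/
theorem exists_interior_ratioLe (h : BackwardBounds y₁ y₂ ρ ℓ w δ θ) (hY1 : y₁ • 1 ≤ Y)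
    (hY : Y ≤ y₂ • 1) (hW : InRegion Y y₂ w θ W) {ε : ℝ} (hε : 0 < ε) :
    ∃ η : ℝ, 0 < η ∧ ∃ K : ℕ, ∀ (q : ℕ → ℝ) (B : ℕ → Matrix (Fin n) (Fin n) ℝ)
      (L : ℕ → Matrix (Fin n) (Fin m) ℝ) (T : ℕ),
      (∀ t ≥ T, IsAdmissible Y ρ ℓ θ (q t) (B t) (L t)) →
      (∀ t ≥ T, RatioLe (1 + η) (bwd (q t) (B t) (L t) W) W) →
      ∀ (V : ℕ → Matrix (Fin n) (Fin n) ℝ) (N : ℕ), InRegion Y y₂ w θ (V (N + 1)) →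
      (∀ t, T ≤ t → t ≤ N → InRegion Y y₂ w θ (V (t + 1)) →
        V t = bwd (q t) (B t) (L t) (V (t + 1))) →
      ∀ t, T ≤ t → t + K ≤ N + 1 → RatioLe (1 + ε) (V t) W := by
  have hw := h.w_pos
  have hY0 := (posDef_of_le (posDef_smul_one h.y₁_pos) hY1).nonneg
  set κ := rate (2 * w) with hκ
  have hκ0 : 0 < κ := rate_pos (by positivity)
  have hκ1 : κ < 1 := rate_lt_one (by positivity)
  set κ' := (1 + κ) / 2 with hκ'
  have hκ'1 : 0 < 1 - κ' := by linarith
  have hκ'0 : 0 < κ' := by linarith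
  set η := min ((1 - κ) / 2) (ε / 2 * (1 - κ')) with hη
  have hη0 : 0 < η := lt_min (by linarith) (by positivity)
  have hη1 : κ * (1 + η) ≤ κ' := by
    have := min_le_left ((1 - κ) / 2) (ε / 2 * (1 - κ'))
    nlinarith
  have hη2 : η / (1 - κ') ≤ ε / 2 := by
    rw [div_le_iff₀ hκ'1]
    exact min_le_right _ _
  obtain ⟨K, hK⟩ := exists_pow_lt_of_lt_one (show 0 < ε / 2 / (2 * w) by positivity)
    (show κ' < 1 by linarith)
  rw [lt_div_iff₀ (by positivity)] at hK
  refine ⟨η, hη0, K, fun q B L T hc hηW V N hterm hrec => ?_⟩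
  have hreg := h.inRegion_of_recursion hY1 hY hc hterm hrec
  have key : ∀ j t, T ≤ t → t + j = N + 1 →
      RatioLe (1 + (2 * w * κ' ^ j + η / (1 - κ'))) (V t) W := by
    intro j
    induction j with
    | zero =>
      intro t hT ht
      refine (h.ratioLe_of_inRegion hY (hreg t hT (by omega)) hW).mono ?_
        (h.posDef (hreg t hT (by omega))).nonneg (h.posDef hW).nonneg
      have : 0 ≤ η / (1 - κ') := by positivity
      rw [pow_zero]
      linarith
    | succ j ih =>
      intro t hT ht
      have hr := hreg (t + 1) (by omega) (by omega)
      have hu : 0 ≤ 2 * w * κ' ^ j + η / (1 - κ') := by positivity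
      have hb := (h.posDef (h.inRegion_bwd hY1 hY (hc t hT) hr)).nonneg
      have hb' := (h.posDef (h.inRegion_bwd hY1 hY (hc t hT) hW)).nonneg
      have h1 := h.ratioLe_bwd hY0 hY (hc t hT) hr hW hb hb' hu (ih (t + 1) (by omega) (by omega))
      have h2 := h1.trans (hηW t hT) (by positivity) (by positivity)
      rw [← hrec t hT (by omega) hr] at h2
      refine h2.mono ?_ (h.posDef (hreg t hT (by omega))).nonneg (h.posDef hW).nonneg
      have e : η / (1 - κ') = κ' * (η / (1 - κ')) + η := by
        field_simp
        ring
      have h3 := mul_le_mul_of_nonneg_right hη1 hu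
      rw [pow_succ]
      rw [← hκ]
      nlinarith
  intro t hT ht
  refine (key (N + 1 - t) t hT (by omega)).mono ?_ (h.posDef (hreg t hT (by omega))).nonneg
    (h.posDef hW).nonneg
  have hp : κ' ^ (N + 1 - t) ≤ κ' ^ K := pow_le_pow_of_le_one hκ'0.le (by linarith) (by omega)
  nlinarith

end BackwardBounds

/-- The filter of the pairs `(N, t)` with `N → ∞` and `lo N ≤ t ≤ hi N`. -/
def window (lo hi : ℕ → ℕ) : Filter (ℕ × ℕ) :=
  comap Prod.fst atTop ⊓ 𝓟 {p | lo p.1 ≤ p.2 ∧ p.2 ≤ hi p.1}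

theorem eventually_window {lo hi : ℕ → ℕ} {p : ℕ × ℕ → Prop} :
    (∀ᶠ a in window lo hi, p a) ↔ ∀ᶠ N in atTop, ∀ t, lo N ≤ t → t ≤ hi N → p (N, t) := by
  rw [window, eventually_inf_principal, eventually_comap]
  refine eventually_congr (Eventually.of_forall fun N => ⟨fun h t h1 h2 => h (N, t) rfl ⟨h1, h2⟩, ?_⟩)
  rintro h ⟨N', t⟩ rfl ⟨h1, h2⟩
  exact h t h1 h2

/-- Uniform convergence becomes convergence along a filter, so the ordinary continuity lemmas apply
to it. -/
theorem convergesOn_iff {α : Type*} [TopologicalSpace α] {lo hi : ℕ → ℕ} {X : ℕ → ℕ → α} {x : α} :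
    ConvergesOn lo hi X x ↔ Tendsto (fun p => X p.1 p.2) (window lo hi) (𝓝 x) := by
  rw [ConvergesOn, tendsto_def]
  exact forall_congr' fun U => forall_congr' fun _ =>
    (eventually_window (p := fun p => X p.1 p.2 ∈ U)).symm

theorem tendsto_snd_window {lo hi : ℕ → ℕ} (hlo : Tendsto lo atTop atTop) :
    Tendsto Prod.snd (window lo hi) atTop := by
  refine tendsto_atTop.2 fun T => eventually_window.2 ?_
  filter_upwards [hlo.eventually_ge_atTop T] with N hN t ht _
  exact hN.trans ht

theorem eventually_window_le {lo hi : ℕ → ℕ} {K : ℕ} (hhi : ∀ᶠ N in atTop, hi N + K ≤ N + 1) :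
    ∀ᶠ p in window lo hi, p.2 + K ≤ p.1 + 1 := by
  refine eventually_window.2 ?_
  filter_upwards [hhi] with N hN t _ ht
  omega

theorem tendsto_floor_mul {α : ℝ} (hα : 0 < α) : Tendsto (fun N : ℕ => ⌊α * N⌋₊) atTop atTop :=
  tendsto_nat_floor_atTop.comp (tendsto_natCast_atTop_atTop.const_mul_atTop hα)

theorem eventually_ceil_mul_le {β : ℝ} (hβ0 : 0 < β) (hβ : β < 1) (K : ℕ) :
    ∀ᶠ N : ℕ in atTop, ⌈β * N⌉₊ + K ≤ N + 1 := by
  have h : Tendsto (fun N : ℕ => (1 - β) * (N : ℝ)) atTop atTop :=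
    tendsto_natCast_atTop_atTop.const_mul_atTop (by linarith)
  filter_upwards [h.eventually_ge_atTop (K : ℝ)] with N hN
  have h1 := Nat.ceil_lt_add_one (show 0 ≤ β * (N : ℝ) by positivity)
  have h2 : ((⌈β * N⌉₊ + K : ℕ) : ℝ) < ((N + 1 : ℕ) : ℝ) := by
    push_cast
    linarith
  exact (Nat.cast_lt.1 h2).le

end Interior

/-! ### Continuity of the least favorable model in the gain and $W$. -/

section LeastFavorable

variable {n m : ℕ} {α : Type*} {l : Filter α}

theorem tendsto_fromBlocks {ι κ μ ν : Type*} {a : α → Matrix ι κ ℝ} {b : α → Matrix ι μ ℝ}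
    {c : α → Matrix ν κ ℝ} {d : α → Matrix ν μ ℝ} {a' b' c' d'} (ha : Tendsto a l (𝓝 a'))
    (hb : Tendsto b l (𝓝 b')) (hc : Tendsto c l (𝓝 c')) (hd : Tendsto d l (𝓝 d')) :
    Tendsto (fun x => fromBlocks (a x) (b x) (c x) (d x)) l (𝓝 (fromBlocks a' b' c' d')) := by
  have h : Continuous fun p : (Matrix ι κ ℝ × Matrix ι μ ℝ) × (Matrix ν κ ℝ × Matrix ν μ ℝ) =>
      fromBlocks p.1.1 p.1.2 p.2.1 p.2.2 := by fun_prop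
  exact (h.tendsto ((a', b'), (c', d'))).comp
    ((ha.prodMk_nhds hb).prodMk_nhds (hc.prodMk_nhds hd))

theorem tendsto_fromCols {ι κ μ : Type*} {a : α → Matrix ι κ ℝ} {b : α → Matrix ι μ ℝ}
    {a' b'} (ha : Tendsto a l (𝓝 a')) (hb : Tendsto b l (𝓝 b')) :
    Tendsto (fun x => fromCols (a x) (b x)) l (𝓝 (fromCols a' b')) := by
  refine tendsto_pi_nhds.2 fun i => tendsto_pi_nhds.2 ?_
  rintro (j | j)
  · exact tendsto_pi_nhds.1 (tendsto_pi_nhds.1 ha i) j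
  · exact tendsto_pi_nhds.1 (tendsto_pi_nhds.1 hb i) j

theorem tendsto_fromRows {ι κ μ : Type*} {a : α → Matrix ι κ ℝ} {b : α → Matrix μ κ ℝ}
    {a' b'} (ha : Tendsto a l (𝓝 a')) (hb : Tendsto b l (𝓝 b')) :
    Tendsto (fun x => fromRows (a x) (b x)) l (𝓝 (fromRows a' b')) := by
  refine tendsto_pi_nhds.2 ?_
  rintro (i | i)
  · exact tendsto_pi_nhds.1 ha i
  · exact tendsto_pi_nhds.1 hb i

variable {A W' : Matrix (Fin n) (Fin n) ℝ} {C : Matrix (Fin m) (Fin n) ℝ}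
  {L : α → Matrix (Fin n) (Fin m) ℝ} {L' : Matrix (Fin n) (Fin m) ℝ}
  {W : α → Matrix (Fin n) (Fin n) ℝ}

theorem tendsto_one_sub (hL : Tendsto L l (𝓝 L')) (hW : Tendsto W l (𝓝 W')) :
    Tendsto (fun a => 1 - (L a)ᵀ * W a * L a) l (𝓝 (1 - L'ᵀ * W' * L')) :=
  tendsto_const_nhds.sub
    (tendsto_matrix_mul (tendsto_matrix_mul (tendsto_matrix_transpose hL) hW) hL)

theorem tendsto_lfO (hL : Tendsto L l (𝓝 L')) (hW : Tendsto W l (𝓝 W'))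
    (hp : (1 - L'ᵀ * W' * L').PosDef) : Tendsto (fun a => lfO (L a) (W a)) l (𝓝 (lfO L' W')) :=
  tendsto_inv_of_posDef (tendsto_one_sub hL hW) hp

theorem tendsto_lfF (hL : Tendsto L l (𝓝 L')) (hW : Tendsto W l (𝓝 W'))
    (hp : (1 - L'ᵀ * W' * L').PosDef) :
    Tendsto (fun a => lfF C (L a) (W a)) l (𝓝 (lfF C L' W')) :=
  (tendsto_matrix_mul (tendsto_matrix_mul (tendsto_matrix_mul (tendsto_lfO hL hW hp)
    (tendsto_matrix_transpose hL)) hW)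
    (tendsto_const_nhds.sub (tendsto_matrix_mul hL tendsto_const_nhds))).neg

theorem tendsto_lfA (hL : Tendsto L l (𝓝 L')) (hW : Tendsto W l (𝓝 W'))
    (hp : (1 - L'ᵀ * W' * L').PosDef) :
    Tendsto (fun a => lfA A C (L a) (W a)) l (𝓝 (lfA A C L' W')) := by
  have hF := tendsto_lfF (C := C) hL hW hp
  have hLC := tendsto_matrix_mul hL (tendsto_const_nhds (x := C))
  have hLF := tendsto_matrix_mul hL hF
  refine tendsto_fromBlocks tendsto_const_nhds tendsto_const_nhds tendsto_const_nhds
    (tendsto_fromBlocks ?_ ?_ tendsto_const_nhds tendsto_const_nhds)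
  · exact (tendsto_const_nhds.sub (tendsto_matrix_mul hLC tendsto_const_nhds)).sub
      (tendsto_matrix_mul hLF tendsto_const_nhds)
  · exact (tendsto_const_nhds.sub hLF).sub hLC

theorem tendsto_lfC (hL : Tendsto L l (𝓝 L')) (hW : Tendsto W l (𝓝 W'))
    (hp : (1 - L'ᵀ * W' * L').PosDef) :
    Tendsto (fun a => lfC A C (L a) (W a)) l (𝓝 (lfC A C L' W')) := by
  have hF := tendsto_lfF (C := C) hL hW hp
  exact tendsto_fromCols tendsto_const_nhds
    (tendsto_fromCols (tendsto_matrix_mul hF tendsto_const_nhds) hF)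

theorem IsSqrtMap.tendsto_lfO {S : Matrix (Fin m) (Fin m) ℝ → Matrix (Fin m) (Fin m) ℝ}
    (hS : IsSqrtMap S) (hL : Tendsto L l (𝓝 L')) (hW : Tendsto W l (𝓝 W'))
    (hp : (1 - L'ᵀ * W' * L').PosDef) (hev : ∀ᶠ a in l, (1 - (L a)ᵀ * W a * L a).PosDef) :
    Tendsto (fun a => S (lfO (L a) (W a))) l (𝓝 (S (lfO L' W'))) := by
  have h := (hS.cont (lfO L' W') hp.inv).tendsto
  exact h.comp (tendsto_nhdsWithin_iff.2 ⟨URKF.tendsto_lfO hL hW hp, hev.mono fun a ha => ha.inv⟩)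

theorem tendsto_lfB {Υ : α → Matrix (Fin m) (Fin m) ℝ} {Υ' : Matrix (Fin m) (Fin m) ℝ}
    (hL : Tendsto L l (𝓝 L')) (hΥ : Tendsto Υ l (𝓝 Υ')) :
    Tendsto (fun a => lfB (L a) (Υ a)) l (𝓝 (lfB L' Υ')) :=
  tendsto_fromBlocks tendsto_const_nhds tendsto_const_nhds tendsto_const_nhds
    (tendsto_fromRows (tendsto_matrix_mul hL hΥ).neg tendsto_const_nhds)

theorem tendsto_lfD {Υ : α → Matrix (Fin m) (Fin m) ℝ} {Υ' : Matrix (Fin m) (Fin m) ℝ}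
    (hΥ : Tendsto Υ l (𝓝 Υ')) : Tendsto (fun a => lfD n (Υ a)) l (𝓝 (lfD n Υ')) :=
  tendsto_fromCols tendsto_const_nhds hΥ

end LeastFavorable

/-! ### Choice of constants and assembly. -/

section Main

open scoped MatrixOrder

variable {n m : ℕ} {A : Matrix (Fin n) (Fin n) ℝ} {C : Matrix (Fin m) (Fin n) ℝ}
  {Q : Matrix (Fin n) (Fin n) ℝ} {R : Matrix (Fin m) (Fin m) ℝ}

theorem RiccatiBounds.steadyCov_eq {M z K ρ δ θ₀ : ℝ} (h : RiccatiBounds A C Q R M z K ρ δ θ₀)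
    (hQ : Q.PosDef) (hR : R.PosDef) {P : Matrix (Fin n) (Fin n) ℝ} {θ : ℝ} (hθ0 : 0 ≤ θ)
    (hθ : θ ≤ θ₀) (hs : IsSteady A C Q R θ P) : steadyCov A C Q R θ = P := by
  have hex : ∃ P, IsSteady A C Q R θ P := ⟨P, hs⟩
  rw [steadyCov, dif_pos hex]
  exact h.steady_unique hQ hR hθ0 hθ hex.choose_spec hs

/-- The scalar $q$ is free because $W_t$ carries the parameter of time $t-1$, not of time $t$. -/
theorem IsBackward.eq_bwd {L : ℕ → Matrix (Fin n) (Fin m) ℝ} {θ : ℕ → ℝ} {N : ℕ}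
    {Ω : ℕ → Matrix (Fin n) (Fin n) ℝ} (h : IsBackward A C L θ N Ω) {t : ℕ} (ht : t ≤ N) {q : ℝ}
    {W : Matrix (Fin n) (Fin n) ℝ} (hW : W = θ t • 1 + Ω (t + 1)) (hWp : W.PosDef)
    (hD : (W⁻¹ - L t * (L t)ᵀ).PosDef) : q • 1 + Ω t = bwd q (abar A C (L t)) (L t) W := by
  rw [h.step t ht W hW, backward_step_eq hWp hD, bwd, add_comm]

theorem tendsto_abar {α : Type*} {l : Filter α} {L : α → Matrix (Fin n) (Fin m) ℝ}
    {L' : Matrix (Fin n) (Fin m) ℝ} (hL : Tendsto L l (𝓝 L')) :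
    Tendsto (fun a => abar A C (L a)) l (𝓝 (abar A C L')) :=
  tendsto_matrix_mul (tendsto_const_nhds.sub (tendsto_matrix_mul hL tendsto_const_nhds))
    tendsto_const_nhds

/-- The gap $\rho_0<\rho$ lets the Lyapunov inequality of the limit survive, with the same $Y$, for
coefficients close to the limit. -/
theorem eventually_isAdmissible {Y : Matrix (Fin n) (Fin n) ℝ} {ρ₀ ρ ℓ θ : ℝ}
    {L : Matrix (Fin n) (Fin m) ℝ} {Ls : ℕ → Matrix (Fin n) (Fin m) ℝ} {θs : ℕ → ℝ}
    (hY : Y.PosDef) (hlyap : (abar A C L)ᵀ * Y * abar A C L ≤ ρ₀ • Y) (hρ : ρ₀ < ρ) (hθ0 : 0 < θ)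
    (hL : Tendsto Ls atTop (𝓝 L)) (hθ : Tendsto θs atTop (𝓝 θ))
    (hgain : ∀ᶠ t in atTop, Ls t * (Ls t)ᵀ ≤ ℓ • 1) :
    ∀ᶠ t in atTop, IsAdmissible Y ρ ℓ θ (θs (t - 1)) (abar A C (Ls t)) (Ls t) := by
  have hθ' := hθ.comp (tendsto_sub_atTop_nat 1)
  have hB := tendsto_abar (A := A) (C := C) hL
  have hlim := (tendsto_const_nhds (x := ρ • Y)).sub
    (tendsto_matrix_mul (tendsto_matrix_mul (tendsto_matrix_transpose hB)
      (tendsto_const_nhds (x := Y))) hB)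
  have hp : (ρ • Y - (abar A C L)ᵀ * Y * abar A C L).PosDef := by
    refine posDef_of_le (hY.smul (sub_pos.2 hρ)) ?_
    rw [sub_smul]
    exact sub_le_sub_left hlyap _
  have hev := eventually_posDef hlim hp (Eventually.of_forall fun t => by
    rw [transpose_sub, transpose_smul, transpose_mul, transpose_mul, transpose_transpose,
      hY.transpose_eq, Matrix.mul_assoc])
  filter_upwards [hev, hgain, hθ'.eventually (lt_mem_nhds (show θ / 2 < θ by linarith)),
    hθ'.eventually (gt_mem_nhds (show θ < 2 * θ by linarith))] with t h1 h2 h3 h4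
  exact ⟨h3.le, h4.le, sub_nonneg.1 h1.nonneg, h2⟩

namespace BackwardBounds

variable {y₁ y₂ ρ ℓ w δ θ : ℝ} {Y W : Matrix (Fin n) (Fin n) ℝ} {L : Matrix (Fin n) (Fin m) ℝ}

theorem steady_backward (h : BackwardBounds y₁ y₂ ρ ℓ w δ θ) (hY1 : y₁ • 1 ≤ Y) (hY : Y ≤ y₂ • 1)
    (hc : IsAdmissible Y ρ ℓ θ θ (abar A C L) L) (hW : InRegion Y y₂ w θ W)
    (hfix : bwd θ (abar A C L) L W = W) {Ω : ℕ → ℕ → Matrix (Fin n) (Fin n) ℝ}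
    (hΩ : ∀ N, IsBackward A C (fun _ => L) (fun _ => θ) N (Ω N)) :
    (∀ N, ∀ t ≤ N, (1 - Lᵀ * (θ • 1 + Ω N (t + 1)) * L).PosDef) ∧
      ∀ β : ℝ, 0 < β → β < 1 →
        ConvergesOn (fun _ => 0) (fun N => ⌈β * N⌉₊) (fun N t => θ • 1 + Ω N t) W := by
  have hterm : ∀ N, InRegion Y y₂ w θ (θ • 1 + Ω N (N + 1)) := by
    intro N
    rw [(hΩ N).terminal, add_zero]
    exact h.inRegion_smul_one hY1 hc.q_ge hc.q_le
  have hrec : ∀ N t, 0 ≤ t → t ≤ N → InRegion Y y₂ w θ (θ • 1 + Ω N (t + 1)) →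
      θ • 1 + Ω N t = bwd θ (abar A C L) L (θ • 1 + Ω N (t + 1)) := fun N t _ ht hr =>
    (hΩ N).eq_bwd ht rfl (h.posDef hr) (h.posDef_sub hY hc hr)
  have hreg := fun N => h.inRegion_of_recursion (T := 0) (V := fun t => θ • 1 + Ω N t) hY1 hY
    (fun _ _ => hc) (hterm N) (hrec N)
  refine ⟨fun N t ht => ?_, fun β hβ0 hβ => ?_⟩
  · have hr := hreg N (t + 1) (Nat.zero_le _) (by omega)
    exact posDef_one_sub (h.posDef hr) (h.posDef_sub hY hc hr)
  · rw [convergesOn_iff]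
    refine tendsto_of_forall_ratioLe (h.posDef hW).nonneg fun ε hε => ?_
    obtain ⟨η, hη, K, hK⟩ := h.exists_interior_ratioLe hY1 hY hW (m := m) hε
    have hself : RatioLe (1 + η) W W := by
      have := smul_le_smul_of_nonneg_right (show 1 ≤ 1 + η by linarith) (h.posDef hW).nonneg
      rw [one_smul] at this
      exact ⟨this, this⟩
    filter_upwards [eventually_window_le (eventually_ceil_mul_le hβ0 hβ K)] with p hp
    exact hK (fun _ => θ) (fun _ => abar A C L) (fun _ => L) 0 (fun _ _ => hc)
      (fun _ _ => by rwa [hfix]) (fun t => θ • 1 + Ω p.1 t) p.1 (hterm p.1) (hrec p.1) p.2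
      (Nat.zero_le _) hp

theorem tendsto_backward (h : BackwardBounds y₁ y₂ ρ ℓ w δ θ) (hY1 : y₁ • 1 ≤ Y) (hY : Y ≤ y₂ • 1)
    (hc : IsAdmissible Y ρ ℓ θ θ (abar A C L) L) (hW : InRegion Y y₂ w θ W)
    (hfix : bwd θ (abar A C L) L W = W) {Ls : ℕ → Matrix (Fin n) (Fin m) ℝ} {θs : ℕ → ℝ}
    (hL : Tendsto Ls atTop (𝓝 L)) (hθ : Tendsto θs atTop (𝓝 θ))
    (hadm : ∀ᶠ t in atTop, IsAdmissible Y ρ ℓ θ (θs (t - 1)) (abar A C (Ls t)) (Ls t))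
    {Ω Ws : ℕ → ℕ → Matrix (Fin n) (Fin n) ℝ} (hΩ : ∀ N, IsBackward A C Ls θs N (Ω N))
    (hWs : ∀ N t, Ws N (t + 1) = θs t • 1 + Ω N (t + 1)) {lo hi : ℕ → ℕ}
    (hlo : Tendsto lo atTop atTop) (hhi : ∀ K, ∀ᶠ N in atTop, hi N + K ≤ N + 1) :
    (∀ᶠ N : ℕ in atTop, ∀ t, lo N ≤ t → t ≤ N →
      (1 - (Ls t)ᵀ * Ws N (t + 1) * Ls t).PosDef) ∧
    Tendsto (fun p : ℕ × ℕ => Ws p.1 p.2) (window lo hi) (𝓝 W) ∧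
    Tendsto (fun p : ℕ × ℕ => Ws p.1 (p.2 + 1)) (window lo hi) (𝓝 W) := by
  -- Times $t\ge1$ only: $W_0$ is not prescribed when the coefficients vary.
  obtain ⟨T, hT⟩ := eventually_atTop.1 (hadm.and (eventually_ge_atTop 1))
  have hc' : ∀ t ≥ T, IsAdmissible Y ρ ℓ θ (θs (t - 1)) (abar A C (Ls t)) (Ls t) :=
    fun t ht => (hT t ht).1
  have hpos : ∀ t ≥ T, 1 ≤ t := fun t ht => (hT t ht).2
  have hterm : ∀ N, T ≤ N + 1 → InRegion Y y₂ w θ (Ws N (N + 1)) := by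
    intro N hN
    have := hc' (N + 1) hN
    rw [hWs, (hΩ N).terminal, add_zero]
    exact h.inRegion_smul_one hY1 this.q_ge this.q_le
  have hrec : ∀ N t, T ≤ t → t ≤ N → InRegion Y y₂ w θ (Ws N (t + 1)) →
      Ws N t = bwd (θs (t - 1)) (abar A C (Ls t)) (Ls t) (Ws N (t + 1)) := by
    intro N t hTt ht hr
    obtain ⟨s, rfl⟩ : ∃ s, t = s + 1 := ⟨t - 1, by have := hpos t hTt; omega⟩
    rw [hWs N s]
    exact (hΩ N).eq_bwd ht (hWs N _) (h.posDef hr) (h.posDef_sub hY (hc' _ hTt) hr)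
  have hreg := fun N (hN : T ≤ N + 1) => h.inRegion_of_recursion (V := Ws N) hY1 hY hc'
    (hterm N hN) (hrec N)
  have hlim : Tendsto (fun t => bwd (θs (t - 1)) (abar A C (Ls t)) (Ls t) W) atTop (𝓝 W) := by
    have := tendsto_bwd (hθ.comp (tendsto_sub_atTop_nat 1)) (tendsto_abar (A := A) (C := C) hL) hL
      (tendsto_const_nhds (x := W)) (h.posDef hW) (h.posDef_sub hY hc hW)
    rwa [hfix] at this
  have hinner : ∀ ε : ℝ, 0 < ε → ∃ T' K : ℕ, ∀ N t, T' ≤ t → t + K ≤ N + 1 →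
      RatioLe (1 + ε) (Ws N t) W := by
    intro ε hε
    obtain ⟨η, hη, K, hK⟩ := h.exists_interior_ratioLe hY1 hY hW (m := m) hε
    have hsymm : ∀ᶠ t in atTop, (bwd (θs (t - 1)) (abar A C (Ls t)) (Ls t) W)ᵀ =
        bwd (θs (t - 1)) (abar A C (Ls t)) (Ls t) W := by
      filter_upwards [hadm] with t ht
      exact (h.posDef (h.inRegion_bwd hY1 hY ht hW)).transpose_eq
    obtain ⟨T', hT'⟩ := eventually_atTop.1
      (eventually_ratioLe_of_tendsto (h.posDef hW) hlim hsymm hη)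
    refine ⟨max T T', K, fun N t ht htK => ?_⟩
    exact hK _ _ _ (max T T') (fun s hs => hc' s (le_of_max_le_left hs))
      (fun s hs => hT' s (le_of_max_le_right hs)) (Ws N) N
      (hterm N (by have := le_of_max_le_left ht; omega))
      (fun s hs => hrec N s (le_of_max_le_left hs)) t ht htK
  refine ⟨?_, ?_, ?_⟩
  · filter_upwards [hlo.eventually_ge_atTop T] with N hN t ht htN
    have hTt : T ≤ t := hN.trans ht
    have hr := hreg N (by omega) (t + 1) (by omega) (by omega)
    exact posDef_one_sub (h.posDef hr) (h.posDef_sub hY (hc' t hTt) hr)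
  · refine tendsto_of_forall_ratioLe (h.posDef hW).nonneg fun ε hε => ?_
    obtain ⟨T', K, hK⟩ := hinner ε hε
    filter_upwards [(tendsto_snd_window hlo).eventually_ge_atTop T', eventually_window_le (hhi K)]
      with p hp1 hp2
    exact hK _ _ hp1 hp2
  · refine tendsto_of_forall_ratioLe (h.posDef hW).nonneg fun ε hε => ?_
    obtain ⟨T', K, hK⟩ := hinner ε hε
    filter_upwards [(tendsto_snd_window hlo).eventually_ge_atTop T',
      eventually_window_le (hhi (K + 1))] with p hp1 hp2
    exact hK _ _ (by omega) (by omega)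

end BackwardBounds

theorem gain_mul_transpose_le_smul_one (hR : R.PosDef) {P : Matrix (Fin n) (Fin n) ℝ}
    (hP : P.PosDef) {r M : ℝ} (hr : 0 < r) (hrR : r • 1 ≤ R) (hPM : P ≤ M • 1) :
    gain C R P * (gain C R P)ᵀ ≤ (r⁻¹ * M) • 1 := by
  refine (gain_mul_transpose_le hR hP hr hrR).trans ?_
  rw [mul_smul]
  exact smul_le_smul_of_nonneg_left hPM (inv_nonneg.2 hr.le)

theorem exists_steadyState [NeZero n] (hobs : Observable A C) (hQ : Q.PosDef) (hR : R.PosDef)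
    {θmax : ℝ} (hθmax : 0 < θmax) : ∃ cmax : ℝ, 0 < cmax ∧ ∀ c : ℝ, 0 < c → c ≤ cmax →
      ∃ (θ : ℝ) (P Y : Matrix (Fin n) (Fin n) ℝ) (y₁ y₂ ρ₀ ρ ℓ w δ : ℝ),
        0 < θ ∧ θ ≤ θmax ∧ IsSteady A C Q R θ P ∧ IsRiskParam c (updCov C R P) θ ∧
        steadyCov A C Q R θ = P ∧ BackwardBounds y₁ y₂ ρ ℓ w δ θ ∧ Y.PosDef ∧ y₁ • 1 ≤ Y ∧
        Y ≤ y₂ • 1 ∧ (abar A C (gain C R P))ᵀ * Y * abar A C (gain C R P) ≤ ρ₀ • Y ∧ ρ₀ < ρ ∧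
        gain C R P * (gain C R P)ᵀ ≤ ℓ • 1 ∧
        ∀ P₀ : Matrix (Fin n) (Fin n) ℝ, P₀.PosDef → ∀ Ps θs, IsRun A C Q R c P₀ Ps θs →
          Tendsto Ps atTop (𝓝 P) ∧ Tendsto θs atTop (𝓝 θ) ∧
          ∀ᶠ t in atTop, gain C R (Ps t) * (gain C R (Ps t))ᵀ ≤ ℓ • 1 := by
  obtain ⟨M, z, K, σ, δ', θ₁, hθ₁, hbound⟩ := exists_riccatiBounds hobs hQ hR
  have hb₁ := hbound θ₁ le_rfl
  have hM := hb₁.posM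
  have hz := hb₁.posz
  have hσ := hb₁.one_lt
  obtain ⟨r, hr, hrR⟩ := exists_smul_one_le hR
  -- From $P\le MI\le\sigma Q$ follows $P-Q\le(1-\sigma^{-1})P$, the Lyapunov rate.
  set ρ₀ := 1 - σ⁻¹ with hρ₀
  have hσ1 : σ⁻¹ < 1 := inv_lt_one_of_one_lt₀ hσ
  have hσ0 : 0 < σ⁻¹ := inv_pos.2 (by linarith)
  -- The Lyapunov matrix $Y=(P^+)^{-1}$ satisfies $M^{-1}I\le Y\le z^{-1}I$ for every steady state
  -- in range, so these constants can be fixed before $c$ and $\theta$.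
  obtain ⟨w, δ, θ₂, hθ₂, hback⟩ := exists_backwardBounds (y₁ := M⁻¹) (y₂ := z⁻¹)
    (ρ := (1 + ρ₀) / 2) (ℓ := r⁻¹ * M) (inv_pos.2 hM) (inv_pos.2 hz) (by linarith) (by linarith)
    (by positivity)
  set θ₀ := min (min θ₁ θ₂) (min θmax (1 / (2 * z))) with hθ₀
  have hθ₀0 : 0 < θ₀ := lt_min (lt_min hθ₁ hθ₂) (lt_min hθmax (by positivity))
  have hle1 : θ₀ ≤ θ₁ := (min_le_left _ _).trans (min_le_left _ _)
  have hle2 : θ₀ ≤ θ₂ := (min_le_left _ _).trans (min_le_right _ _)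
  have hle3 : θ₀ ≤ θmax := (min_le_right _ _).trans (min_le_left _ _)
  have hle4 : θ₀ ≤ 1 / (2 * z) := (min_le_right _ _).trans (min_le_right _ _)
  have hzθ : θ₀ * z < 1 := by
    rw [le_div_iff₀ (by positivity)] at hle4
    linarith
  have hb := hbound θ₀ hle1
  obtain ⟨c₀, hc₀, htol⟩ := exists_tolerance (n := n) hz hθ₀0 hzθ
  refine ⟨c₀, hc₀, fun c hc hcc => ?_⟩
  -- Any initial covariance would do; this auxiliary run starts at $Q$ and only serves to produce
  -- the limit.
  obtain ⟨Ps, θs, hrun⟩ := exists_isRun (A := A) (C := C) hQ hR hc hQ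
  obtain ⟨P, θ, hsteady, hreg⟩ :=
    (hrun.isRegularRun hb hQ hR hQ (htol c hcc)).exists_limit hc hb hQ hR
  have hrisk := hreg.risk 0
  have hθ := hreg.θ_le 0
  have hPM := hreg.upper 0
  have hlow := hreg.lower 0
  have hX := posDef_updCov (C := C) hR hsteady.posDef
  refine ⟨θ, P, (updCov C R P)⁻¹, M⁻¹, z⁻¹, ρ₀, (1 + ρ₀) / 2, r⁻¹ * M, w, δ, hrisk.pos,
    hθ.trans hle3, hsteady, hrisk, hb.steadyCov_eq hQ hR hrisk.pos.le hθ hsteady,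
    hback θ hrisk.pos (hθ.trans hle2), hX.inv, ?_, ?_, ?_, by linarith,
    gain_mul_transpose_le_smul_one hR hsteady.posDef hr hrR hPM, fun P₀ hP₀ Ps θs hrun => ?_⟩
  · rw [← inv_smul_one]
    exact inv_antitone hX ((updCov_le hR hsteady.posDef).trans hPM)
  · rw [← inv_smul_one]
    exact inv_antitone (posDef_smul_one hz) (hb.upd_ge.trans (updCov_mono hR hQ hlow))
  · refine hsteady.abar_lyapunov hR hrisk.pos.le (by linarith) ?_
    have h1 := smul_le_smul_of_nonneg_left (hPM.trans hb.ratio) hσ0.le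
    rw [smul_smul, inv_mul_cancel₀ (by linarith), one_smul] at h1
    rw [hρ₀, sub_smul, one_smul]
    exact sub_le_sub_left h1 _
  · have hr' := hrun.isRegularRun hb hQ hR hP₀ (htol c hcc)
    obtain ⟨h1, h2⟩ := hr'.tendsto hreg hb hQ hR
    refine ⟨(tendsto_add_atTop_iff_nat (n + 1)).1 h1, (tendsto_add_atTop_iff_nat (n + 1)).1 h2, ?_⟩
    filter_upwards [eventually_ge_atTop (n + 1)] with t ht
    obtain ⟨s, rfl⟩ : ∃ s, t = s + (n + 1) := ⟨t - (n + 1), by omega⟩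
    exact gain_mul_transpose_le_smul_one hR (posDef_of_le hQ (hr'.lower s)) hr hrR (hr'.upper s)

end Main

end URKF

end

theorem proposition1 {n m : ℕ} (hn : 0 < n)
    (A : Matrix (Fin n) (Fin n) ℝ) (C : Matrix (Fin m) (Fin n) ℝ)
    (Q : Matrix (Fin n) (Fin n) ℝ) (R : Matrix (Fin m) (Fin m) ℝ)
    (hQ : Q.PosDef) (hR : R.PosDef) (hobs : URKF.Observable A C)
    (θmax : ℝ) (hθmax : 0 < θmax)
    (hf : ContinuousOn (URKF.steadyMap A C Q R) (Set.Icc 0 θmax)) :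
    ∃ cmax : ℝ, 0 < cmax ∧ ∀ c : ℝ, 0 < c → c ≤ cmax →
      ∃ (θ : ℝ) (P : Matrix (Fin n) (Fin n) ℝ) (L : Matrix (Fin n) (Fin m) ℝ)
        (W : Matrix (Fin n) (Fin n) ℝ),
        -- the steady state of the filter
        0 < θ ∧ θ ≤ θmax ∧ URKF.IsSteady A C Q R θ P ∧
        URKF.IsRiskParam c (URKF.updCov C R P) θ ∧
        L = URKF.gain C R P ∧ URKF.steadyMap A C Q R θ = (URKF.abar A C L, L) ∧
        -- the steady state backward recursion
        W.PosDef ∧ (1 - Lᵀ * W * L).PosDef ∧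
        (∀ Ω : ℕ → ℕ → Matrix (Fin n) (Fin n) ℝ,
          (∀ N, URKF.IsBackward A C (fun _ => L) (fun _ => θ) N (Ω N)) →
          (∀ N, ∀ t ≤ N, (1 - Lᵀ * (θ • 1 + Ω N (t + 1)) * L).PosDef) ∧
          ∀ β : ℝ, 0 < β → β < 1 →
            URKF.ConvergesOn (fun _ => 0) (fun N => ⌈β * N⌉₊) (fun N t => θ • 1 + Ω N t) W) ∧
        -- stability
        (∀ J : Matrix (Fin n) (Fin m) ℝ,
          J = (URKF.abar A C L)ᵀ * W * L * (Lᵀ * W * L - 1)⁻¹ →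
          URKF.Stable (URKF.abar A C L - L * Jᵀ)) ∧
        -- the filter and the least favorable model over `{0, …, N}`, for any initial covariance
        ∀ P₀ : Matrix (Fin n) (Fin n) ℝ, P₀.PosDef →
          (∃ Ps θs, URKF.IsRun A C Q R c P₀ Ps θs) ∧
          ∀ (Ps : ℕ → Matrix (Fin n) (Fin n) ℝ) (θs : ℕ → ℝ)
            (Ls : ℕ → Matrix (Fin n) (Fin m) ℝ),
            URKF.IsRun A C Q R c P₀ Ps θs → (∀ t, Ls t = URKF.gain C R (Ps t)) →
            Tendsto Ps atTop (𝓝 P) ∧ Tendsto θs atTop (𝓝 θ) ∧ Tendsto Ls atTop (𝓝 L) ∧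
            ∀ Ω Ws : ℕ → ℕ → Matrix (Fin n) (Fin n) ℝ,
              (∀ N, URKF.IsBackward A C Ls θs N (Ω N)) →
              (∀ N t, Ws N (t + 1) = θs t • 1 + Ω N (t + 1)) →
              ∀ α β : ℝ, 0 < α → α < β → β < 1 →
                (∀ᶠ N : ℕ in atTop, ∀ t, ⌊α * N⌋₊ ≤ t → t ≤ N →
                  (1 - (Ls t)ᵀ * Ws N (t + 1) * Ls t).PosDef) ∧
                URKF.ConvergesOn (fun N => ⌊α * N⌋₊) (fun N => ⌈β * N⌉₊) Ws W ∧
                URKF.ConvergesOn (fun N => ⌊α * N⌋₊) (fun N => ⌈β * N⌉₊)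
                  (fun N t => URKF.lfA A C (Ls t) (Ws N (t + 1))) (URKF.lfA A C L W) ∧
                URKF.ConvergesOn (fun N => ⌊α * N⌋₊) (fun N => ⌈β * N⌉₊)
                  (fun N t => URKF.lfC A C (Ls t) (Ws N (t + 1))) (URKF.lfC A C L W) ∧
                ∀ S : Matrix (Fin m) (Fin m) ℝ → Matrix (Fin m) (Fin m) ℝ, URKF.IsSqrtMap S →
                  URKF.ConvergesOn (fun N => ⌊α * N⌋₊) (fun N => ⌈β * N⌉₊)
                    (fun N t => URKF.lfB (Ls t) (S (URKF.lfO (Ls t) (Ws N (t + 1)))))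
                    (URKF.lfB L (S (URKF.lfO L W))) ∧
                  URKF.ConvergesOn (fun N => ⌊α * N⌋₊) (fun N => ⌈β * N⌉₊)
                    (fun N t => URKF.lfD n (S (URKF.lfO (Ls t) (Ws N (t + 1)))))
                    (URKF.lfD n (S (URKF.lfO L W))) := by
  have : NeZero n := ⟨hn.ne'⟩
  obtain ⟨cmax, hcmax, H⟩ := URKF.exists_steadyState hobs hQ hR hθmax
  refine ⟨cmax, hcmax, fun c hc hcc => ?_⟩
  obtain ⟨θ, P, Y, y₁, y₂, ρ₀, ρ, ℓ, w, δ, hθ, hθle, hsteady, hrisk, hcov, hb, hYp, hY1, hY2, hlyap,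
    hρ, hgain, hruns⟩ := H c hc hcc
  -- Constant sequences specialize the asymptotic statement to the steady coefficients.
  have hadm := (URKF.eventually_isAdmissible hYp hlyap hρ hθ tendsto_const_nhds
    tendsto_const_nhds (Eventually.of_forall fun _ : ℕ => hgain)).exists.choose_spec
  obtain ⟨W, hW, hfix⟩ := hb.exists_fixedPoint hY1 hY2 hadm
  have hWp := hb.posDef hW
  have hD := hb.posDef_sub hY2 hadm hW
  have hO := URKF.posDef_one_sub hWp hD
  refine ⟨θ, P, URKF.gain C R P, W, hθ, hθle, hsteady, hrisk, rfl, ?_, hWp, hO, fun Ω hΩ =>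
    hb.steady_backward hY1 hY2 hadm hW hfix hΩ, fun J hJ =>
    hb.stable_feedback hYp.nonneg hY2 hadm hW hfix hJ, fun P₀ hP₀ =>
    ⟨URKF.exists_isRun hQ hR hc hP₀, fun Ps θs Ls hrun hLs => ?_⟩⟩
  · rw [URKF.steadyMap, hcov]
  obtain ⟨hPs, hθs, hgains⟩ := hruns P₀ hP₀ Ps θs hrun
  have hLlim : Tendsto Ls atTop (𝓝 (URKF.gain C R P)) :=
    (URKF.tendsto_gain hR hsteady.posDef hPs).congr fun t => (hLs t).symm
  refine ⟨hPs, hθs, hLlim, fun Ω Ws hΩ hWs α β hα hαβ hβ => ?_⟩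
  have hadms := URKF.eventually_isAdmissible hYp hlyap hρ hθ hLlim hθs
    (hgains.mono fun t ht => by rwa [hLs t])
  have hlo := URKF.tendsto_floor_mul hα
  have hhi := URKF.eventually_ceil_mul_le (hα.trans hαβ) hβ
  obtain ⟨hpd, hW0, hW1⟩ := hb.tendsto_backward hY1 hY2 hadm hW hfix hLlim hθs hadms hΩ hWs hlo hhi
  have hL1 := hLlim.comp (URKF.tendsto_snd_window (hi := fun N => ⌈β * N⌉₊) hlo)
  have hev : ∀ᶠ p in URKF.window (fun N => ⌊α * N⌋₊) (fun N => ⌈β * N⌉₊),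
      (1 - (Ls p.2)ᵀ * Ws p.1 (p.2 + 1) * Ls p.2).PosDef := by
    refine URKF.eventually_window.2 ?_
    -- The choice $K=1$ gives $\lceil\beta N\rceil\le N$, so the window lies inside the horizon.
    filter_upwards [hpd, hhi 1] with N h1 h2 t ht ht'
    exact h1 t ht (by omega)
  refine ⟨hpd, URKF.convergesOn_iff.2 hW0, URKF.convergesOn_iff.2 (URKF.tendsto_lfA hL1 hW1 hO),
    URKF.convergesOn_iff.2 (URKF.tendsto_lfC hL1 hW1 hO), fun S hS => ?_⟩
  have hSlim := hS.tendsto_lfO hL1 hW1 hO hev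
  exact ⟨URKF.convergesOn_iff.2 (URKF.tendsto_lfB hL1 hSlim),
    URKF.convergesOn_iff.2 (URKF.tendsto_lfD hSlim)⟩
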